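/- Let $I\subseteq\mathbb R$ be a nonempty open interval and let $\sigma\colon I\to\mathbb R$ be smooth with no zeros. Consider the equation $$(u_t+uu_x+u_{xx})_x+\sigma(t)u_{yy}=0,\qquad t\in I,\ (x,y)\in\mathbb R^2. \tag{E$_\sigma$}$$ A Lie point symmetry of (E$_\sigma$) is a smooth vector field $V=\tau\partial_t+\xi\partial_x+\eta\partial_y+\phi\,\partial_u$ on $\{(t,x,y,u):t\in I\}$, with coefficients depending on $(t,x,y,u)$, whose third prolongation annihilates the equation at all jets that satisfy the equation. For smooth $f,g$ on $I$ put $$X(f)=f\partial_x+f'\partial_u,\qquad Y(g)=g\,\partial_y-\frac{g'}{2\sigma}\,y\,\partial_x-\Bigl(\frac{g'}{2\sigma}\Bigr)'y\,\partial_u .$$ The equivalence transformations on $I$ are $$\tilde t=\frac{at+b}{ct+d},\qquad \tilde x=\frac{\varepsilon\sqrt\Delta}{ct+d}x-\frac{\varepsilon\sqrt\Delta}{2Y_1}\frac{Y_0'}{(ct+d)\sigma}y+\beta_0,\qquad \tilde y=Y_1y+Y_0,$$ $$u=\frac{\varepsilon\sqrt\Delta}{ct+d}\tilde u+\frac{c}{ct+d}x+\frac1{2Y_1}\Bigl(\frac{Y_0''}{\sigma}-\frac{c}{ct+d}\frac{Y_0'}{\sigma}-\frac{Y_0'\sigma'}{\sigma^2}\Bigr)y-\frac{(Y_0')^2}{4Y_1^2\sigma}-\frac{\varepsilon}{\sqrt\Delta}(ct+d)\beta_0',$$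 where $a,b,c,d\in\mathbb R$, $\Delta=ad-bc>0$, $ct+d\ne0$ on $I$, $\varepsilon=\pm1$, $Y_1\neq0$, and $Y_0,\beta_0$ are smooth functions of $t$ on $I$. Such a transformation takes $(I,\sigma)$ to $(\tilde I,\tilde\sigma)$, where $\tilde I$ is the image of $I$ under $t\mapsto\tilde t$ and $\tilde\sigma(\tilde t)=\varepsilon\Delta^{-3/2}Y_1^2(ct+d)^3\sigma(t)$. 1. For every $\sigma$ the Lie point symmetries of (E$_\sigma$) form a Lie algebra $L$. The span $N$ of all $X(f)$ and $Y(g)$ is an infinite-dimensional nilpotent ideal of $L$, and $L$ is the semidirect sum of some subalgebra and $N$. 2. $L\neq N$ if and only if some equivalence transformation takes $(I,\sigma)$ to some $(\tilde I,\tilde\sigma)$ with $\tilde\sigma$ in one of the following four families, where $\sigma_0=\pm1$; if $L\ne N$, this transformation can be chosen so that it transforms (E$_\sigma$) into (E$_{\tilde\sigma}$). No $(I,\sigma)$ can be taken to members of two different families. - (a) $\tilde\sigma=\sigma_0$; - (b) $\tilde\sigma=\sigma_0t^s$ with $\tilde I\subseteq(0,\infty)$, $s\in\mathbb R$, $s\ne0,-3$;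 - (c) $\tilde\sigma=\sigma_0e^{\kappa t}$ with $\kappa=\pm1$; - (d) $\tilde\sigma=\sigma_0(1+t^2)^{-3/2}e^{s\arctan t}$, $s\in\mathbb R$. 3. If $\sigma$ itself belongs to one of these families, then $L$ is the semidirect sum of the ideal $N$ and the Lie algebra with the following basis: - (a) $T_0=\partial_t$ and $D_0=2t\partial_t+x\partial_x+\tfrac32y\partial_y-u\partial_u$; - (b) $D(s)=2t\partial_t+x\partial_x+\tfrac{2s+3}{2}y\partial_y-u\partial_u$; - (c) $T_\kappa=\partial_t+\tfrac{\kappa}{2}y\partial_y$; - (d) $C(s)=(1+t^2)\partial_t+xt\,\partial_x+\tfrac s2y\partial_y+(x-tu)\partial_u$. -/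

import Mathlib

open Set VectorField
open scoped ContDiff Topology

noncomputable section

/-! ## Smooth functions of time and the coefficient of the equation -/

/-- A smooth real function on the open set `I` of times (its values outside `I` are irrelevant). -/
structure SmoothFn (I : TopologicalSpace.Opens ℝ) where
  toFun : ℝ → ℝ
  smooth : ContDiffOn ℝ ∞ toFun I

/-- An admissible coefficient `σ`: smooth and nowhere zero on `I`. -/
structure Coeff (I : TopologicalSpace.Opens ℝ) extends SmoothFn I where
  ne_zero : ∀ t ∈ I, toFun t ≠ 0

/-! ## The Lie algebra of smooth vector fields on `I × ℝ³`

A point of the space of independent and dependent variables is `p = ![t, x, y, u]`. -/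

/-- The domain `{(t, x, y, u) : t ∈ I}`. -/
def strip (I : TopologicalSpace.Opens ℝ) : Set (Fin 4 → ℝ) := {p | p 0 ∈ I}

theorem isOpen_strip (I : TopologicalSpace.Opens ℝ) : IsOpen (strip I) :=
  I.isOpen.preimage (continuous_apply 0)

/-- Smooth vector fields `τ ∂_t + ξ ∂_x + η ∂_y + φ ∂_u` on `strip I`, where
`V p = ![τ, ξ, η, φ]`.  So that equality is equality on `strip I`, a field is represented by the
function that vanishes outside `strip I`. -/
def smoothFields (I : TopologicalSpace.Opens ℝ) :
    Submodule ℝ ((Fin 4 → ℝ) → (Fin 4 → ℝ)) where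
  carrier := {V | ContDiffOn ℝ ∞ V (strip I) ∧ ∀ p, p ∉ strip I → V p = 0}
  add_mem' := by
    rintro V W ⟨hV, hV'⟩ ⟨hW, hW'⟩
    exact ⟨hV.add hW, fun p hp => by simp [hV' p hp, hW' p hp]⟩
  zero_mem' := ⟨contDiffOn_const, fun _ _ => rfl⟩
  smul_mem' := by
    rintro c V ⟨hV, hV'⟩
    exact ⟨hV.const_smul c, fun p hp => by simp [hV' p hp]⟩

/-- The type of smooth vector fields on `strip I`. -/
abbrev VF (I : TopologicalSpace.Opens ℝ) : Type := smoothFields I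

/-- The smooth vector field on `strip I` given by a formula that is smooth there. -/
def VF.mk {I : TopologicalSpace.Opens ℝ} (v : (Fin 4 → ℝ) → (Fin 4 → ℝ))
    (hv : ContDiffOn ℝ ∞ v (strip I)) : VF I :=
  ⟨(strip I).indicator v, hv.congr fun _ hp => Set.indicator_of_mem hp v,
    fun _ hp => Set.indicator_of_notMem hp v⟩

/-- The usual commutator `[V, W] = V(W) - W(V)` of vector fields. -/
instance (I : TopologicalSpace.Opens ℝ) : Bracket (VF I) (VF I) where
  bracket V W := VF.mk (lieBracketWithin ℝ V.1 W.1 (strip I))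
    (V.2.1.lieBracketWithin_vectorField W.2.1 (isOpen_strip I).uniqueDiffOn (by simp))

theorem VF.bracket_apply {I : TopologicalSpace.Opens ℝ} (V W : VF I) {p : Fin 4 → ℝ}
    (hp : p ∈ strip I) : (⁅V, W⁆ : VF I).1 p = lieBracketWithin ℝ V.1 W.1 (strip I) p :=
  Set.indicator_of_mem hp _

theorem VF.ext_on {I : TopologicalSpace.Opens ℝ} {V W : VF I}
    (h : ∀ p ∈ strip I, V.1 p = W.1 p) : V = W := by
  apply Subtype.ext
  funext p
  by_cases hp : p ∈ strip I
  · exact h p hp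
  · rw [V.2.2 p hp, W.2.2 p hp]

theorem VF.differentiableWithinAt {I : TopologicalSpace.Opens ℝ} (V : VF I) {p : Fin 4 → ℝ}
    (hp : p ∈ strip I) : DifferentiableWithinAt ℝ V.1 (strip I) p :=
  (V.2.1 p hp).differentiableWithinAt (by simp)

instance (I : TopologicalSpace.Opens ℝ) : LieRing (VF I) where
  add_lie U V W := VF.ext_on fun p hp => by
    have := lieBracketWithin_add_left (W := W.1) (U.differentiableWithinAt hp)
      (V.differentiableWithinAt hp) ((isOpen_strip I).uniqueDiffWithinAt hp)
    simpa [VF.bracket_apply _ _ hp] using this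
  lie_add U V W := VF.ext_on fun p hp => by
    have := lieBracketWithin_add_right (V := U.1) (V.differentiableWithinAt hp)
      (W.differentiableWithinAt hp) ((isOpen_strip I).uniqueDiffWithinAt hp)
    simpa [VF.bracket_apply _ _ hp] using this
  lie_self V := VF.ext_on fun p hp => by
    simp [VF.bracket_apply _ _ hp]
  leibniz_lie U V W := VF.ext_on fun p hp => by
    have hc : ∀ A B : VF I, EqOn (⁅A, B⁆ : VF I).1 (lieBracketWithin ℝ A.1 B.1 (strip I))
        (strip I) := fun A B q hq => VF.bracket_apply A B hq
    have key := leibniz_identity_lieBracketWithin (𝕜 := ℝ) (n := ∞)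
      (by simpa using (WithTop.coe_le_coe.2 le_top : ((2 : ℕ∞) : WithTop ℕ∞) ≤ ((⊤ : ℕ∞) : WithTop ℕ∞)))
      (isOpen_strip I).uniqueDiffOn
      (subset_closure ((isOpen_strip I).interior_eq.symm ▸ hp)) hp
      (U.2.1 p hp) (V.2.1 p hp) (W.2.1 p hp)
    have e : ∀ A B : VF I, (A + B).1 p = A.1 p + B.1 p := fun _ _ => rfl
    rw [e, VF.bracket_apply _ _ hp, VF.bracket_apply _ _ hp, VF.bracket_apply _ _ hp,
      lieBracketWithin_congr' (fun q _ => rfl) (hc V W) hp,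
      lieBracketWithin_congr' (hc U V) (fun q _ => rfl) hp,
      lieBracketWithin_congr' (fun q _ => rfl) (hc U W) hp]
    exact key

instance (I : TopologicalSpace.Opens ℝ) : LieAlgebra ℝ (VF I) where
  lie_smul c V W := VF.ext_on fun p hp => by
    have := lieBracketWithin_const_smul_right (V := V.1) (c := c) (W.differentiableWithinAt hp)
      ((isOpen_strip I).uniqueDiffWithinAt hp)
    simpa [VF.bracket_apply _ _ hp] using this

/-! ## The equation `(u_t + u u_x + u_xx)_x + σ(t) u_yy = 0`

The independent variables are `p = ![t, x, y]`, with indices `0`, `1`, `2`. -/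

/-- Partial derivative with respect to the `i`-th independent variable. -/
def pd (i : Fin 3) (u : (Fin 3 → ℝ) → ℝ) : (Fin 3 → ℝ) → ℝ :=
  fun p => fderiv ℝ u p (Pi.single i 1)

/-- Iterated partial derivative `u_J`, for example `u_tx = pdList [0, 1] u`. -/
def pdList (J : List (Fin 3)) (u : (Fin 3 → ℝ) → ℝ) : (Fin 3 → ℝ) → ℝ :=
  J.foldr pd u

/-- The left-hand side of the equation, evaluated on a function `u` at `p`. -/
def gKZK (σ : ℝ → ℝ) (u : (Fin 3 → ℝ) → ℝ) (p : Fin 3 → ℝ) : ℝ :=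
  pd 1 (fun q => pd 0 u q + u q * pd 1 u q + pd 1 (pd 1 u) q) p + σ (p 0) * pd 2 (pd 2 u) p

/-! ## Prolongation and point symmetries -/

/-- The point `(t, x, y, u(t, x, y))` of the graph of `u`. -/
def graphPt (u : (Fin 3 → ℝ) → ℝ) (p : Fin 3 → ℝ) : Fin 4 → ℝ := ![p 0, p 1, p 2, u p]

/-- The characteristic `Q = φ - τ u_t - ξ u_x - η u_y` of a vector field along `u`. -/
def characteristic (V : (Fin 4 → ℝ) → (Fin 4 → ℝ)) (u : (Fin 3 → ℝ) → ℝ) (p : Fin 3 → ℝ) : ℝ :=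
  V (graphPt u p) 3 - ∑ i : Fin 3, V (graphPt u p) i.castSucc * pd i u p

/-- The coefficient `φ^J = D_J Q + τ u_{J,t} + ξ u_{J,x} + η u_{J,y}` of `∂/∂u_J` in the
prolongation of `V`, evaluated at the jet of `u` at `p`. -/
def prolongCoeff (V : (Fin 4 → ℝ) → (Fin 4 → ℝ)) (J : List (Fin 3)) (u : (Fin 3 → ℝ) → ℝ)
    (p : Fin 3 → ℝ) : ℝ :=
  pdList J (characteristic V u) p + ∑ i : Fin 3, V (graphPt u p) i.castSucc * pdList (i :: J) u p

/-- The third prolongation of `V` applied to the left-hand side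
`u_tx + u_x² + u u_xx + u_xxx + σ(t) u_yy`, evaluated at the jet of `u` at `p`. -/
def prolongGKZK (σ : ℝ → ℝ) (V : (Fin 4 → ℝ) → (Fin 4 → ℝ)) (u : (Fin 3 → ℝ) → ℝ)
    (p : Fin 3 → ℝ) : ℝ :=
  V (graphPt u p) 0 * deriv σ (p 0) * pdList [2, 2] u p
    + prolongCoeff V [] u p * pdList [1, 1] u p
    + 2 * pdList [1] u p * prolongCoeff V [1] u p
    + prolongCoeff V [0, 1] u p
    + u p * prolongCoeff V [1, 1] u p
    + prolongCoeff V [1, 1, 1] u p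
    + σ (p 0) * prolongCoeff V [2, 2] u p

/-- The infinitesimal invariance criterion: the third prolongation of `V` annihilates the equation
at every jet (realized by a smooth `u` at a point `p`) that satisfies the equation. -/
def IsPointSymmetry {I : TopologicalSpace.Opens ℝ} (σ : Coeff I) (V : VF I) : Prop :=
  ∀ u : (Fin 3 → ℝ) → ℝ, ContDiff ℝ ∞ u → ∀ p : Fin 3 → ℝ, p 0 ∈ I →
    gKZK σ.toFun u p = 0 → prolongGKZK σ.toFun V.1 u p = 0

/-- The Lie point symmetry algebra: the Lie algebra generated by all infinitesimal point
symmetries. -/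
def symmetryAlgebra {I : TopologicalSpace.Opens ℝ} (σ : Coeff I) : LieSubalgebra ℝ (VF I) :=
  LieSubalgebra.lieSpan ℝ (VF I) {V | IsPointSymmetry σ V}

/-! ## The vector fields of the classification -/

theorem contDiffOn_apply_strip {I : TopologicalSpace.Opens ℝ} (i : Fin 4) :
    ContDiffOn ℝ ∞ (fun p : Fin 4 → ℝ => p i) (strip I) :=
  (contDiff_apply ℝ ℝ i).contDiffOn

theorem contDiffOn_time {I : TopologicalSpace.Opens ℝ} {f : ℝ → ℝ} (hf : ContDiffOn ℝ ∞ f I) :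
    ContDiffOn ℝ ∞ (fun p : Fin 4 → ℝ => f (p 0)) (strip I) :=
  hf.comp (contDiffOn_apply_strip 0) fun _ hp => hp

theorem contDiffOn_deriv {I : TopologicalSpace.Opens ℝ} {f : ℝ → ℝ} (hf : ContDiffOn ℝ ∞ f I) :
    ContDiffOn ℝ ∞ (deriv f) I :=
  hf.deriv_of_isOpen I.isOpen (by simp)

theorem contDiffOn_vec {s : Set (Fin 4 → ℝ)} {a b c d : (Fin 4 → ℝ) → ℝ}
    (ha : ContDiffOn ℝ ∞ a s) (hb : ContDiffOn ℝ ∞ b s) (hc : ContDiffOn ℝ ∞ c s)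
    (hd : ContDiffOn ℝ ∞ d s) : ContDiffOn ℝ ∞ (fun p => ![a p, b p, c p, d p]) s := by
  refine contDiffOn_pi.2 fun i => ?_
  fin_cases i
  · exact ha
  · exact hb
  · exact hc
  · exact hd

/-- `X(f) = f ∂_x + f' ∂_u`. -/
def fieldX {I : TopologicalSpace.Opens ℝ} (f : SmoothFn I) : VF I :=
  VF.mk (fun p => ![0, f.toFun (p 0), 0, deriv f.toFun (p 0)])
    (contDiffOn_vec contDiffOn_const (contDiffOn_time f.smooth) contDiffOn_const
      (contDiffOn_time (contDiffOn_deriv f.smooth)))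

theorem contDiffOn_ratio {I : TopologicalSpace.Opens ℝ} (σ : Coeff I) (g : SmoothFn I) :
    ContDiffOn ℝ ∞ (fun t => deriv g.toFun t / (2 * σ.toFun t)) I :=
  (contDiffOn_deriv g.smooth).div (contDiffOn_const.mul σ.smooth)
    fun t ht => mul_ne_zero two_ne_zero (σ.ne_zero t ht)

/-- `Y(g) = g ∂_y - (g' / (2σ)) y ∂_x - (g' / (2σ))' y ∂_u`. -/
def fieldY {I : TopologicalSpace.Opens ℝ} (σ : Coeff I) (g : SmoothFn I) : VF I :=
  VF.mk (fun p => ![0, -(deriv g.toFun (p 0) / (2 * σ.toFun (p 0))) * p 2, g.toFun (p 0),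
      -deriv (fun t => deriv g.toFun t / (2 * σ.toFun t)) (p 0) * p 2])
    (contDiffOn_vec contDiffOn_const
      ((contDiffOn_time (contDiffOn_ratio σ g)).neg.mul (contDiffOn_apply_strip 2))
      (contDiffOn_time g.smooth)
      ((contDiffOn_time (contDiffOn_deriv (contDiffOn_ratio σ g))).neg.mul
        (contDiffOn_apply_strip 2)))

/-- `T_0 = ∂_t`. -/
def fieldT0 (I : TopologicalSpace.Opens ℝ) : VF I :=
  VF.mk (fun _ => ![1, 0, 0, 0]) contDiffOn_const

/-- `D(s) = 2t ∂_t + x ∂_x + ((2s + 3) / 2) y ∂_y - u ∂_u`. -/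
def fieldD (I : TopologicalSpace.Opens ℝ) (s : ℝ) : VF I :=
  VF.mk (fun p => ![2 * p 0, p 1, (2 * s + 3) / 2 * p 2, -p 3])
    (contDiffOn_vec (by fun_prop) (by fun_prop) (by fun_prop) (by fun_prop))

/-- `T_κ = ∂_t + (κ / 2) y ∂_y`. -/
def fieldT (I : TopologicalSpace.Opens ℝ) (κ : ℝ) : VF I :=
  VF.mk (fun p => ![1, 0, κ / 2 * p 2, 0])
    (contDiffOn_vec (by fun_prop) (by fun_prop) (by fun_prop) (by fun_prop))

/-- `C(s) = (1 + t²) ∂_t + x t ∂_x + (s / 2) y ∂_y + (x - t u) ∂_u`. -/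
def fieldC (I : TopologicalSpace.Opens ℝ) (s : ℝ) : VF I :=
  VF.mk (fun p => ![1 + p 0 ^ 2, p 1 * p 0, s / 2 * p 2, p 1 - p 0 * p 3])
    (contDiffOn_vec (by fun_prop) (by fun_prop) (by fun_prop) (by fun_prop))

/-- The set of all `X(f)` and `Y(g)`. -/
def genericFields {I : TopologicalSpace.Opens ℝ} (σ : Coeff I) : Set (VF I) :=
  range fieldX ∪ range (fieldY σ)

/-- The Lie algebra generated by all `X(f)` and `Y(g)`. -/
def genericAlgebra {I : TopologicalSpace.Opens ℝ} (σ : Coeff I) : LieSubalgebra ℝ (VF I) :=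
  LieSubalgebra.lieSpan ℝ (VF I) (genericFields σ)

/-- `L` is the (internal) semidirect sum of the subalgebra `S` and the ideal `N`. -/
def IsSemidirectSum {𝔤 : Type*} [LieRing 𝔤] [LieAlgebra ℝ 𝔤] (L S N : LieSubalgebra ℝ 𝔤) : Prop :=
  N ≤ L ∧ (∀ V ∈ L, ∀ W ∈ N, ⁅V, W⁆ ∈ N) ∧
    Disjoint S.toSubmodule N.toSubmodule ∧ S.toSubmodule ⊔ N.toSubmodule = L.toSubmodule

/-- The symmetry algebra of the equation is the extension of the algebra of the `X(f)`, `Y(g)` by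
the additional basis elements `v`: these are linearly independent, they span a Lie algebra, and
the symmetry algebra is the semidirect sum of that Lie algebra and the ideal
`{X(f), Y(g)}`. -/
def IsExtendedBy {I : TopologicalSpace.Opens ℝ} (σ : Coeff I) {n : ℕ} (v : Fin n → VF I) : Prop :=
  LinearIndependent ℝ v ∧
    (LieSubalgebra.lieSpan ℝ (VF I) (range v)).toSubmodule = Submodule.span ℝ (range v) ∧
    IsSemidirectSum (symmetryAlgebra σ) (LieSubalgebra.lieSpan ℝ (VF I) (range v))
      (genericAlgebra σ)

/-! ## Equivalence transformations -/

/-- The parameters of an element of the equivalence group that is defined on `I × ℝ³`. -/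
structure EquivTransf (I : TopologicalSpace.Opens ℝ) where
  a : ℝ
  b : ℝ
  c : ℝ
  d : ℝ
  ε : ℝ
  Y₁ : ℝ
  Y₀ : SmoothFn I
  β₀ : SmoothFn I
  det_pos : 0 < a * d - b * c
  sign : ε = 1 ∨ ε = -1
  Y₁_ne_zero : Y₁ ≠ 0
  regular : ∀ t ∈ I, c * t + d ≠ 0

namespace EquivTransf

variable {I : TopologicalSpace.Opens ℝ}

/-- `Δ = ad - bc`. -/
def Δ (g : EquivTransf I) : ℝ := g.a * g.d - g.b * g.c

/-- The new time `(at + b) / (ct + d)`. -/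
def newTime (g : EquivTransf I) (t : ℝ) : ℝ := (g.a * t + g.b) / (g.c * t + g.d)

/-- The new independent variables as functions of the old ones. -/
def newPoint (g : EquivTransf I) (σ : Coeff I) (p : Fin 3 → ℝ) : Fin 3 → ℝ :=
  ![g.newTime (p 0),
    g.ε * √g.Δ / (g.c * p 0 + g.d) * p 1
      - g.ε * √g.Δ / (2 * g.Y₁)
          * (deriv g.Y₀.toFun (p 0) / ((g.c * p 0 + g.d) * σ.toFun (p 0))) * p 2
      + g.β₀.toFun (p 0),
    g.Y₁ * p 2 + g.Y₀.toFun (p 0)]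

/-- The old dependent variable `u(t, x, y)` in terms of the new one `v`, as a function of the new
independent variables. -/
def oldFunction (g : EquivTransf I) (σ : Coeff I) (v : (Fin 3 → ℝ) → ℝ) (p : Fin 3 → ℝ) : ℝ :=
  g.ε * √g.Δ / (g.c * p 0 + g.d) * v (g.newPoint σ p)
    + g.c / (g.c * p 0 + g.d) * p 1
    + 1 / (2 * g.Y₁) *
        (deriv (deriv g.Y₀.toFun) (p 0) / σ.toFun (p 0)
          - g.c / (g.c * p 0 + g.d) * (deriv g.Y₀.toFun (p 0) / σ.toFun (p 0))
          - deriv g.Y₀.toFun (p 0) * deriv σ.toFun (p 0) / σ.toFun (p 0) ^ 2) * p 2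
    - 1 / (4 * g.Y₁ ^ 2) * (deriv g.Y₀.toFun (p 0) ^ 2 / σ.toFun (p 0))
    - g.ε / √g.Δ * (g.c * p 0 + g.d) * deriv g.β₀.toFun (p 0)

/-- The transformation takes the interval `I` onto `J` and the coefficient `σ` on `I` to the
coefficient `σ'` on `J`, that is `σ'(T(t)) = ε Δ^(-3/2) Y₁² (ct + d)³ σ(t)`. -/
def Takes (g : EquivTransf I) (σ : Coeff I) {J : TopologicalSpace.Opens ℝ} (σ' : Coeff J) : Prop :=
  (J : Set ℝ) = g.newTime '' I ∧
    ∀ t ∈ I, σ'.toFun (g.newTime t) =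
      g.ε * g.Δ ^ (-(3 / 2) : ℝ) * g.Y₁ ^ 2 * (g.c * t + g.d) ^ 3 * σ.toFun t

/-- The change of variables transforms the equation with coefficient `σ` on `I` into the equation
with coefficient `σ'` on `J`. -/
def MapsEquation (g : EquivTransf I) (σ : Coeff I) {J : TopologicalSpace.Opens ℝ} (σ' : Coeff J) :
    Prop :=
  ∀ v : (Fin 3 → ℝ) → ℝ, ContDiffOn ℝ ∞ v {q | q 0 ∈ J} → ∀ p : Fin 3 → ℝ, p 0 ∈ I →
    (gKZK σ.toFun (g.oldFunction σ v) p = 0 ↔ gKZK σ'.toFun v (g.newPoint σ p) = 0)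

end EquivTransf

/-! ## The list of representatives

In all of them `σ₀ = ±1`. -/

/-- `σ = σ₀` on `I`. -/
def IsConstantCase {I : TopologicalSpace.Opens ℝ} (σ : Coeff I) : Prop :=
  ∃ σ₀ : ℝ, (σ₀ = 1 ∨ σ₀ = -1) ∧ ∀ t ∈ I, σ.toFun t = σ₀

/-- `σ = σ₀ t ^ s` on `I ⊆ (0, ∞)`. -/
def IsPowerCase {I : TopologicalSpace.Opens ℝ} (σ : Coeff I) (s : ℝ) : Prop :=
  ∃ σ₀ : ℝ, (σ₀ = 1 ∨ σ₀ = -1) ∧ ∀ t ∈ I, 0 < t ∧ σ.toFun t = σ₀ * t ^ s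

/-- `σ = σ₀ exp(κ t)` on `I`. -/
def IsExpCase {I : TopologicalSpace.Opens ℝ} (σ : Coeff I) (κ : ℝ) : Prop :=
  ∃ σ₀ : ℝ, (σ₀ = 1 ∨ σ₀ = -1) ∧ ∀ t ∈ I, σ.toFun t = σ₀ * Real.exp (κ * t)

/-- `σ = σ₀ (1 + t²) ^ (-3/2) exp(s arctan t)` on `I`. -/
def IsArctanCase {I : TopologicalSpace.Opens ℝ} (σ : Coeff I) (s : ℝ) : Prop :=
  ∃ σ₀ : ℝ, (σ₀ = 1 ∨ σ₀ = -1) ∧ ∀ t ∈ I,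
    σ.toFun t = σ₀ * (1 + t ^ 2) ^ (-(3 / 2) : ℝ) * Real.exp (s * Real.arctan t)

/-- The four families of coefficients with an extended symmetry algebra. -/
inductive Family
  | constant
  | power
  | exponential
  | arctangent

/-- The members of the four families. -/
def Family.Contains (F : Family) {I : TopologicalSpace.Opens ℝ} (σ : Coeff I) : Prop :=
  match F with
  | .constant => IsConstantCase σ
  | .power => ∃ s : ℝ, s ≠ 0 ∧ s ≠ -3 ∧ IsPowerCase σ s
  | .exponential => ∃ κ : ℝ, (κ = 1 ∨ κ = -1) ∧ IsExpCase σ κ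
  | .arctangent => ∃ s : ℝ, IsArctanCase σ s

end

/-!
The left-hand side of the equation is a polynomial in the third-order jet of `u`, and so is its
derivative along the prolongation of a vector field.  Every jet is realized by a polynomial, hence
the coefficients of the free jet variables vanish separately.  This gives the determining equations
(`IsPointSymmetry.determining`), and conversely they make the prolongation a multiple of the
equation (`Determining.isPointSymmetry`).  To make these computations algebraic, smooth functions on
an open set form a ring `SmoothRing` with commuting derivations, and the chain rule `D_pullback`
supplies total derivatives.

The determining equations integrate to `V = liftField I A B C k + X(f) + Y(g)`, where `liftField`
lifts `τ ∂_t` with `τ = A t² + B t + C`, subject to the single condition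
`τ σ' + 3/2 τ' σ = 2 k σ` of `Admissible` (`isPointSymmetry_iff`).  The commutation relations show
that the `X(f) + Y(g)` are a nilpotent ideal, of class two because `[Y(g), Y(h)]` is some `X(f)` and
the `X(f)` are central in it.  The fields `liftField I A B C k` with admissible `τ` are a
complementary subalgebra: if `τ₁` and `τ₂` are admissible, eliminating `σ'` yields a polynomial
identity whose derivative is the condition for `[τ₁, τ₂]` (`Admissible.bracket`).  Therefore the
algebra is larger than the ideal exactly if there is an admissible `τ ≠ 0`.

Equivalence transformations act on time by Möbius transformations, which transport admissible
fields `τ ∂_t` on the line (`EquivTransf.Takes.admissible_iff`) and preserve the discriminant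
`B² - 4AC`.  The discriminants that occur are all `δ ≥ 0` for the constant family, all `δ > 0` for
the powers, only `0` for the exponentials and all `δ < 0` for the arctangent family, so that the
families are inequivalent (`Family.Contains.hasDisc_iff`).

For an admissible `τ ≠ 0`, a Möbius transformation that puts `τ` into a normal form (two roots, a
double root, no real roots) turns the condition on `σ` into the linear equation that characterizes
one of the families, up to a constant factor that a scaling of `y` reduces to `± 1`
(`EquivTransf.exists_takes`, `Admissible.hasNormalForm`).  A root of `τ` inside `I` forces `k` to a
value for which `σ (ct + d)³` is constant; then `σ` is equivalent to `± 1`.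
-/

noncomputable section

/-! ### The differential ring of smooth functions on an open set -/

/-- The ring of smooth real functions on an open subset `U` of `ℝⁿ`, as a subalgebra of all
functions on the subtype `U`.  Smoothness is that of the extension by zero, on `U`. -/
def SmoothRing {n : ℕ} (U : TopologicalSpace.Opens (Fin n → ℝ)) : Subalgebra ℝ (U → ℝ) where
  carrier := {f | ContDiffOn ℝ ∞ (Function.extend Subtype.val f 0) U}
  mul_mem' {f g} hf hg := (ContDiffOn.mul hf hg).congr fun p hp => by
    have h : ∀ k : U → ℝ, Function.extend Subtype.val k 0 p = k ⟨p, hp⟩ := fun k =>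
      Subtype.val_injective.extend_apply k 0 (⟨p, hp⟩ : U)
    simp [h]
  add_mem' {f g} hf hg := (ContDiffOn.add hf hg).congr fun p hp => by
    have h : ∀ k : U → ℝ, Function.extend Subtype.val k 0 p = k ⟨p, hp⟩ := fun k =>
      Subtype.val_injective.extend_apply k 0 (⟨p, hp⟩ : U)
    simp [h]
  algebraMap_mem' c := contDiffOn_const (c := c) |>.congr fun p hp => by
    have h : ∀ k : U → ℝ, Function.extend Subtype.val k 0 p = k ⟨p, hp⟩ := fun k =>
      Subtype.val_injective.extend_apply k 0 (⟨p, hp⟩ : U)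
    simp [h]

namespace SmoothRing

variable {n m : ℕ} {U : TopologicalSpace.Opens (Fin n → ℝ)}
  {W : TopologicalSpace.Opens (Fin m → ℝ)}

/-- The extension by zero of a smooth function on `U`. -/
def extend (f : SmoothRing U) : (Fin n → ℝ) → ℝ := Function.extend Subtype.val f.1 0

theorem extend_apply (f : SmoothRing U) (p : U) : (extend f) p = f.1 p :=
  Subtype.val_injective.extend_apply _ _ p

theorem contDiffOn_extend (f : SmoothRing U) : ContDiffOn ℝ ∞ (extend f) U := f.2

/-- The restriction to `U` of a function that is smooth on `U`. -/
def mk (F : (Fin n → ℝ) → ℝ) (hF : ContDiffOn ℝ ∞ F U) : SmoothRing U :=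
  ⟨fun p => F p, hF.congr fun p hp =>
    Subtype.val_injective.extend_apply (fun p : U => F p) 0 (⟨p, hp⟩ : U)⟩

@[simp] theorem mk_apply (F : (Fin n → ℝ) → ℝ) (hF : ContDiffOn ℝ ∞ F U) (p : U) :
    (mk F hF).1 p = F p := rfl

@[simp] theorem val_add (f g : SmoothRing U) (p : U) : (f + g).1 p = f.1 p + g.1 p := rfl
@[simp] theorem val_mul (f g : SmoothRing U) (p : U) : (f * g).1 p = f.1 p * g.1 p := rfl
@[simp] theorem val_sub (f g : SmoothRing U) (p : U) : (f - g).1 p = f.1 p - g.1 p := rfl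
@[simp] theorem val_neg (f : SmoothRing U) (p : U) : (-f).1 p = -f.1 p := rfl
@[simp] theorem val_zero (p : U) : (0 : SmoothRing U).1 p = 0 := rfl
@[simp] theorem val_one (p : U) : (1 : SmoothRing U).1 p = 1 := rfl
@[simp] theorem val_algebraMap (c : ℝ) (p : U) : (algebraMap ℝ (SmoothRing U) c).1 p = c := rfl
@[simp] theorem val_smul (c : ℝ) (f : SmoothRing U) (p : U) : (c • f).1 p = c * f.1 p := rfl

theorem eq_iff {f g : SmoothRing U} : f = g ↔ ∀ p : U, f.1 p = g.1 p :=
  ⟨fun h p => by rw [h], fun h => Subtype.ext (funext h)⟩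

/-- Evaluation at a point, as a ring homomorphism. -/
def evalAt (p : U) : SmoothRing U →ₐ[ℝ] ℝ :=
  (Pi.evalAlgHom ℝ (fun _ : U => ℝ) p).comp (SmoothRing U).val

theorem evalAt_apply (p : U) (f : SmoothRing U) : evalAt p f = f.1 p := rfl

theorem eventually_mem (p : U) : ∀ᶠ q in 𝓝 (p : Fin n → ℝ), q ∈ U := U.isOpen.mem_nhds p.2

theorem contDiffAt {F : (Fin n → ℝ) → ℝ} (hF : ContDiffOn ℝ ∞ F U) (p : U) :
    ContDiffAt ℝ ∞ F p := hF.contDiffAt (eventually_mem p)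

theorem differentiableAt {F : (Fin n → ℝ) → ℝ} (hF : ContDiffOn ℝ ∞ F U) (p : U) :
    DifferentiableAt ℝ F p := (contDiffAt hF p).differentiableAt (by simp)

theorem contDiffOn_fderiv {F : (Fin n → ℝ) → ℝ} (hF : ContDiffOn ℝ ∞ F U) :
    ContDiffOn ℝ ∞ (fderiv ℝ F) U :=
  hF.fderiv_of_isOpen U.isOpen (by simp)

theorem contDiffOn_partial {F : (Fin n → ℝ) → ℝ} (hF : ContDiffOn ℝ ∞ F U) (i : Fin n) :
    ContDiffOn ℝ ∞ (fun p => fderiv ℝ F p (Pi.single i 1)) U :=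
  (contDiffOn_fderiv hF).clm_apply contDiffOn_const

theorem extend_eventuallyEq {f : SmoothRing U} {F : (Fin n → ℝ) → ℝ} (h : ∀ q : U, f.1 q = F q)
    (p : U) : (extend f) =ᶠ[𝓝 (p : Fin n → ℝ)] F := by
  filter_upwards [eventually_mem p] with q hq
  exact (extend_apply f ⟨q, hq⟩).trans (h ⟨q, hq⟩)

/-- The partial derivative `∂_i` as a derivation of the ring of smooth functions on `U`. -/
def D (i : Fin n) : Derivation ℝ (SmoothRing U) (SmoothRing U) :=
  Derivation.mk'
    { toFun := fun f => mk (fun p => fderiv ℝ (extend f) p (Pi.single i 1))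
        (contDiffOn_partial (contDiffOn_extend f) i)
      map_add' := fun f g => eq_iff.2 fun p => by
        have e : extend (f + g) =ᶠ[𝓝 (p : Fin n → ℝ)] (extend f) + (extend g) :=
          extend_eventuallyEq (fun q => by simp [extend_apply]) p
        simp [e.fderiv_eq, fderiv_add (differentiableAt (contDiffOn_extend f) p)
          (differentiableAt (contDiffOn_extend g) p)]
      map_smul' := fun c f => eq_iff.2 fun p => by
        have e : extend (c • f) =ᶠ[𝓝 (p : Fin n → ℝ)] c • (extend f) :=
          extend_eventuallyEq (fun q => by simp [extend_apply]) p
        simp [e.fderiv_eq, fderiv_const_smul (differentiableAt (contDiffOn_extend f) p)] }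
    fun f g => eq_iff.2 fun p => by
      have e : extend (f * g) =ᶠ[𝓝 (p : Fin n → ℝ)] (extend f) * (extend g) :=
        extend_eventuallyEq (fun q => by simp [extend_apply]) p
      simp [e.fderiv_eq, fderiv_mul (differentiableAt (contDiffOn_extend f) p)
        (differentiableAt (contDiffOn_extend g) p), extend_apply]

theorem D_apply_of_eq {f : SmoothRing U} {F : (Fin n → ℝ) → ℝ} (h : ∀ q : U, f.1 q = F q)
    (i : Fin n) (p : U) : (D i f).1 p = fderiv ℝ F p (Pi.single i 1) := by
  change fderiv ℝ (extend f) p (Pi.single i 1) = _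
  rw [(extend_eventuallyEq h p).fderiv_eq]

theorem D_mul (i : Fin n) (f g : SmoothRing U) : D i (f * g) = f * D i g + D i f * g := by
  rw [Derivation.leibniz, smul_eq_mul, smul_eq_mul, mul_comm g]

theorem D_smul (i : Fin n) (c : ℝ) (f : SmoothRing U) : D i (c • f) = c • D i f :=
  (D i).map_smul c f

theorem D_comm (i j : Fin n) (f : SmoothRing U) : D i (D j f) = D j (D i f) := by
  refine eq_iff.2 fun p => ?_
  have key : ∀ i j : Fin n, (D i (D j f)).1 p
      = fderiv ℝ (fderiv ℝ (extend f)) p (Pi.single i 1) (Pi.single j 1) := by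
    intro i j
    rw [D_apply_of_eq (F := fun q => fderiv ℝ (extend f) q (Pi.single j 1)) (fun q => rfl)]
    rw [fderiv_clm_apply (((contDiffOn_fderiv (contDiffOn_extend f)).contDiffAt
      (eventually_mem p)).differentiableAt (by simp)) (differentiableAt_const _)]
    simp
  rw [key, key]
  exact ((contDiffAt (contDiffOn_extend f) p).isSymmSndFDerivAt
    (by simp; exact WithTop.coe_le_coe.2 (le_top (a := (2 : ℕ∞))))) _ _

/-- The `j`-th coordinate function. -/
def coord (j : Fin n) : SmoothRing U := mk (fun p => p j) (contDiff_apply ℝ ℝ j).contDiffOn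

@[simp] theorem coord_apply (j : Fin n) (p : U) : (coord j : SmoothRing U).1 p = p.1 j := rfl

theorem D_coord (i j : Fin n) : D i (coord j : SmoothRing U) = if i = j then 1 else 0 := by
  refine eq_iff.2 fun p => ?_
  rw [D_apply_of_eq (F := fun q => q j) (fun q => rfl)]
  have : fderiv ℝ (fun q : Fin n → ℝ => q j) p = ContinuousLinearMap.proj j :=
    (ContinuousLinearMap.proj (R := ℝ) (φ := fun _ : Fin n => ℝ) j).fderiv
  rw [this]
  by_cases h : i = j
  · subst h; simp
  · simp [h, Ne.symm h]

/-- Composition with a smooth map `U → W` whose components are `Φ`. -/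
def pullback (Φ : Fin m → SmoothRing U) (hΦ : ∀ p : U, (fun j => (Φ j).1 p) ∈ W) :
    SmoothRing W →ₐ[ℝ] SmoothRing U :=
  AlgHom.ofLinearMap
    { toFun := fun f => mk (fun p => (extend f) fun j => extend (Φ j) p)
        ((contDiffOn_extend f).comp (contDiffOn_pi.2 fun j => contDiffOn_extend (Φ j))
          fun p hp => by
          have := hΦ ⟨p, hp⟩
          simp only [← extend_apply] at this
          exact this)
      map_add' := fun f g => eq_iff.2 fun p => by
        have h := fun k : SmoothRing W => extend_apply k ⟨_, hΦ p⟩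
        simp only [mk_apply, extend_apply, val_add] at h ⊢
        simp [h]
      map_smul' := fun c f => eq_iff.2 fun p => by
        have h := fun k : SmoothRing W => extend_apply k ⟨_, hΦ p⟩
        simp only [mk_apply, extend_apply, val_smul, RingHom.id_apply] at h ⊢
        simp [h] }
    (eq_iff.2 fun p => by
        have h := fun k : SmoothRing W => extend_apply k ⟨_, hΦ p⟩
        simp [extend_apply, h])
    (fun f g => eq_iff.2 fun p => by
        have h := fun k : SmoothRing W => extend_apply k ⟨_, hΦ p⟩
        simp [extend_apply, h])

theorem pullback_apply (Φ : Fin m → SmoothRing U) (hΦ : ∀ p : U, (fun j => (Φ j).1 p) ∈ W)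
    (f : SmoothRing W) (p : U) : (pullback Φ hΦ f).1 p = f.1 ⟨fun j => (Φ j).1 p, hΦ p⟩ := by
  change (extend f) (fun j => extend (Φ j) p) = _
  simp only [extend_apply]
  exact extend_apply f ⟨_, hΦ p⟩

/-- The chain rule. -/
theorem D_pullback (Φ : Fin m → SmoothRing U) (hΦ : ∀ p : U, (fun j => (Φ j).1 p) ∈ W)
    (i : Fin n) (f : SmoothRing W) :
    D i (pullback Φ hΦ f) = ∑ j, pullback Φ hΦ (D j f) * D i (Φ j) := by
  refine eq_iff.2 fun p => ?_
  have hw : (fun j => extend (Φ j) (p : Fin n → ℝ)) ∈ W := by simpa only [extend_apply] using hΦ p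
  rw [D_apply_of_eq (F := fun p => (extend f) fun j => extend (Φ j) p) (fun q => rfl)]
  have hd : DifferentiableAt ℝ (fun q : Fin n → ℝ => fun j => extend (Φ j) q) p :=
    differentiableAt_pi.2 fun j => differentiableAt (contDiffOn_extend (Φ j)) p
  have hf : DifferentiableAt ℝ (extend f) (fun j => extend (Φ j) (p : Fin n → ℝ)) :=
    differentiableAt (contDiffOn_extend f) ⟨_, hw⟩
  rw [show (fun p => (extend f) fun j => extend (Φ j) p)
      = extend f ∘ (fun q => fun j => extend (Φ j) q) from rfl,
    fderiv_comp (p : Fin n → ℝ) hf hd, ContinuousLinearMap.comp_apply,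
    fderiv_pi (fun j => differentiableAt (contDiffOn_extend (Φ j)) p)]
  have hsum : ∀ v : Fin m → ℝ, ∀ A : (Fin m → ℝ) →L[ℝ] ℝ, A v = ∑ j, A (Pi.single j 1) * v j := by
    intro v A
    conv_lhs => rw [← Finset.univ_sum_single v]
    rw [map_sum]
    refine Finset.sum_congr rfl fun j _ => ?_
    rw [show (Pi.single j (v j) : Fin m → ℝ) = v j • Pi.single j 1 by
      rw [← Pi.single_smul, smul_eq_mul, mul_one], map_smul, smul_eq_mul, mul_comm]
  rw [hsum]
  have : ∀ s : Finset (Fin m), ∀ k : Fin m → SmoothRing U,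
      (∑ j ∈ s, k j).1 p = ∑ j ∈ s, (k j).1 p :=
    fun s k => map_sum (evalAt p) k s
  rw [this]
  refine Finset.sum_congr rfl fun j _ => ?_
  rw [val_mul, pullback_apply]
  congr 1
  change _ = fderiv ℝ (extend f) _ _
  congr 2
  funext j
  rw [extend_apply]

/-- On a convex open set a function is constant as soon as its partial derivatives vanish. -/
theorem exists_eq_algebraMap (hU : Convex ℝ (U : Set (Fin n → ℝ))) (f : SmoothRing U)
    (h : ∀ i, D i f = 0) : ∃ c : ℝ, f = algebraMap ℝ _ c := by
  have h0 : ∀ p ∈ (U : Set (Fin n → ℝ)), fderiv ℝ (extend f) p = 0 := by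
    intro p hp
    refine ContinuousLinearMap.ext fun v => ?_
    rw [← Finset.univ_sum_single v, map_sum, _root_.zero_apply]
    refine Finset.sum_eq_zero fun j _ => ?_
    rw [show (Pi.single j (v j) : Fin n → ℝ) = v j • Pi.single j 1 by
      rw [← Pi.single_smul, smul_eq_mul, mul_one], map_smul]
    have : fderiv ℝ (extend f) p (Pi.single j 1) = (D j f).1 ⟨p, hp⟩ := rfl
    rw [this, h j]
    simp
  obtain ⟨c, hc⟩ := U.isOpen.exists_is_const_of_fderiv_eq_zero hU.isPreconnected
    ((contDiffOn_extend f).differentiableOn (by simp)) h0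
  exact ⟨c, eq_iff.2 fun p => by rw [← extend_apply, hc p.1 p.2]; rfl⟩

end SmoothRing

/-! ### Total derivatives and the prolongation formula -/

open SmoothRing

/-- The strip `{(t, x, y, u) : t ∈ I}` as an open set. -/
def stripOpens (I : TopologicalSpace.Opens ℝ) : TopologicalSpace.Opens (Fin 4 → ℝ) :=
  ⟨strip I, isOpen_strip I⟩

/-- The set `{(t, x, y) : t ∈ I}` of independent variables. -/
def baseOpens (I : TopologicalSpace.Opens ℝ) : TopologicalSpace.Opens (Fin 3 → ℝ) :=
  ⟨{p | p 0 ∈ I}, I.isOpen.preimage (continuous_apply 0)⟩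

variable {I : TopologicalSpace.Opens ℝ}

/-- The `j`-th coefficient of a vector field. -/
def VF.coeff (V : VF I) (j : Fin 4) : SmoothRing (stripOpens I) :=
  SmoothRing.mk (fun p => V.1 p j) ((contDiff_apply ℝ ℝ j).comp_contDiffOn V.2.1)

theorem mem_strip_graph (w : SmoothRing (baseOpens I)) (p : baseOpens I) :
    (fun j => ((![coord 0, coord 1, coord 2, w] : Fin 4 → SmoothRing (baseOpens I)) j).1 p)
      ∈ stripOpens I := p.2

/-- Restriction of functions on the strip to the graph of `w`. -/
def alongGraph (w : SmoothRing (baseOpens I)) :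
    SmoothRing (stripOpens I) →ₐ[ℝ] SmoothRing (baseOpens I) :=
  pullback ![coord 0, coord 1, coord 2, w] (mem_strip_graph w)

theorem D_alongGraph_zero (w : SmoothRing (baseOpens I)) (F : SmoothRing (stripOpens I)) :
    D 0 (alongGraph w F) = alongGraph w (D 0 F) + alongGraph w (D 3 F) * D 0 w := by
  rw [alongGraph, D_pullback, Fin.sum_univ_four]
  simp [D_coord]

theorem D_alongGraph_one (w : SmoothRing (baseOpens I)) (F : SmoothRing (stripOpens I)) :
    D 1 (alongGraph w F) = alongGraph w (D 1 F) + alongGraph w (D 3 F) * D 1 w := by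
  rw [alongGraph, D_pullback, Fin.sum_univ_four]
  simp [D_coord]

theorem D_alongGraph_two (w : SmoothRing (baseOpens I)) (F : SmoothRing (stripOpens I)) :
    D 2 (alongGraph w F) = alongGraph w (D 2 F) + alongGraph w (D 3 F) * D 2 w := by
  rw [alongGraph, D_pullback, Fin.sum_univ_four]
  simp [D_coord]

/-- The part of the third-order jet of a function of `(t, x, y)` that enters the third
prolongation; the field `xxt` is the value of `u_xxt`, and so on. -/
structure Jet where
  u : ℝ
  t : ℝ
  x : ℝ
  y : ℝ
  tt : ℝ
  tx : ℝ
  ty : ℝ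
  xx : ℝ
  xy : ℝ
  yy : ℝ
  xxx : ℝ
  xxt : ℝ
  xxy : ℝ

/-- The jet of a function at a point. -/
def jetAt (w : SmoothRing (baseOpens I)) (p : baseOpens I) : Jet where
  u := w.1 p
  t := (D 0 w).1 p
  x := (D 1 w).1 p
  y := (D 2 w).1 p
  tt := (D 0 (D 0 w)).1 p
  tx := (D 0 (D 1 w)).1 p
  ty := (D 0 (D 2 w)).1 p
  xx := (D 1 (D 1 w)).1 p
  xy := (D 1 (D 2 w)).1 p
  yy := (D 2 (D 2 w)).1 p
  xxx := (D 1 (D 1 (D 1 w))).1 p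
  xxt := (D 0 (D 1 (D 1 w))).1 p
  xxy := (D 1 (D 1 (D 2 w))).1 p

namespace Jet

variable (F : SmoothRing (stripOpens I)) (z : stripOpens I) (j : Jet)

/-- The total derivative `D_t F` at the jet `j` over the point `z`. -/
def dT : ℝ := (D 0 F).1 z + (D 3 F).1 z * j.t
/-- The total derivative `D_x F`. -/
def dX : ℝ := (D 1 F).1 z + (D 3 F).1 z * j.x
/-- The total derivative `D_y F`. -/
def dY : ℝ := (D 2 F).1 z + (D 3 F).1 z * j.y
/-- The total derivative `D_t D_x F`. -/
def dTX : ℝ := (D 0 (D 1 F)).1 z + (D 0 (D 3 F)).1 z * j.x + (D 1 (D 3 F)).1 z * j.t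
  + (D 3 (D 3 F)).1 z * j.t * j.x + (D 3 F).1 z * j.tx
/-- The total derivative `D_x D_x F`. -/
def dXX : ℝ := (D 1 (D 1 F)).1 z + 2 * (D 1 (D 3 F)).1 z * j.x
  + (D 3 (D 3 F)).1 z * j.x ^ 2 + (D 3 F).1 z * j.xx
/-- The total derivative `D_y D_y F`. -/
def dYY : ℝ := (D 2 (D 2 F)).1 z + 2 * (D 2 (D 3 F)).1 z * j.y
  + (D 3 (D 3 F)).1 z * j.y ^ 2 + (D 3 F).1 z * j.yy
/-- The total derivative `D_x D_x D_x F`. -/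
def dXXX : ℝ := (D 1 (D 1 (D 1 F))).1 z + 3 * (D 1 (D 1 (D 3 F))).1 z * j.x
  + 3 * (D 1 (D 3 (D 3 F))).1 z * j.x ^ 2 + (D 3 (D 3 (D 3 F))).1 z * j.x ^ 3
  + 3 * (D 1 (D 3 F)).1 z * j.xx + 3 * (D 3 (D 3 F)).1 z * j.x * j.xx + (D 3 F).1 z * j.xxx

variable (V : Fin 4 → SmoothRing (stripOpens I))

/-- The prolongation coefficient `φ^x`. -/
def phiX : ℝ := dX (V 3) z j - dX (V 0) z j * j.t - dX (V 1) z j * j.x - dX (V 2) z j * j.y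
/-- The prolongation coefficient `φ^tx`. -/
def phiTX : ℝ := dTX (V 3) z j
  - (dTX (V 0) z j * j.t + dT (V 0) z j * j.tx + dX (V 0) z j * j.tt)
  - (dTX (V 1) z j * j.x + dT (V 1) z j * j.xx + dX (V 1) z j * j.tx)
  - (dTX (V 2) z j * j.y + dT (V 2) z j * j.xy + dX (V 2) z j * j.ty)
/-- The prolongation coefficient `φ^xx`. -/
def phiXX : ℝ := dXX (V 3) z j
  - (dXX (V 0) z j * j.t + 2 * dX (V 0) z j * j.tx)
  - (dXX (V 1) z j * j.x + 2 * dX (V 1) z j * j.xx)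
  - (dXX (V 2) z j * j.y + 2 * dX (V 2) z j * j.xy)
/-- The prolongation coefficient `φ^yy`. -/
def phiYY : ℝ := dYY (V 3) z j
  - (dYY (V 0) z j * j.t + 2 * dY (V 0) z j * j.ty)
  - (dYY (V 1) z j * j.x + 2 * dY (V 1) z j * j.xy)
  - (dYY (V 2) z j * j.y + 2 * dY (V 2) z j * j.yy)
/-- The prolongation coefficient `φ^xxx`. -/
def phiXXX : ℝ := dXXX (V 3) z j
  - (dXXX (V 0) z j * j.t + 3 * dXX (V 0) z j * j.tx + 3 * dX (V 0) z j * j.xxt)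
  - (dXXX (V 1) z j * j.x + 3 * dXX (V 1) z j * j.xx + 3 * dX (V 1) z j * j.xxx)
  - (dXXX (V 2) z j * j.y + 3 * dXX (V 2) z j * j.xy + 3 * dX (V 2) z j * j.xxy)

/-- The left-hand side of the equation as a function of jets; `s` is the value of `σ` at the time
of the jet. -/
def eqn (s : ℝ) : ℝ := j.tx + j.x ^ 2 + j.u * j.xx + j.xxx + s * j.yy

/-- The prolongation of the vector field with coefficients `V`, applied to the left-hand side of
the equation; `s` and `s'` are the values of `σ` and `σ'`. -/
def prolonged (s s' : ℝ) : ℝ :=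
  (V 0).1 z * s' * j.yy + (V 3).1 z * j.xx + 2 * j.x * phiX z j V + phiTX z j V
    + j.u * phiXX z j V + phiXXX z j V + s * phiYY z j V

end Jet

section total

variable (w : SmoothRing (baseOpens I)) (p : baseOpens I) (F : SmoothRing (stripOpens I))

/-- The point of the graph of `w` over `p`. -/
def graphPoint : stripOpens I := ⟨_, mem_strip_graph w p⟩

theorem alongGraph_apply : (alongGraph w F).1 p = F.1 (graphPoint w p) := pullback_apply _ _ _ _

theorem total_t : (D 0 (alongGraph w F)).1 p = Jet.dT F (graphPoint w p) (jetAt w p) := by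
  rw [D_alongGraph_zero]; simp [alongGraph_apply, Jet.dT, jetAt]

theorem total_x : (D 1 (alongGraph w F)).1 p = Jet.dX F (graphPoint w p) (jetAt w p) := by
  rw [D_alongGraph_one]; simp [alongGraph_apply, Jet.dX, jetAt]

theorem total_y : (D 2 (alongGraph w F)).1 p = Jet.dY F (graphPoint w p) (jetAt w p) := by
  rw [D_alongGraph_two]; simp [alongGraph_apply, Jet.dY, jetAt]

theorem total_tx :
    (D 0 (D 1 (alongGraph w F))).1 p = Jet.dTX F (graphPoint w p) (jetAt w p) := by
  simp only [D_alongGraph_one, D_alongGraph_zero, D_mul, map_add, val_add, val_mul,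
    alongGraph_apply, Jet.dTX, jetAt, D_comm 3 1 F]
  ring

theorem total_xx :
    (D 1 (D 1 (alongGraph w F))).1 p = Jet.dXX F (graphPoint w p) (jetAt w p) := by
  simp only [D_alongGraph_one, D_mul, map_add, val_add, val_mul,
    alongGraph_apply, Jet.dXX, jetAt, D_comm 3 1 F]
  ring

theorem total_yy :
    (D 2 (D 2 (alongGraph w F))).1 p = Jet.dYY F (graphPoint w p) (jetAt w p) := by
  simp only [D_alongGraph_two, D_mul, map_add, val_add, val_mul,
    alongGraph_apply, Jet.dYY, jetAt, D_comm 3 2 F]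
  ring

theorem total_xxx :
    (D 1 (D 1 (D 1 (alongGraph w F)))).1 p = Jet.dXXX F (graphPoint w p) (jetAt w p) := by
  simp only [D_alongGraph_one, D_mul, map_add, val_add, val_mul,
    alongGraph_apply, Jet.dXXX, jetAt, D_comm 3 1 F, D_comm 3 1 (D 1 F), D_comm 3 1 (D 3 F)]
  ring

end total

section bridge

theorem pd_eq {f : (Fin 3 → ℝ) → ℝ} {F : SmoothRing (baseOpens I)}
    (h : ∀ q : baseOpens I, F.1 q = f q) (i : Fin 3) (q : baseOpens I) :
    (D i F).1 q = pd i f q := D_apply_of_eq h i q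

/-- Iterated partial derivatives in the ring of smooth functions. -/
def DList (J : List (Fin 3)) (F : SmoothRing (baseOpens I)) : SmoothRing (baseOpens I) :=
  J.foldr (fun i => D i) F

theorem pdList_eq {f : (Fin 3 → ℝ) → ℝ} {F : SmoothRing (baseOpens I)}
    (h : ∀ q : baseOpens I, F.1 q = f q) (J : List (Fin 3)) (q : baseOpens I) :
    (DList J F).1 q = pdList J f q := by
  induction J generalizing q with
  | nil => exact h q
  | cons i J ih => exact pd_eq ih i q

variable (σ : Coeff I) (V : VF I) {u : (Fin 3 → ℝ) → ℝ} {w : SmoothRing (baseOpens I)}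
  (h : ∀ q : baseOpens I, w.1 q = u q)
include h

theorem graphPt_eq (q : baseOpens I) : graphPt u q = (graphPoint w q).1 := by
  funext j
  fin_cases j <;> simp [graphPt, graphPoint, h]

theorem gKZK_eq (s : ℝ → ℝ) (p : baseOpens I) :
    gKZK s u p = Jet.eqn (jetAt w p) (s (p.1 0)) := by
  have h1 : ∀ q : baseOpens I, (D 0 w + w * D 1 w + D 1 (D 1 w)).1 q
      = pd 0 u q + u q * pd 1 u q + pd 1 (pd 1 u) q := by
    intro q
    simp only [val_add, val_mul, h q, pd_eq h, pd_eq (pd_eq h _)]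
  rw [gKZK, ← pd_eq h1, ← pd_eq (pd_eq h 2)]
  simp only [map_add, D_mul, val_add, val_mul, Jet.eqn, jetAt, D_comm 1 0 w]
  ring

/-- The characteristic of `V` along `w`. -/
theorem characteristic_eq (q : baseOpens I) :
    (alongGraph w (V.coeff 3) - (alongGraph w (V.coeff 0) * D 0 w
      + alongGraph w (V.coeff 1) * D 1 w + alongGraph w (V.coeff 2) * D 2 w)).1 q
      = characteristic V.1 u q := by
  rw [characteristic, Fin.sum_univ_three, graphPt_eq h]
  simp only [val_add, val_mul, val_sub, alongGraph_apply, pd_eq h]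
  rfl

theorem prolongCoeff_eq (J : List (Fin 3)) (q : baseOpens I) :
    prolongCoeff V.1 J u q = (DList J (alongGraph w (V.coeff 3) - (alongGraph w (V.coeff 0) * D 0 w
      + alongGraph w (V.coeff 1) * D 1 w + alongGraph w (V.coeff 2) * D 2 w))
      + (alongGraph w (V.coeff 0) * DList (0 :: J) w
      + alongGraph w (V.coeff 1) * DList (1 :: J) w
      + alongGraph w (V.coeff 2) * DList (2 :: J) w)).1 q := by
  rw [prolongCoeff, Fin.sum_univ_three, graphPt_eq h]
  simp only [val_add, val_mul, alongGraph_apply, pdList_eq h,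
    pdList_eq (characteristic_eq V h)]
  rfl

/-- The third prolongation in terms of the jet of `u` and of the derivatives of the coefficients
of `V` on the strip. -/
theorem prolongGKZK_eq (p : baseOpens I) :
    prolongGKZK σ.toFun V.1 u p = Jet.prolonged (graphPoint w p) (jetAt w p) V.coeff
      (σ.toFun (p.1 0)) (deriv σ.toFun (p.1 0)) := by
  have c0 : V.1 (graphPt u p) 0 = (V.coeff 0).1 (graphPoint w p) := by rw [graphPt_eq h]; rfl
  have e : ∀ J, pdList J u p = (DList J w).1 p := fun J => (pdList_eq h J p).symm
  have e0 : u p = w.1 p := (h p).symm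
  simp only [prolongGKZK, prolongCoeff_eq V h, c0, e, e0]
  simp only [DList, List.foldr, map_sub, map_add, D_mul, val_add, val_mul, val_sub,
    total_t, total_x, total_y, total_tx, total_xx, total_yy, total_xxx, alongGraph_apply]
  simp only [D_comm 1 0 w, D_comm 2 0 w, D_comm 2 1 w, D_comm 1 0 (D _ w), D_comm 2 0 (D _ w),
    D_comm 2 1 (D _ w), D_comm 1 0 (D _ (D _ w)), D_comm 2 1 (D _ (D _ w)), Jet.prolonged,
    Jet.phiX, Jet.phiTX, Jet.phiXX, Jet.phiYY, Jet.phiXXX]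
  have j0 : w.1 p = (jetAt w p).u := rfl
  have j1 : (D 0 w).1 p = (jetAt w p).t := rfl
  have j2 : (D 1 w).1 p = (jetAt w p).x := rfl
  have j3 : (D 2 w).1 p = (jetAt w p).y := rfl
  have j4 : (D 0 (D 0 w)).1 p = (jetAt w p).tt := rfl
  have j5 : (D 0 (D 1 w)).1 p = (jetAt w p).tx := rfl
  have j6 : (D 0 (D 2 w)).1 p = (jetAt w p).ty := rfl
  have j7 : (D 1 (D 1 w)).1 p = (jetAt w p).xx := rfl
  have j8 : (D 1 (D 2 w)).1 p = (jetAt w p).xy := rfl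
  have j9 : (D 2 (D 2 w)).1 p = (jetAt w p).yy := rfl
  have j10 : (D 1 (D 1 (D 1 w))).1 p = (jetAt w p).xxx := rfl
  have j11 : (D 0 (D 1 (D 1 w))).1 p = (jetAt w p).xxt := rfl
  have j12 : (D 1 (D 1 (D 2 w))).1 p = (jetAt w p).xxy := rfl
  simp only [j0, j1, j2, j3, j4, j5, j6, j7, j8, j9, j10, j11, j12]
  ring

end bridge

/-! ### The determining equations -/

theorem D_algebraMap {n : ℕ} {U : TopologicalSpace.Opens (Fin n → ℝ)} (i : Fin n) (c : ℝ) :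
    D i (algebraMap ℝ (SmoothRing U) c) = 0 :=
  (D (U := U) i).map_algebraMap c

/-- Every jet with `u_tt = 0` is the jet of a cubic polynomial.  The jets with `u_tt = 0` suffice
to derive the determining equations. -/
theorem exists_jetAt_eq (z : stripOpens I) (j : Jet) (hu : j.u = z.1 3) (htt : j.tt = 0) :
    ∃ (u : (Fin 3 → ℝ) → ℝ) (w : SmoothRing (baseOpens I)) (p : baseOpens I),
      ContDiff ℝ ∞ u ∧ (∀ q : baseOpens I, w.1 q = u q) ∧ graphPoint w p = z ∧ jetAt w p = j ∧
        p.1 0 = z.1 0 := by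
  have hp : (![z.1 0, z.1 1, z.1 2] : Fin 3 → ℝ) ∈ baseOpens I := z.2
  set T : SmoothRing (baseOpens I) := coord 0 - algebraMap ℝ _ (z.1 0) with hT
  set X : SmoothRing (baseOpens I) := coord 1 - algebraMap ℝ _ (z.1 1) with hX
  set Y : SmoothRing (baseOpens I) := coord 2 - algebraMap ℝ _ (z.1 2) with hY
  set C : ℝ → SmoothRing (baseOpens I) := fun c => algebraMap ℝ (SmoothRing (baseOpens I)) c with hC
  set w : SmoothRing (baseOpens I) := C j.u + C j.t * T + C j.x * X + C j.y * Y + C j.tx * (T * X)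
    + C j.ty * (T * Y) + C (j.xx / 2) * (X * X) + C j.xy * (X * Y) + C (j.yy / 2) * (Y * Y)
    + C (j.xxx / 6) * (X * (X * X)) + C (j.xxt / 2) * (X * (X * T)) + C (j.xxy / 2) * (X * (X * Y))
    with hw
  have hDT : ∀ i, D i T = if i = 0 then 1 else 0 := fun i => by
    rw [hT, map_sub, D_coord, D_algebraMap, sub_zero]
  have hDX : ∀ i, D i X = if i = 1 then 1 else 0 := fun i => by
    rw [hX, map_sub, D_coord, D_algebraMap, sub_zero]
  have hDY : ∀ i, D i Y = if i = 2 then 1 else 0 := fun i => by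
    rw [hY, map_sub, D_coord, D_algebraMap, sub_zero]
  have hDC : ∀ i c, D i (C c) = 0 := fun i c => D_algebraMap i c
  have eT : T.1 ⟨_, hp⟩ = 0 := by simp [hT]
  have eX : X.1 ⟨_, hp⟩ = 0 := by simp [hX]
  have eY : Y.1 ⟨_, hp⟩ = 0 := by simp [hY]
  have eC : ∀ c, (C c).1 ⟨_, hp⟩ = c := fun c => by simp [hC]
  refine ⟨fun q => j.u + j.t * (q 0 - z.1 0) + j.x * (q 1 - z.1 1) + j.y * (q 2 - z.1 2)
    + j.tx * ((q 0 - z.1 0) * (q 1 - z.1 1)) + j.ty * ((q 0 - z.1 0) * (q 2 - z.1 2))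
    + j.xx / 2 * ((q 1 - z.1 1) * (q 1 - z.1 1)) + j.xy * ((q 1 - z.1 1) * (q 2 - z.1 2))
    + j.yy / 2 * ((q 2 - z.1 2) * (q 2 - z.1 2))
    + j.xxx / 6 * ((q 1 - z.1 1) * ((q 1 - z.1 1) * (q 1 - z.1 1)))
    + j.xxt / 2 * ((q 1 - z.1 1) * ((q 1 - z.1 1) * (q 0 - z.1 0)))
    + j.xxy / 2 * ((q 1 - z.1 1) * ((q 1 - z.1 1) * (q 2 - z.1 2))), w, ⟨_, hp⟩, by fun_prop,
    fun q => by simp [hw, hT, hX, hY, hC], ?_, ?_, rfl⟩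
  · have e : w.1 ⟨_, hp⟩ = z.1 3 := by
      simp [hw, eT, eX, eY, eC, hu]
    apply Subtype.ext
    funext i
    fin_cases i
    · rfl
    · rfl
    · rfl
    · exact e
  · have d0 : D 0 w = C j.t + C j.tx * X + C j.ty * Y + C (j.xxt / 2) * (X * X) := by
      simp [hw, hDT, hDX, hDY, hDC]
    have d1 : D 1 w = C j.x + C j.tx * T + C (j.xx / 2) * (X + X) + C j.xy * Y
        + C (j.xxx / 6) * (X * (X + X) + X * X) + C (j.xxt / 2) * (X * T + X * T)
        + C (j.xxy / 2) * (X * Y + X * Y) := by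
      simp [hw, hDT, hDX, hDY, hDC]
    have d2 : D 2 w = C j.y + C j.ty * T + C j.xy * X + C (j.yy / 2) * (Y + Y)
        + C (j.xxy / 2) * (X * X) := by
      simp [hw, hDT, hDX, hDY, hDC]
    obtain ⟨u, t, x, y, tt, tx, ty, xx, xy, yy, xxx, xxt, xxy⟩ := j
    simp only at htt
    subst htt
    simp only [jetAt, d0, d1, d2, map_add, D_mul, hDT, hDX, hDY, hDC, Jet.mk.injEq]
    simp [eT, eX, eY, eC, hw]
    exact ⟨by ring, by ring, by ring, by ring, by ring⟩

/-- A point symmetry annihilates the equation at each jet with `u_tt = 0` that satisfies it. -/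
theorem IsPointSymmetry.prolonged_eq_zero {σ : Coeff I} {V : VF I} (hV : IsPointSymmetry σ V)
    (z : stripOpens I) (j : Jet) (hu : j.u = z.1 3) (htt : j.tt = 0)
    (hj : j.eqn (σ.toFun (z.1 0)) = 0) :
    Jet.prolonged z j V.coeff (σ.toFun (z.1 0)) (deriv σ.toFun (z.1 0)) = 0 := by
  obtain ⟨u, w, p, hu', hw, hz, hjp, h0⟩ := exists_jetAt_eq z j hu htt
  have := hV u hu' p p.2
  rw [gKZK_eq hw, prolongGKZK_eq σ V hw, hjp, h0, hz] at this
  exact this hj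

section determining

variable {σ : Coeff I} {V : VF I} (hV : IsPointSymmetry σ V)
include hV

/-- The equation does not involve `u_xxt` and `u_xxy`, so these are free on the jets that satisfy
it, and their coefficients `-3 D_x τ` and `-3 D_x η` in the prolongation vanish. -/
theorem IsPointSymmetry.tau_eta_x_u :
    D 1 (V.coeff 0) = 0 ∧ D 3 (V.coeff 0) = 0 ∧ D 1 (V.coeff 2) = 0 ∧ D 3 (V.coeff 2) = 0 := by
  have key : ∀ z : stripOpens I, (D 1 (V.coeff 0)).1 z = 0 ∧ (D 3 (V.coeff 0)).1 z = 0 ∧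
      (D 1 (V.coeff 2)).1 z = 0 ∧ (D 3 (V.coeff 2)).1 z = 0 := by
    intro z
    -- the jets with `u_x = a`, `u_xxt = k`, `u_xxy = l`; the equation forces `u_xxx = -a²`
    have H : ∀ a k l : ℝ, _ := fun a k l => hV.prolonged_eq_zero z
      ⟨z.1 3, 0, a, 0, 0, 0, 0, 0, 0, 0, -a ^ 2, k, l⟩ rfl rfl (by simp [Jet.eqn])
    have h1 := H 0 1 0
    have h2 := H 1 1 0
    have h3 := H 0 0 1
    have h4 := H 1 0 1
    have h5 := H 0 0 0
    have h6 := H 1 0 0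
    simp only [Jet.prolonged, Jet.phiX, Jet.phiTX, Jet.phiXX, Jet.phiYY, Jet.phiXXX, Jet.dX,
      Jet.dT, Jet.dY, Jet.dXX, Jet.dTX, Jet.dYY, Jet.dXXX] at h1 h2 h3 h4 h5 h6
    ring_nf at h1 h2 h3 h4 h5 h6
    refine ⟨?_, ?_, ?_, ?_⟩ <;> linarith
  exact ⟨eq_iff.2 fun z => (key z).1, eq_iff.2 fun z => (key z).2.1,
    eq_iff.2 fun z => (key z).2.2.1, eq_iff.2 fun z => (key z).2.2.2⟩

/-- The equation does not involve `u_ty` and `u_xy` either: the coefficient of `u_ty` is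
`-2σ D_y τ`, and the part of the coefficient of `u_xy` that contains `u_y` is a multiple of
`ξ_u`. -/
theorem IsPointSymmetry.tau_y_xi_u :
    D 2 (V.coeff 0) = 0 ∧ D 3 (V.coeff 1) = 0 := by
  obtain ⟨a1, a2, a3, a4⟩ := hV.tau_eta_x_u
  have key : ∀ z : stripOpens I, (D 2 (V.coeff 0)).1 z = 0 ∧ (D 3 (V.coeff 1)).1 z = 0 := by
    intro z
    -- the jets with `u_y = y`, `u_ty = k`, `u_xy = l`
    have H : ∀ y k l : ℝ, _ := fun y k l => hV.prolonged_eq_zero z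
      ⟨z.1 3, 0, 0, y, 0, 0, k, 0, l, 0, 0, 0, 0⟩ rfl rfl (by simp [Jet.eqn])
    have h1 := H 0 1 0
    have h2 := H 0 0 1
    have h3 := H 1 0 1
    have h4 := H 0 0 0
    have h5 := H 1 0 0
    simp only [Jet.prolonged, Jet.phiX, Jet.phiTX, Jet.phiXX, Jet.phiYY, Jet.phiXXX, Jet.dX,
      Jet.dT, Jet.dY, Jet.dXX, Jet.dTX, Jet.dYY, Jet.dXXX, a1, a2, a3, a4, map_zero,
      val_zero] at h1 h2 h3 h4 h5
    ring_nf at h1 h2 h3 h4 h5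
    have hs := σ.ne_zero _ z.2
    refine ⟨?_, ?_⟩ <;> refine (mul_right_inj' hs).1 ?_ <;> linarith
  exact ⟨eq_iff.2 fun z => (key z).1, eq_iff.2 fun z => (key z).2⟩

end determining

/-- The prolongation of a field whose coefficients `τ`, `η`, `ξ` depend only on `t`, on `(t, y)`
and on `(t, x, y)`. -/
theorem Jet.prolonged_eq_of_projectable {V : Fin 4 → SmoothRing (stripOpens I)}
    (a1 : D 1 (V 0) = 0) (a2 : D 3 (V 0) = 0) (a3 : D 1 (V 2) = 0) (a4 : D 3 (V 2) = 0)
    (b1 : D 2 (V 0) = 0) (b2 : D 3 (V 1) = 0) (z : stripOpens I) (j : Jet) (s s' : ℝ) :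
    j.prolonged z V s s' =
      (V 0).1 z * s' * j.yy + (V 3).1 z * j.xx
      + 2 * j.x * ((D 1 (V 3)).1 z + (D 3 (V 3)).1 z * j.x - (D 1 (V 1)).1 z * j.x)
      + ((D 0 (D 1 (V 3))).1 z + (D 0 (D 3 (V 3))).1 z * j.x + (D 1 (D 3 (V 3))).1 z * j.t
        + (D 3 (D 3 (V 3))).1 z * j.t * j.x + (D 3 (V 3)).1 z * j.tx - (D 0 (V 0)).1 z * j.tx
        - ((D 0 (D 1 (V 1))).1 z * j.x + (D 0 (V 1)).1 z * j.xx + (D 1 (V 1)).1 z * j.tx)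
        - (D 0 (V 2)).1 z * j.xy)
      + j.u * ((D 1 (D 1 (V 3))).1 z + 2 * (D 1 (D 3 (V 3))).1 z * j.x
        + (D 3 (D 3 (V 3))).1 z * j.x ^ 2 + (D 3 (V 3)).1 z * j.xx
        - ((D 1 (D 1 (V 1))).1 z * j.x + 2 * (D 1 (V 1)).1 z * j.xx))
      + (Jet.dXXX (V 3) z j - ((D 1 (D 1 (D 1 (V 1)))).1 z * j.x
        + 3 * (D 1 (D 1 (V 1))).1 z * j.xx + 3 * (D 1 (V 1)).1 z * j.xxx))
      + s * ((D 2 (D 2 (V 3))).1 z + 2 * (D 2 (D 3 (V 3))).1 z * j.y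
        + (D 3 (D 3 (V 3))).1 z * j.y ^ 2 + (D 3 (V 3)).1 z * j.yy
        - ((D 2 (D 2 (V 1))).1 z * j.x + 2 * (D 2 (V 1)).1 z * j.xy)
        - ((D 2 (D 2 (V 2))).1 z * j.y + 2 * (D 2 (V 2)).1 z * j.yy)) := by
  simp only [Jet.prolonged, Jet.phiX, Jet.phiTX, Jet.phiXX, Jet.phiYY, Jet.phiXXX, Jet.dX,
    Jet.dT, Jet.dY, Jet.dXX, Jet.dTX, Jet.dYY, Jet.dXXX, a1, a2, a3, a4, b1, b2, map_zero,
    val_zero]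
  ring

/-- The coefficients of `u_xy`, `u_tx`, `u_yy`, `u_x u_xx` and `u_xx` vanish once `u_xxx` is
eliminated by means of the equation. -/
theorem IsPointSymmetry.second_order_coefficients {σ : Coeff I} {V : VF I}
    (hV : IsPointSymmetry σ V) (z : stripOpens I) :
    (D 0 (V.coeff 2)).1 z = -2 * σ.toFun (z.1 0) * (D 2 (V.coeff 1)).1 z ∧
    2 * (D 1 (V.coeff 1)).1 z = (D 0 (V.coeff 0)).1 z ∧
    (V.coeff 0).1 z * deriv σ.toFun (z.1 0) + σ.toFun (z.1 0) * (3 * (D 1 (V.coeff 1)).1 z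
      - 2 * (D 2 (V.coeff 2)).1 z) = 0 ∧
    (D 3 (D 3 (V.coeff 3))).1 z = 0 ∧
    3 * (D 1 (D 3 (V.coeff 3))).1 z - 3 * (D 1 (D 1 (V.coeff 1))).1 z + (V.coeff 3).1 z
      + z.1 3 * (D 1 (V.coeff 1)).1 z - (D 0 (V.coeff 1)).1 z = 0 := by
  obtain ⟨a1, a2, a3, a4⟩ := hV.tau_eta_x_u
  obtain ⟨b1, b2⟩ := hV.tau_y_xi_u
  have H : ∀ x tx xx xy yy : ℝ, _ := fun x tx xx xy yy => hV.prolonged_eq_zero z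
      ⟨z.1 3, 0, x, 0, 0, tx, 0, xx, xy, yy,
        -(tx + x ^ 2 + z.1 3 * xx + σ.toFun (z.1 0) * yy), 0, 0⟩ rfl rfl
        (by simp only [Jet.eqn]; ring)
  simp only [Jet.prolonged_eq_of_projectable a1 a2 a3 a4 b1 b2, Jet.dXXX] at H
  have h0 := H 0 0 0 0 0
  have h1 := H 0 1 0 0 0
  have h2 := H 0 0 1 0 0
  have h3 := H 0 0 0 1 0
  have h4 := H 0 0 0 0 1
  have h5 := H 1 0 0 0 0
  have h6 := H 1 0 1 0 0
  ring_nf at h0 h1 h2 h3 h4 h5 h6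
  have i0 : (D 3 (D 3 (V.coeff 3))).1 z = 0 := by linarith
  have i1 : 2 * (D 1 (V.coeff 1)).1 z = (D 0 (V.coeff 0)).1 z := by linarith
  refine ⟨by linarith, i1, by linarith, i0, by linarith⟩

/-- The derivative of a smooth function of time. -/
def SmoothFn.derivative (f : SmoothFn I) : SmoothFn I := ⟨deriv f.toFun, contDiffOn_deriv f.smooth⟩

/-- A function of time as a function on the strip. -/
def timeFn (f : SmoothFn I) : SmoothRing (stripOpens I) :=
  SmoothRing.mk (fun p => f.toFun (p 0)) (contDiffOn_time f.smooth)

@[simp] theorem timeFn_apply (f : SmoothFn I) (z : stripOpens I) :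
    (timeFn f).1 z = f.toFun (z.1 0) := rfl

/-- The partial derivatives of a function of the first coordinate. -/
theorem D_mk_time {n : ℕ} {U : TopologicalSpace.Opens (Fin (n + 1) → ℝ)} {f : ℝ → ℝ}
    (hf : ContDiffOn ℝ ∞ (fun p : Fin (n + 1) → ℝ => f (p 0)) U) (i : Fin (n + 1)) (q : U) {f' : ℝ}
    (h : HasDerivAt f f' (q.1 0)) : (D i (SmoothRing.mk _ hf)).1 q = if i = 0 then f' else 0 := by
  rw [D_apply_of_eq (F := fun p => f (p 0)) (fun q => rfl)]
  have h1 : HasFDerivAt (fun q : Fin (n + 1) → ℝ => q 0)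
      (ContinuousLinearMap.proj (R := ℝ) (φ := fun _ : Fin (n + 1) => ℝ) 0) q.1 :=
    (ContinuousLinearMap.proj (R := ℝ) (φ := fun _ : Fin (n + 1) => ℝ) 0).hasFDerivAt
  have h3 := h.comp_hasFDerivAt q.1 h1
  rw [show (fun p : Fin (n + 1) → ℝ => f (p 0)) = f ∘ (fun q : Fin (n + 1) → ℝ => q 0) from rfl,
    h3.fderiv]
  by_cases h : i = 0
  · subst h; simp
  · simp [h, Ne.symm h]

theorem SmoothFn.hasDerivAt (f : SmoothFn I) {t : ℝ} (ht : t ∈ I) :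
    HasDerivAt f.toFun (deriv f.toFun t) t :=
  ((f.smooth.contDiffAt (I.isOpen.mem_nhds ht)).differentiableAt (by simp)).hasDerivAt

theorem D_timeFn (i : Fin 4) (f : SmoothFn I) :
    D i (timeFn f) = if i = 0 then timeFn f.derivative else 0 := by
  refine eq_iff.2 fun z =>
    (D_mk_time (U := stripOpens I) (contDiffOn_time f.smooth) i z (f.hasDerivAt z.2)).trans ?_
  by_cases h : i = 0
  · subst h; simp [SmoothFn.derivative]
  · simp [h]

theorem D_timeFn_zero (f : SmoothFn I) : D 0 (timeFn f) = timeFn f.derivative := by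
  simp [D_timeFn]
theorem D_timeFn_one (f : SmoothFn I) : D 1 (timeFn f) = 0 := by simp [D_timeFn]
theorem D_timeFn_two (f : SmoothFn I) : D 2 (timeFn f) = 0 := by simp [D_timeFn]
theorem D_timeFn_three (f : SmoothFn I) : D 3 (timeFn f) = 0 := by simp [D_timeFn]

/-- The coefficient `σ`, as a function on the strip, cancels. -/
theorem timeFn_mul_cancel (σ : Coeff I) {F G : SmoothRing (stripOpens I)}
    (h : timeFn σ.toSmoothFn * F = timeFn σ.toSmoothFn * G) : F = G :=
  eq_iff.2 fun z => mul_left_cancel₀ (σ.ne_zero _ z.2) (eq_iff.1 h z)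

theorem two_mul_cancel {F G : SmoothRing (stripOpens I)} (h : 2 * F = 2 * G) : F = G := by
  have h2 : ∀ K : SmoothRing (stripOpens I), (2 * K) = (2 : ℝ) • K := fun K => by
    rw [two_smul, two_mul]
  rw [h2, h2] at h
  simpa using congrArg (fun K => (2 : ℝ)⁻¹ • K) h

/-- The determining equations of the point symmetries; the coefficients of the field are
`V = ![τ, ξ, η, φ]`. -/
structure Determining (σ : Coeff I) (V : Fin 4 → SmoothRing (stripOpens I)) : Prop where
  tau_x : D 1 (V 0) = 0
  tau_y : D 2 (V 0) = 0
  tau_u : D 3 (V 0) = 0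
  tau_ttt : D 0 (D 0 (D 0 (V 0))) = 0
  eta_x : D 1 (V 2) = 0
  eta_u : D 3 (V 2) = 0
  eta_yy : D 2 (D 2 (V 2)) = 0
  xi_u : D 3 (V 1) = 0
  xi_x : 2 * D 1 (V 1) = D 0 (V 0)
  xi_yy : D 2 (D 2 (V 1)) = 0
  eta_t : D 0 (V 2) = -2 * timeFn σ.toSmoothFn * D 2 (V 1)
  phi : V 3 = D 0 (V 1) - coord 3 * D 1 (V 1)
  sigma : V 0 * timeFn σ.toSmoothFn.derivative
    + timeFn σ.toSmoothFn * (3 * D 1 (V 1) - 2 * D 2 (V 2)) = 0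

theorem D_two_mul {n : ℕ} {U : TopologicalSpace.Opens (Fin n → ℝ)} (i : Fin n)
    (F : SmoothRing U) : D i (2 * F) = 2 * D i F := by
  rw [two_mul, map_add, two_mul]

/-- A point symmetry solves the determining equations. -/
theorem IsPointSymmetry.determining {σ : Coeff I} {V : VF I} (hV : IsPointSymmetry σ V) :
    Determining σ V.coeff := by
  obtain ⟨a1, a2, a3, a4⟩ := hV.tau_eta_x_u
  obtain ⟨b1, b2⟩ := hV.tau_y_xi_u
  have c := hV.second_order_coefficients
  have c1 : D 0 (V.coeff 2) = -2 * timeFn σ.toSmoothFn * D 2 (V.coeff 1) :=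
    eq_iff.2 fun z => (c z).1
  have c2 : 2 * D 1 (V.coeff 1) = D 0 (V.coeff 0) := eq_iff.2 fun z => (c z).2.1
  have c4 : D 3 (D 3 (V.coeff 3)) = 0 := eq_iff.2 fun z => (c z).2.2.2.1
  -- the `x`-derivative of `ξ` depends on `t` only
  have d1 : D 1 (D 1 (V.coeff 1)) = 0 := two_mul_cancel (by
    rw [← D_two_mul, c2, D_comm, a1, map_zero, mul_zero])
  have d2 : D 1 (D 2 (V.coeff 1)) = 0 := two_mul_cancel (by
    rw [D_comm, ← D_two_mul, c2, D_comm, b1, map_zero, mul_zero])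
  have c5 : 3 * D 1 (D 3 (V.coeff 3)) + V.coeff 3 + coord 3 * D 1 (V.coeff 1)
      - D 0 (V.coeff 1) = 0 := eq_iff.2 fun z => by
    have := (c z).2.2.2.2
    rw [d1] at this
    simp only [val_zero, mul_zero, sub_zero] at this
    exact this
  have three : ∀ i (F : SmoothRing (stripOpens I)), D i (3 * F) = 3 * D i F := fun i F => by
    rw [show 3 * F = F + F + F by ring, map_add, map_add]; ring
  -- differentiate the coefficient of `u_xx` with respect to `u`
  have d3 : D 3 (V.coeff 3) = -D 1 (V.coeff 1) := by
    have h := congrArg (D 3) c5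
    rw [map_sub, map_add, map_add, three, D_mul, D_comm 3 1 (D 3 _), c4, D_comm 3 1, D_comm 3 0,
      b2, D_coord] at h
    simp only [map_zero, if_true] at h
    linear_combination h
  have d4 : V.coeff 3 = D 0 (V.coeff 1) - coord 3 * D 1 (V.coeff 1) := by
    rw [d3, map_neg, d1] at c5
    linear_combination c5
  have e1 : D 1 (V.coeff 3) = D 0 (D 1 (V.coeff 1)) := by
    rw [d4, map_sub, D_mul, d1, D_coord, D_comm 1 0]; simp
  have e2 : D 1 (D 0 (D 1 (V.coeff 1))) = 0 := by rw [D_comm, d1, map_zero]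
  have e3 : D 2 (D 1 (V.coeff 1)) = 0 := by rw [D_comm, d2]
  have e4 : D 3 (D 1 (V.coeff 1)) = 0 := by rw [D_comm, b2, map_zero]
  have key : ∀ z : stripOpens I, (D 2 (D 2 (V.coeff 1))).1 z = 0 ∧
      (D 2 (D 2 (V.coeff 2))).1 z = 0 ∧ (D 0 (D 1 (V.coeff 3))).1 z
        + σ.toFun (z.1 0) * (D 2 (D 2 (V.coeff 3))).1 z = 0 := by
    intro z
    -- the jets with `u_x = x`, `u_y = y` and `u_xxx = -x²`
    have H : ∀ x y : ℝ, _ := fun x y => hV.prolonged_eq_zero z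
      ⟨z.1 3, 0, x, y, 0, 0, 0, 0, 0, 0, -x ^ 2, 0, 0⟩ rfl rfl (by simp [Jet.eqn])
    simp only [Jet.prolonged_eq_of_projectable a1 a2 a3 a4 b1 b2, Jet.dXXX] at H
    simp only [e1, d3, d1, e2, e3, e4, map_neg, map_zero, val_zero, val_neg] at H
    have h0 := H 0 0
    have h1 := H 1 0
    have h2 := H 0 1
    rw [e1]
    ring_nf at h0 h1 h2
    have hs := σ.ne_zero _ z.2
    refine ⟨(mul_right_inj' hs).1 ?_, (mul_right_inj' hs).1 ?_, ?_⟩ <;> linarith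
  have f1 : D 2 (D 2 (V.coeff 1)) = 0 := eq_iff.2 fun z => (key z).1
  have f3 : D 0 (D 1 (V.coeff 3)) + timeFn σ.toSmoothFn * D 2 (D 2 (V.coeff 3)) = 0 :=
    eq_iff.2 fun z => (key z).2.2
  have f4 : D 2 (D 2 (V.coeff 3)) = 0 := by
    rw [d4, map_sub, D_mul, D_coord, D_comm 2 1, d2, D_comm 2 0, map_sub, D_comm 2 0, f1]
    simp
  refine ⟨a1, b1, a2, two_mul_cancel ?_, a3, a4, eq_iff.2 fun z => (key z).2.1, b2, c2, f1, c1,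
    d4, eq_iff.2 fun z => (c z).2.2.1⟩
  rw [f4, mul_zero, add_zero, e1] at f3
  rw [← c2, D_two_mul, D_two_mul, f3, mul_zero, mul_zero]

/-- The prolongation of a solution of the determining equations, applied to the left-hand side of
the equation, is `-2 τ_t` times that left-hand side. -/
theorem Determining.isPointSymmetry {σ : Coeff I} {V : VF I} (h : Determining σ V.coeff) :
    IsPointSymmetry σ V := by
  obtain ⟨a1, b1, a2, a5, a3, a4, g1, b2, c2, f1, c1, d4, c3⟩ := h
  intro u hu p hp heq
  set w : SmoothRing (baseOpens I) := SmoothRing.mk u hu.contDiffOn with hwdef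
  have hw : ∀ q : baseOpens I, w.1 q = u q := fun q => rfl
  set P : baseOpens I := ⟨p, hp⟩
  have heq' := gKZK_eq hw σ.toFun P
  rw [show (P : Fin 3 → ℝ) = p from rfl, heq] at heq'
  change prolongGKZK σ.toFun V.1 u (P : Fin 3 → ℝ) = 0
  rw [prolongGKZK_eq σ V hw]
  have d1 : D 1 (D 1 (V.coeff 1)) = 0 := two_mul_cancel (by
    rw [← D_two_mul, c2, D_comm, a1, map_zero, mul_zero])
  have d2 : D 1 (D 2 (V.coeff 1)) = 0 := two_mul_cancel (by
    rw [D_comm, ← D_two_mul, c2, D_comm, b1, map_zero, mul_zero])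
  have d3 : D 3 (V.coeff 3) = -D 1 (V.coeff 1) := by
    rw [d4, map_sub, D_mul, D_comm 3 0, D_comm 3 1, b2, D_coord]; simp
  have e1 : D 1 (V.coeff 3) = D 0 (D 1 (V.coeff 1)) := by
    rw [d4, map_sub, D_mul, d1, D_coord, D_comm 1 0]; simp
  have e2 : D 1 (D 0 (D 1 (V.coeff 1))) = 0 := by rw [D_comm, d1, map_zero]
  have e3 : D 2 (D 1 (V.coeff 1)) = 0 := by rw [D_comm, d2]
  have f4 : D 2 (D 2 (V.coeff 3)) = 0 := by
    rw [d4, map_sub, D_mul, D_coord, D_comm 2 1, d2, D_comm 2 0, map_sub, D_comm 2 0, f1]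
    simp
  have a6 : D 0 (D 0 (D 1 (V.coeff 1))) = 0 := two_mul_cancel (by
    rw [← D_two_mul, ← D_two_mul, c2, a5, mul_zero])
  have e5 : D 3 (D 1 (V.coeff 1)) = 0 := by rw [D_comm, b2, map_zero]
  set z := graphPoint w P
  have u3 : (coord 3 : SmoothRing (stripOpens I)).1 z = (jetAt w P).u := rfl
  have k1 := eq_iff.1 c1 z
  have k2 := eq_iff.1 c3 z
  have k3 := eq_iff.1 d4 z
  have k4 := eq_iff.1 c2 z
  change 0 = (jetAt w P).eqn (σ.toFun (z.1 0)) at heq'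
  change Jet.prolonged z (jetAt w P) V.coeff (σ.toFun (z.1 0)) (deriv σ.toFun (z.1 0)) = 0
  have two : ∀ F : SmoothRing (stripOpens I), (2 * F).1 z = 2 * F.1 z := fun _ => rfl
  have ntwo : ∀ F : SmoothRing (stripOpens I), (-2 * timeFn σ.toSmoothFn * F).1 z
    = -2 * σ.toFun (z.1 0) * F.1 z := fun _ => rfl
  have three : ∀ F : SmoothRing (stripOpens I), (3 * F).1 z = 3 * F.1 z := fun _ => rfl
  simp only [val_mul, val_sub, val_add, two, three, ntwo, timeFn_apply, u3, SmoothFn.derivative,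
    val_zero] at k1 k2 k3 k4
  rw [Jet.prolonged_eq_of_projectable a1 a2 a3 a4 b1 b2, Jet.dXXX]
  simp only [d1, d3, e1, e2, e3, e5, f1, f4, a6, g1, map_zero, map_neg, val_zero, val_neg]
  rw [k1, k3]
  simp only [Jet.eqn] at heq'
  rw [← k4]
  linear_combination (jetAt w P).yy * k2 + 4 * (D 1 (V.coeff 1)).1 z * heq'

theorem isPointSymmetry_iff_determining (σ : Coeff I) (V : VF I) :
    IsPointSymmetry σ V ↔ Determining σ V.coeff :=
  ⟨fun h => h.determining, fun h => h.isPointSymmetry⟩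

/-! ### Vector fields by coefficients -/

namespace VF

theorem coeff_apply (V : VF I) (j : Fin 4) (z : stripOpens I) : (V.coeff j).1 z = V.1 z j := rfl

theorem coeff_mk (v : (Fin 4 → ℝ) → Fin 4 → ℝ) (hv : ContDiffOn ℝ ∞ v (strip I)) (j : Fin 4)
    (z : stripOpens I) : ((VF.mk v hv).coeff j).1 z = v z j :=
  congrFun (Set.indicator_of_mem (s := strip I) z.2 v) j

theorem coeff_injective {V W : VF I} (h : ∀ j, V.coeff j = W.coeff j) : V = W :=
  VF.ext_on fun p hp => funext fun j => eq_iff.1 (h j) ⟨p, hp⟩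

theorem coeff_add (V W : VF I) (j : Fin 4) : (V + W).coeff j = V.coeff j + W.coeff j := rfl

theorem coeff_smul (c : ℝ) (V : VF I) (j : Fin 4) : (c • V).coeff j = c • V.coeff j := rfl

theorem coeff_zero (j : Fin 4) : (0 : VF I).coeff j = 0 := rfl

/-- The coefficients of the commutator. -/
theorem coeff_lie (V W : VF I) (j : Fin 4) :
    (⁅V, W⁆ : VF I).coeff j
      = ∑ i, (V.coeff i * D i (W.coeff j) - W.coeff i * D i (V.coeff j)) := by
  refine eq_iff.2 fun z => ?_
  have key : ∀ A B : VF I, (fderivWithin ℝ B.1 (strip I) z (A.1 z)) j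
      = ∑ i, (A.coeff i).1 z * (D i (B.coeff j)).1 z := by
    intro A B
    have hB : DifferentiableAt ℝ B.1 z :=
      (B.2.1.contDiffAt ((isOpen_strip I).mem_nhds z.2)).differentiableAt (by simp)
    rw [fderivWithin_of_isOpen (isOpen_strip I) z.2]
    conv_lhs => rw [← Finset.univ_sum_single (A.1 z), map_sum, Finset.sum_apply]
    refine Finset.sum_congr rfl fun i _ => ?_
    rw [show (Pi.single i (A.1 z i) : Fin 4 → ℝ) = A.1 z i • Pi.single i 1 by
      rw [← Pi.single_smul, smul_eq_mul, mul_one], map_smul, Pi.smul_apply, smul_eq_mul,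
      D_apply_of_eq (F := fun p => B.1 p j) (fun q => rfl), fderiv_apply hB]
    rfl
  rw [coeff_apply, VF.bracket_apply V W z.2, lieBracketWithin, Pi.sub_apply, key, key,
    ← Finset.sum_sub_distrib]
  rw [← evalAt_apply z (∑ i, _), map_sum]
  rfl

end VF

section coefficients

variable (σ : Coeff I)

/-- The function `g' / (2σ)`. -/
def ratio (g : SmoothFn I) : SmoothFn I := ⟨_, contDiffOn_ratio σ g⟩

theorem two_mul_ratio (g : SmoothFn I) :
    2 * (timeFn σ.toSmoothFn * timeFn (ratio σ g)) = timeFn g.derivative := by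
  refine eq_iff.2 fun z => ?_
  have hs := σ.ne_zero _ z.2
  change 2 * (σ.toFun (z.1 0) * (deriv g.toFun (z.1 0) / (2 * σ.toFun (z.1 0))))
    = deriv g.toFun (z.1 0)
  field_simp

theorem fieldX_coeff (f : SmoothFn I) :
    (fieldX f).coeff = ![0, timeFn f, 0, timeFn f.derivative] := by
  funext j
  refine eq_iff.2 fun z => ?_
  rw [fieldX, VF.coeff_mk]
  fin_cases j <;> rfl

theorem fieldY_coeff (g : SmoothFn I) :
    (fieldY σ g).coeff = ![0, -timeFn (ratio σ g) * coord 2, timeFn g,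
      -timeFn (ratio σ g).derivative * coord 2] := by
  funext j
  refine eq_iff.2 fun z => ?_
  rw [fieldY, VF.coeff_mk]
  fin_cases j <;> rfl

/-- The symmetry `τ ∂_t + τ'/2 x ∂_x + k y ∂_y + (τ''/2 x - τ'/2 u) ∂_u` with
`τ = A t² + B t + C`. -/
def liftField (I : TopologicalSpace.Opens ℝ) (A B C k : ℝ) : VF I :=
  VF.mk (fun p => ![A * p 0 ^ 2 + B * p 0 + C, (A * p 0 + B / 2) * p 1, k * p 2,
      A * p 1 - (A * p 0 + B / 2) * p 3])
    (contDiffOn_vec (by fun_prop) (by fun_prop) (by fun_prop) (by fun_prop))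

/-- Real constants on the strip. -/
abbrev const (I : TopologicalSpace.Opens ℝ) (c : ℝ) : SmoothRing (stripOpens I) :=
  algebraMap ℝ _ c

theorem D_const (i : Fin 4) (c : ℝ) : D i (const I c) = 0 := D_algebraMap i c

theorem two_mul_const_half (c : ℝ) : 2 * const I (c / 2) = const I c := eq_iff.2 fun z => by
  change 2 * (c / 2) = c
  ring

theorem liftField_coeff (A B C k : ℝ) :
    (liftField I A B C k).coeff = ![const I A * coord 0 ^ 2 + const I B * coord 0 + const I C,
      (const I A * coord 0 + const I (B / 2)) * coord 1, const I k * coord 2,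
      const I A * coord 1 - (const I A * coord 0 + const I (B / 2)) * coord 3] := by
  funext j
  refine eq_iff.2 fun z => ?_
  rw [liftField, VF.coeff_mk]
  fin_cases j <;> rfl

/-- The condition `τ σ' + 3/2 τ' σ = 2 k σ` on `τ = A t² + B t + C` and `k` under which the field
`liftField I A B C k` is a symmetry. -/
def Admissible (A B C k : ℝ) : Prop :=
  ∀ t ∈ I, (A * t ^ 2 + B * t + C) * deriv σ.toFun t + 3 / 2 * (2 * A * t + B) * σ.toFun t
    = 2 * k * σ.toFun t

end coefficients

/-! ### Integration of the determining equations -/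

theorem convex_strip (hI : IsConnected (I : Set ℝ)) :
    Convex ℝ (stripOpens I : Set (Fin 4 → ℝ)) := by
  have h := hI.isPreconnected.ordConnected.convex (𝕜 := ℝ)
  intro p hp q hq a b ha hb hab
  exact h hp hq ha hb hab

/-- A function on the strip whose derivatives in `x`, `y`, `u` vanish depends on `t` only. -/
theorem exists_eq_timeFn (F : SmoothRing (stripOpens I)) (h1 : D 1 F = 0) (h2 : D 2 F = 0)
    (h3 : D 3 F = 0) : ∃ f : SmoothFn I, F = timeFn f := by
  -- compare the values of `F` at the two ends of a segment on which `t` is constant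
  refine ⟨⟨fun t => extend F ![t, 0, 0, 0], (contDiffOn_extend F).comp
    (contDiff_pi.2 fun i => ?_).contDiffOn fun t ht => ht⟩, eq_iff.2 fun z => ?_⟩
  · fin_cases i
    · exact contDiff_id
    all_goals exact contDiff_const
  set v : Fin 4 → ℝ := ![0, z.1 1, z.1 2, z.1 3] with hv
  set o : Fin 4 → ℝ := ![z.1 0, 0, 0, 0] with ho
  have hmem : ∀ s : ℝ, o + s • v ∈ stripOpens I := by
    intro s
    change (o + s • v) 0 ∈ I
    rw [show (o + s • v) 0 = z.1 0 by simp [ho, hv]]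
    exact z.2
  have hd : ∀ s : ℝ, HasDerivAt (fun s : ℝ => extend F (o + s • v)) 0 s := by
    intro s
    have hγ : HasDerivAt (fun s : ℝ => o + s • v) v s := by
      simpa using ((hasDerivAt_id s).smul_const v).const_add o
    have hF := (SmoothRing.differentiableAt (contDiffOn_extend F) ⟨_, hmem s⟩).hasFDerivAt
    have := hF.comp_hasDerivAt s hγ
    have e : fderiv ℝ (extend F) (o + s • v) v = 0 := by
      rw [← Finset.univ_sum_single v, map_sum, Fin.sum_univ_four]
      have hs : ∀ i c, fderiv ℝ (extend F) (o + s • v) (Pi.single i c)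
          = c * (D i F).1 ⟨_, hmem s⟩ := by
        intro i c
        rw [show (Pi.single i c : Fin 4 → ℝ) = c • Pi.single i 1 by
          rw [← Pi.single_smul, smul_eq_mul, mul_one], map_smul, smul_eq_mul]
        rfl
      rw [Finset.univ_sum_single v]
      simp only [hs, h1, h2, h3]
      simp [hv]
    rw [show (fderiv ℝ (extend F) ((⟨_, hmem s⟩ : stripOpens I) : Fin 4 → ℝ)) v = 0 from e] at this
    exact this
  have hc := is_const_of_deriv_eq_zero (fun s => (hd s).differentiableAt)
    (fun s => (hd s).deriv) 1 0
  have e1 : o + (1 : ℝ) • v = z.1 := by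
    funext i; fin_cases i <;> simp [ho, hv]
  simp only [e1, zero_smul, add_zero] at hc
  rw [← extend_apply, hc]
  rfl

/-- A function of `t` with vanishing third derivative is a quadratic polynomial. -/
theorem exists_eq_quadratic (hI : IsConnected (I : Set ℝ)) {T : SmoothRing (stripOpens I)}
    (a1 : D 1 T = 0) (b1 : D 2 T = 0) (a2 : D 3 T = 0) (a5 : D 0 (D 0 (D 0 T)) = 0) :
    ∃ A B C : ℝ, T = const I A * (coord 0 * coord 0) + const I B * coord 0 + const I C := by
  have hc := convex_strip hI
  obtain ⟨A₂, hA⟩ := exists_eq_algebraMap hc (D 0 (D 0 T)) fun i => by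
    fin_cases i
    · exact a5
    · change D 1 _ = 0
      rw [D_comm, D_comm 1 0, a1, map_zero, map_zero]
    · change D 2 _ = 0
      rw [D_comm, D_comm 2 0, b1, map_zero, map_zero]
    · change D 3 _ = 0
      rw [D_comm, D_comm 3 0, a2, map_zero, map_zero]
  obtain ⟨B, hB⟩ := exists_eq_algebraMap hc (D 0 T - const I A₂ * coord 0) fun i => by
    rw [map_sub, D_mul, D_coord, D_const]
    fin_cases i
    · change D 0 _ - _ = 0
      rw [hA]; simp
    · change D 1 _ - _ = 0
      rw [D_comm, a1]; simp
    · change D 2 _ - _ = 0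
      rw [D_comm, b1]; simp
    · change D 3 _ - _ = 0
      rw [D_comm, a2]; simp
  have hB' : D 0 T = const I A₂ * coord 0 + const I B := by
    rw [← sub_eq_iff_eq_add']; exact hB
  obtain ⟨C, hC⟩ := exists_eq_algebraMap hc
      (T - (const I (A₂ / 2) * (coord 0 * coord 0) + const I B * coord 0)) fun i => by
    rw [map_sub, map_add, D_mul, D_mul, D_mul, D_coord, D_const, D_const]
    have : const I A₂ = 2 * const I (A₂ / 2) := (two_mul_const_half A₂).symm
    fin_cases i
    · change D 0 _ - _ = 0
      rw [hB', this]; simp; ring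
    · change D 1 _ - _ = 0
      rw [a1]; simp
    · change D 2 _ - _ = 0
      rw [b1]; simp
    · change D 3 _ - _ = 0
      rw [a2]; simp
  refine ⟨A₂ / 2, B, C, ?_⟩
  rw [← sub_eq_iff_eq_add']
  exact hC

/-- The solution of the determining equations: `τ` is quadratic in `t`, `η_y` is a constant `k`,
and `g`, `f` are the integration constants of `η` in `y` and of `ξ` in `(x, y)`. -/
theorem Determining.exists_normalForm (hI : IsConnected (I : Set ℝ)) {σ : Coeff I} {V : VF I}
    (h : Determining σ V.coeff) : ∃ (A B C k : ℝ) (f g : SmoothFn I), Admissible σ A B C k ∧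
      V = liftField I A B C k + (fieldX f + fieldY σ g) := by
  obtain ⟨a1, b1, a2, a5, a3, a4, g1, b2, c2, f1, c1, d4, c3⟩ := h
  have hc := convex_strip hI
  obtain ⟨A, B, C, hC'⟩ := exists_eq_quadratic hI a1 b1 a2 a5
  obtain ⟨k, hk⟩ := exists_eq_algebraMap hc (D 2 (V.coeff 2)) fun i => by
    fin_cases i
    · change D 0 _ = 0
      rw [D_comm, c1, show -2 * timeFn σ.toSmoothFn * D 2 (V.coeff 1)
        = 2 * -(timeFn σ.toSmoothFn * D 2 (V.coeff 1)) by ring, D_two_mul, map_neg, D_mul, f1,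
        D_timeFn_two]
      simp
    · change D 1 _ = 0
      rw [D_comm, a3, map_zero]
    · exact g1
    · change D 3 _ = 0
      rw [D_comm, a4, map_zero]
  obtain ⟨g, hg⟩ := exists_eq_timeFn (V.coeff 2 - const I k * coord 2)
    (by rw [map_sub, D_mul, D_coord, D_const, a3]; simp)
    (by rw [map_sub, D_mul, D_coord, D_const, hk]; simp)
    (by rw [map_sub, D_mul, D_coord, D_const, a4]; simp)
  have hg' : V.coeff 2 = const I k * coord 2 + timeFn g := by rw [← sub_eq_iff_eq_add']; exact hg
  have hr : D 2 (V.coeff 1) = -timeFn (ratio σ g) := by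
    refine timeFn_mul_cancel σ (two_mul_cancel ?_)
    have := two_mul_ratio σ g
    rw [hg', map_add, D_mul, D_coord, D_const, D_timeFn_zero] at c1
    simp only [Fin.reduceEq, if_false, mul_zero, zero_mul, zero_add] at c1
    linear_combination c1 + this
  have hx : D 1 (V.coeff 1) = const I A * coord 0 + const I (B / 2) := by
    refine two_mul_cancel ?_
    rw [c2, hC']
    simp only [map_add, D_mul, D_coord, D_const]
    refine eq_iff.2 fun z => ?_
    change A * (z.1 0 * 1 + 1 * z.1 0) + 0 * (z.1 0 * z.1 0) + (B * 1 + 0 * z.1 0) + 0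
      = 2 * (A * z.1 0 + B / 2)
    ring
  obtain ⟨f, hf⟩ := exists_eq_timeFn (V.coeff 1
      - ((const I A * coord 0 + const I (B / 2)) * coord 1
        + -timeFn (ratio σ g) * coord 2))
    (by simp only [map_sub, map_add, map_neg, D_mul, D_coord, D_const, D_timeFn_one, hx]; simp)
    (by simp only [map_sub, map_add, map_neg, D_mul, D_coord, D_const, D_timeFn_two, hr]; simp)
    (by simp only [map_sub, map_add, map_neg, D_mul, D_coord, D_const, D_timeFn_three, b2]; simp)
  have hf' : V.coeff 1 = (const I A * coord 0 + const I (B / 2)) * coord 1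
        + -timeFn (ratio σ g) * coord 2 + timeFn f := by rw [← sub_eq_iff_eq_add']; exact hf
  have hp : V.coeff 3 = const I A * coord 1
      - (const I A * coord 0 + const I (B / 2)) * coord 3
      + (timeFn f.derivative + -timeFn (ratio σ g).derivative * coord 2) := by
    rw [d4, hx, hf']
    simp only [map_add, map_neg, D_mul, D_coord, D_const, D_timeFn_zero]
    simp
    ring
  refine ⟨A, B, C, k, f, g, fun t ht => ?_, VF.coeff_injective fun j => ?_⟩
  · rw [hC', hx, hk] at c3
    have := eq_iff.1 c3 ⟨![t, 0, 0, 0], ht⟩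
    change (A * (t * t) + B * t + C) * deriv σ.toFun t
      + σ.toFun t * (3 * (A * t + B / 2) - 2 * k) = 0 at this
    linear_combination this
  · rw [VF.coeff_add, VF.coeff_add, liftField_coeff, fieldX_coeff, fieldY_coeff]
    fin_cases j
    · simp [hC', pow_two]
    · simp [hf']; ring
    · simp [hg']
    · simp [hp]

theorem determining_liftField {σ : Coeff I} {A B C k : ℝ} (h : Admissible σ A B C k) :
    Determining σ (liftField I A B C k).coeff := by
  rw [liftField_coeff]
  constructor <;>
    simp only [Matrix.cons_val_zero, Matrix.cons_val_one, Matrix.cons_val, map_add,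
      D_mul, D_coord, D_const, pow_two, Fin.reduceEq, if_true, if_false, mul_zero, mul_one,
      zero_mul, add_zero, zero_add, map_zero, Derivation.map_one_eq_zero]
  · rw [mul_add, two_mul_const_half]; ring
  · ring
  · exact eq_iff.2 fun z => by
      have := h _ z.2
      change (A * (z.1 0 * z.1 0) + B * z.1 0 + C) * deriv σ.toFun (z.1 0)
        + σ.toFun (z.1 0) * (3 * (A * z.1 0 + B / 2) - 2 * k) = 0
      linear_combination this

theorem determining_fieldX (σ : Coeff I) (f : SmoothFn I) : Determining σ (fieldX f).coeff := by
  rw [fieldX_coeff]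
  constructor <;> simp [D_timeFn_zero, D_timeFn_one, D_timeFn_two, D_timeFn_three]

theorem determining_fieldY (σ : Coeff I) (g : SmoothFn I) :
    Determining σ (fieldY σ g).coeff := by
  rw [fieldY_coeff]
  constructor <;> simp [D_timeFn_zero, D_timeFn_one, D_timeFn_two, D_timeFn_three, D_coord]
  · rw [← two_mul_ratio σ g]
    ring
  · ring

theorem Determining.add {σ : Coeff I} {V W : VF I} (hV : Determining σ V.coeff)
    (hW : Determining σ W.coeff) : Determining σ (V + W).coeff := by
  obtain ⟨a1, a2, a3, a4, a5, a6, a7, a8, a9, a10, a11, a12, a13⟩ := hV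
  obtain ⟨b1, b2, b3, b4, b5, b6, b7, b8, b9, b10, b11, b12, b13⟩ := hW
  constructor <;> simp only [VF.coeff_add, map_add]
  · rw [a1, b1, add_zero]
  · rw [a2, b2, add_zero]
  · rw [a3, b3, add_zero]
  · rw [a4, b4, add_zero]
  · rw [a5, b5, add_zero]
  · rw [a6, b6, add_zero]
  · rw [a7, b7, add_zero]
  · rw [a8, b8, add_zero]
  · linear_combination a9 + b9
  · rw [a10, b10, add_zero]
  · linear_combination a11 + b11
  · linear_combination a12 + b12
  · linear_combination a13 + b13

/-- The point symmetries in closed form. -/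
theorem isPointSymmetry_iff (hI : IsConnected (I : Set ℝ)) (σ : Coeff I) (V : VF I) :
    IsPointSymmetry σ V ↔ ∃ (A B C k : ℝ) (f g : SmoothFn I), Admissible σ A B C k ∧
      V = liftField I A B C k + (fieldX f + fieldY σ g) := by
  rw [isPointSymmetry_iff_determining]
  refine ⟨fun h => h.exists_normalForm hI, ?_⟩
  rintro ⟨A, B, C, k, f, g, h, rfl⟩
  exact (determining_liftField h).add ((determining_fieldX σ f).add (determining_fieldY σ g))

/-! ### Commutation relations -/

/-- A field is `X(f)` as soon as its coefficients are; the derivative `f'` is written as `∂_t f`,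
which makes the commutation relations a matter of algebra. -/
theorem fieldX_eq {f : SmoothFn I} {V : VF I} (h0 : V.coeff 0 = 0) (h1 : V.coeff 1 = timeFn f)
    (h2 : V.coeff 2 = 0) (h3 : V.coeff 3 = D 0 (timeFn f)) : V = fieldX f := by
  refine VF.coeff_injective fun j => ?_
  rw [fieldX_coeff, ← D_timeFn_zero]
  fin_cases j
  · exact h0
  · exact h1
  · exact h2
  · exact h3

/-- A field is `Y(g)` as soon as its coefficients are, where `R = g' / (2σ)` is characterized by
`2σR = g'`. -/
theorem fieldY_eq {σ : Coeff I} {g : SmoothFn I} {V : VF I} {R : SmoothRing (stripOpens I)}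
    (hR : 2 * (timeFn σ.toSmoothFn * R) = D 0 (timeFn g)) (h0 : V.coeff 0 = 0)
    (h1 : V.coeff 1 = -R * coord 2) (h2 : V.coeff 2 = timeFn g)
    (h3 : V.coeff 3 = -D 0 R * coord 2) : V = fieldY σ g := by
  have hR' : R = timeFn (ratio σ g) := timeFn_mul_cancel σ (two_mul_cancel (by
    rw [hR, two_mul_ratio, ← D_timeFn_zero]))
  refine VF.coeff_injective fun j => ?_
  rw [fieldY_coeff, ← D_timeFn_zero, ← hR']
  fin_cases j
  · exact h0
  · exact h1
  · exact h2
  · exact h3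

theorem lie_fieldX_fieldX (f h : SmoothFn I) : ⁅fieldX f, fieldX h⁆ = 0 := by
  refine VF.coeff_injective fun j => ?_
  rw [VF.coeff_lie, fieldX_coeff, fieldX_coeff, Fin.sum_univ_four]
  fin_cases j <;> simp [D_timeFn, VF.coeff_zero]

theorem lie_fieldX_fieldY (σ : Coeff I) (f g : SmoothFn I) : ⁅fieldX f, fieldY σ g⁆ = 0 := by
  refine VF.coeff_injective fun j => ?_
  rw [VF.coeff_lie, fieldX_coeff, fieldY_coeff, Fin.sum_univ_four]
  fin_cases j <;> simp [D_timeFn, VF.coeff_zero, D_coord]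

theorem lie_fieldY_fieldX (σ : Coeff I) (f g : SmoothFn I) : ⁅fieldY σ g, fieldX f⁆ = 0 := by
  rw [← lie_skew, lie_fieldX_fieldY, neg_zero]

/-- The function `f` with `[Y(g), Y(h)] = X(f)`. -/
def wronskian (σ : Coeff I) (g h : SmoothFn I) : SmoothFn I :=
  ⟨fun t => h.toFun t * (ratio σ g).toFun t - g.toFun t * (ratio σ h).toFun t,
    (h.smooth.mul (ratio σ g).smooth).sub (g.smooth.mul (ratio σ h).smooth)⟩

theorem timeFn_wronskian (σ : Coeff I) (g h : SmoothFn I) : timeFn (wronskian σ g h)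
    = timeFn h * timeFn (ratio σ g) - timeFn g * timeFn (ratio σ h) := rfl

theorem lie_fieldY_fieldY (σ : Coeff I) (g h : SmoothFn I) :
    ⁅fieldY σ g, fieldY σ h⁆ = fieldX (wronskian σ g h) := by
  have e1 := two_mul_ratio σ g
  have e2 := two_mul_ratio σ h
  apply fieldX_eq <;> rw [VF.coeff_lie, fieldY_coeff, fieldY_coeff, Fin.sum_univ_four]
  · simp
  · simp [D_timeFn, D_coord, timeFn_wronskian]
    ring
  · simp [D_timeFn]
  · simp [D_timeFn, D_coord, timeFn_wronskian]
    rw [← e1, ← e2]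
    ring

/-- The function `τ f' - τ'/2 f`. -/
def actX (A B C : ℝ) (f : SmoothFn I) : SmoothFn I :=
  ⟨fun t => (A * t ^ 2 + B * t + C) * f.derivative.toFun t - (A * t + B / 2) * f.toFun t,
    (ContDiffOn.mul (by fun_prop) f.derivative.smooth).sub (ContDiffOn.mul (by fun_prop) f.smooth)⟩

theorem timeFn_actX (A B C : ℝ) (f : SmoothFn I) : timeFn (actX A B C f)
    = (const I A * coord 0 ^ 2 + const I B * coord 0 + const I C) * timeFn f.derivative
      - (const I A * coord 0 + const I (B / 2)) * timeFn f := rfl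

/-- The function `τ g' - k g`. -/
def actY (A B C k : ℝ) (g : SmoothFn I) : SmoothFn I :=
  ⟨fun t => (A * t ^ 2 + B * t + C) * g.derivative.toFun t - k * g.toFun t,
    (ContDiffOn.mul (by fun_prop) g.derivative.smooth).sub (ContDiffOn.mul (by fun_prop) g.smooth)⟩

theorem timeFn_actY (A B C k : ℝ) (g : SmoothFn I) : timeFn (actY A B C k g)
    = (const I A * coord 0 ^ 2 + const I B * coord 0 + const I C) * timeFn g.derivative
      - const I k * timeFn g := rfl

theorem lie_liftField_fieldX (A B C k : ℝ) (f : SmoothFn I) :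
    ⁅liftField I A B C k, fieldX f⁆ = fieldX (actX A B C f) := by
  apply fieldX_eq <;> rw [VF.coeff_lie, fieldX_coeff, liftField_coeff, Fin.sum_univ_four]
  · simp [D_coord, pow_two]
  · simp [D_timeFn, D_coord, timeFn_actX, pow_two]
    ring
  · simp [D_coord]
  · simp [D_timeFn, D_coord, timeFn_actX, pow_two]
    linear_combination timeFn f.derivative * two_mul_const_half (I := I) B

theorem lie_liftField_fieldY {σ : Coeff I} {A B C k : ℝ} (h : Admissible σ A B C k)
    (g : SmoothFn I) : ⁅liftField I A B C k, fieldY σ g⁆ = fieldY σ (actY A B C k g) := by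
  have e0 := two_mul_ratio σ g
  have e1 := congrArg (D 0) e0
  rw [D_two_mul, D_mul, D_timeFn_zero, D_timeFn_zero, D_timeFn_zero] at e1
  -- the admissibility condition as an identity in the ring of smooth functions on the strip
  have e2 : (const I A * coord 0 ^ 2 + const I B * coord 0 + const I C)
      * timeFn σ.toSmoothFn.derivative
      + 3 * (const I A * coord 0 + const I (B / 2)) * timeFn σ.toSmoothFn
      = 2 * const I k * timeFn σ.toSmoothFn := eq_iff.2 fun z => by
    have := h _ z.2
    change (A * z.1 0 ^ 2 + B * z.1 0 + C) * deriv σ.toFun (z.1 0)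
      + 3 * (A * z.1 0 + B / 2) * σ.toFun (z.1 0) = 2 * k * σ.toFun (z.1 0)
    linear_combination this
  have eB := two_mul_const_half (I := I) B
  set a := const I A
  set b := const I B
  set b' := const I (B / 2)
  set c := const I C
  set t : SmoothRing (stripOpens I) := coord 0
  set S := timeFn σ.toSmoothFn
  set S' := timeFn σ.toSmoothFn.derivative
  set R := timeFn (ratio σ g) with hR
  set R' := timeFn (ratio σ g).derivative with hR'
  apply fieldY_eq (R := (a * t ^ 2 + b * t + c) * R' + const I k * R - (a * t + b') * R)
  · rw [timeFn_actY]
    simp only [map_add, map_sub, D_mul, pow_two, D_const, D_timeFn_zero, D_coord, if_true]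
    linear_combination (a * t ^ 2 + b * t + c) * e1 - 2 * R * e2 + (2 * a * t + b - const I k) * e0
      + 2 * S * R * eB
  all_goals rw [VF.coeff_lie, fieldY_coeff, liftField_coeff, Fin.sum_univ_four]
  · simp [D_coord, pow_two]
  · simp [D_timeFn, D_coord]
    ring
  · simp [D_timeFn, D_coord, timeFn_actY]
    ring
  · have e3 : D 0 a = 0 := D_const 0 A
    have e4 : D 0 b = 0 := D_const 0 B
    have e5 : D 0 c = 0 := D_const 0 C
    have e6 : D 0 b' = 0 := D_const 0 _
    have e7 : D 0 t = 1 := by simp [t, D_coord]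
    simp only [Matrix.cons_val_zero, Matrix.cons_val_one, Matrix.cons_val, map_add, map_sub,
      map_neg, D_mul, pow_two, e3, e4, e5, e6, e7, D_const, D_coord, D_timeFn_zero, D_timeFn_one,
      D_timeFn_two, D_timeFn_three, hR, hR']
    simp
    linear_combination -R' * coord 2 * eB

theorem lie_liftField_liftField (A B C k A' B' C' k' : ℝ) :
    ⁅liftField I A B C k, liftField I A' B' C' k'⁆
      = liftField I (B * A' - A * B') (2 * (C * A' - C' * A)) (C * B' - C' * B) 0 := by
  refine VF.coeff_injective fun j => ?_
  rw [VF.coeff_lie]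
  simp only [liftField_coeff, Fin.sum_univ_four]
  fin_cases j <;> simp [D_coord, pow_two] <;> refine eq_iff.2 fun z => ?_
  · simp
    ring
  · simp
    ring
  · simp
    ring
  · simp
    ring

/-! ### The symmetry algebra -/

/-- A polynomial of degree at most three that vanishes on a nonempty open set is zero. -/
theorem cubic_eq_zero {I : TopologicalSpace.Opens ℝ} (hI : (I : Set ℝ).Nonempty) {a b c d : ℝ}
    (h : ∀ t ∈ I, a * t ^ 3 + b * t ^ 2 + c * t + d = 0) : a = 0 ∧ b = 0 ∧ c = 0 ∧ d = 0 := by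
  have hinf : (I : Set ℝ).Infinite := by
    obtain ⟨t, ht⟩ := hI
    exact infinite_of_mem_nhds t (I.isOpen.mem_nhds ht)
  have hp : (Polynomial.C a * Polynomial.X ^ 3 + Polynomial.C b * Polynomial.X ^ 2
      + Polynomial.C c * Polynomial.X + Polynomial.C d : Polynomial ℝ) = 0 :=
    Polynomial.eq_zero_of_infinite_isRoot _ (hinf.mono fun t ht => by
      simpa [Polynomial.IsRoot] using h t ht)
  refine ⟨?_, ?_, ?_, ?_⟩
  · simpa [Polynomial.coeff_X, Polynomial.coeff_C] using congrArg (Polynomial.coeff · 3) hp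
  · simpa [Polynomial.coeff_X, Polynomial.coeff_C] using congrArg (Polynomial.coeff · 2) hp
  · simpa [Polynomial.coeff_X, Polynomial.coeff_C] using congrArg (Polynomial.coeff · 1) hp
  · simpa [Polynomial.coeff_X, Polynomial.coeff_C] using congrArg (Polynomial.coeff · 0) hp

theorem fieldX_add (f h : SmoothFn I) :
    fieldX f + fieldX h = fieldX ⟨fun t => f.toFun t + h.toFun t, f.smooth.add h.smooth⟩ := by
  have e : timeFn (⟨fun t => f.toFun t + h.toFun t, f.smooth.add h.smooth⟩ : SmoothFn I)
    = timeFn f + timeFn h := rfl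
  apply fieldX_eq <;> simp [VF.coeff_add, fieldX_coeff, e, D_timeFn_zero]

theorem fieldX_smul (c : ℝ) (f : SmoothFn I) :
    c • fieldX f = fieldX ⟨fun t => c * f.toFun t, contDiffOn_const.mul f.smooth⟩ := by
  have e : timeFn (⟨fun t => c * f.toFun t, contDiffOn_const.mul f.smooth⟩ : SmoothFn I)
    = c • timeFn f := rfl
  apply fieldX_eq <;> simp [VF.coeff_smul, fieldX_coeff, e, D_timeFn_zero]

theorem fieldY_add (σ : Coeff I) (f h : SmoothFn I) : fieldY σ f + fieldY σ h
    = fieldY σ ⟨fun t => f.toFun t + h.toFun t, f.smooth.add h.smooth⟩ := by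
  have e : timeFn (⟨fun t => f.toFun t + h.toFun t, f.smooth.add h.smooth⟩ : SmoothFn I)
    = timeFn f + timeFn h := rfl
  have e1 := two_mul_ratio σ f
  have e2 := two_mul_ratio σ h
  apply fieldY_eq (R := timeFn (ratio σ f) + timeFn (ratio σ h))
  · rw [e, map_add, D_timeFn_zero, D_timeFn_zero, ← e1, ← e2]
    ring
  all_goals simp [VF.coeff_add, fieldY_coeff, e, D_timeFn_zero]
  · ring
  · ring

theorem fieldY_smul (σ : Coeff I) (c : ℝ) (f : SmoothFn I) : c • fieldY σ f
    = fieldY σ ⟨fun t => c * f.toFun t, contDiffOn_const.mul f.smooth⟩ := by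
  have e : timeFn (⟨fun t => c * f.toFun t, contDiffOn_const.mul f.smooth⟩ : SmoothFn I)
    = c • timeFn f := rfl
  apply fieldY_eq (R := c • timeFn (ratio σ f))
  · rw [e, D_smul, D_timeFn_zero, ← two_mul_ratio σ f]
    simp
  all_goals simp [VF.coeff_smul, fieldY_coeff, e, D_timeFn_zero, ← smul_neg]

/-- The zero function of time. -/
def SmoothFn.zero (I : TopologicalSpace.Opens ℝ) : SmoothFn I := ⟨fun _ => 0, contDiffOn_const⟩

theorem timeFn_zero : timeFn (SmoothFn.zero I) = 0 := rfl

theorem fieldX_zero : fieldX (SmoothFn.zero I) = 0 :=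
  (fieldX_eq (V := 0) rfl rfl rfl (by rw [timeFn_zero, map_zero]; rfl)).symm

theorem fieldY_zero (σ : Coeff I) : fieldY σ (SmoothFn.zero I) = 0 :=
  (fieldY_eq (R := 0) (V := 0) (by rw [timeFn_zero, map_zero]; simp) rfl
    (by simp [VF.coeff_zero]) rfl (by simp [VF.coeff_zero])).symm

theorem liftField_add (A B C k A' B' C' k' : ℝ) :
    liftField I A B C k + liftField I A' B' C' k'
      = liftField I (A + A') (B + B') (C + C') (k + k') := by
  refine VF.coeff_injective fun j => ?_
  rw [VF.coeff_add, liftField_coeff, liftField_coeff, liftField_coeff]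
  fin_cases j <;> refine eq_iff.2 fun z => ?_
  · simp [pow_two]; ring
  · simp; ring
  · simp; ring
  · simp; ring

theorem liftField_smul (c A B C k : ℝ) :
    c • liftField I A B C k = liftField I (c * A) (c * B) (c * C) (c * k) := by
  refine VF.coeff_injective fun j => ?_
  rw [VF.coeff_smul, liftField_coeff, liftField_coeff]
  fin_cases j <;> refine eq_iff.2 fun z => ?_
  · simp [pow_two]; ring
  · simp; ring
  · simp; ring
  · simp; ring

theorem liftField_zero : liftField I 0 0 0 0 = 0 := by
  have := liftField_smul (I := I) 0 0 0 0 0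
  simpa using this.symm

section algebras

variable (σ : Coeff I)

theorem Admissible.zero : Admissible σ 0 0 0 0 := fun t _ => by simp

variable {σ}

theorem Admissible.add {A B C k A' B' C' k' : ℝ} (h : Admissible σ A B C k)
    (h' : Admissible σ A' B' C' k') : Admissible σ (A + A') (B + B') (C + C') (k + k') :=
  fun t ht => by linear_combination h t ht + h' t ht

theorem Admissible.smul (c : ℝ) {A B C k : ℝ} (h : Admissible σ A B C k) :
    Admissible σ (c * A) (c * B) (c * C) (c * k) := fun t ht => by linear_combination c * h t ht

/-- The admissible quadratic polynomials are closed under the bracket of vector fields on the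
line.  Eliminating `σ'` from two of the conditions gives a quadratic polynomial that vanishes
on `I`, and the derivative of that identity is the condition for the bracket. -/
theorem Admissible.bracket (hI : (I : Set ℝ).Nonempty) {A B C k A' B' C' k' : ℝ}
    (h : Admissible σ A B C k) (h' : Admissible σ A' B' C' k') :
    Admissible σ (B * A' - A * B') (2 * (C * A' - C' * A)) (C * B' - C' * B) 0 := by
  have key : ∀ t ∈ I, 0 * t ^ 3 + (2 * (k * A' - k' * A) + 3 / 2 * (B * A' - A * B')) * t ^ 2
      + (2 * (k * B' - k' * B) + 3 / 2 * (2 * (C * A' - C' * A))) * t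
      + (2 * (k * C' - k' * C) + 3 / 2 * (C * B' - C' * B)) = 0 := by
    intro t ht
    have h1 := h t ht
    have h2 := h' t ht
    refine (mul_right_inj' (σ.ne_zero t ht)).1 ?_
    linear_combination (-(A' * t ^ 2 + B' * t + C')) * h1 + (A * t ^ 2 + B * t + C) * h2
  obtain ⟨-, e1, e2, e3⟩ := cubic_eq_zero hI key
  intro t ht
  have h1 := h t ht
  have h2 := h' t ht
  linear_combination (-(2 * A * t + B)) * h2 + (2 * A' * t + B') * h1
    + σ.toFun t * (2 * t * e1 + e2)

variable (σ)

/-- The Lie algebra of the fields `X(f) + Y(g)`, an ideal of the algebra of point symmetries. -/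
def genericIdeal : LieSubalgebra ℝ (VF I) where
  carrier := {V | ∃ f g : SmoothFn I, V = fieldX f + fieldY σ g}
  add_mem' := by
    rintro _ _ ⟨f, g, rfl⟩ ⟨f', g', rfl⟩
    exact ⟨_, _, by rw [add_add_add_comm, fieldX_add, fieldY_add]⟩
  zero_mem' := ⟨SmoothFn.zero I, SmoothFn.zero I, by rw [fieldX_zero, fieldY_zero, add_zero]⟩
  smul_mem' := by
    rintro c _ ⟨f, g, rfl⟩
    exact ⟨_, _, by rw [smul_add, fieldX_smul, fieldY_smul]⟩
  lie_mem' := by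
    rintro _ _ ⟨f, g, rfl⟩ ⟨f', g', rfl⟩
    refine ⟨wronskian σ g g', SmoothFn.zero I, ?_⟩
    rw [add_lie, lie_add, lie_add, lie_fieldX_fieldX, lie_fieldX_fieldY,
      lie_fieldY_fieldX, lie_fieldY_fieldY, fieldY_zero]
    simp

theorem fieldX_mem (f : SmoothFn I) : fieldX f ∈ genericIdeal σ :=
  ⟨f, SmoothFn.zero I, by rw [fieldY_zero, add_zero]⟩

theorem fieldY_mem (g : SmoothFn I) : fieldY σ g ∈ genericIdeal σ :=
  ⟨SmoothFn.zero I, g, by rw [fieldX_zero, zero_add]⟩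

theorem genericIdeal_le_span :
    (genericIdeal σ).toSubmodule ≤ Submodule.span ℝ (genericFields σ) := by
  rintro _ ⟨f, g, rfl⟩
  exact add_mem (Submodule.subset_span (Or.inl ⟨f, rfl⟩)) (Submodule.subset_span (Or.inr ⟨g, rfl⟩))

theorem genericAlgebra_eq : genericAlgebra σ = genericIdeal σ := by
  apply le_antisymm
  · refine LieSubalgebra.lieSpan_le.2 ?_
    rintro _ (⟨f, rfl⟩ | ⟨g, rfl⟩)
    · exact fieldX_mem σ f
    · exact fieldY_mem σ g
  · exact (genericIdeal_le_span σ).trans LieSubalgebra.submodule_span_le_lieSpan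

theorem genericAlgebra_toSubmodule :
    (genericAlgebra σ).toSubmodule = Submodule.span ℝ (genericFields σ) :=
  le_antisymm ((genericAlgebra_eq σ).symm ▸ genericIdeal_le_span σ)
    LieSubalgebra.submodule_span_le_lieSpan

/-- Double commutators of the fields `X(f) + Y(g)` vanish. -/
theorem lie_lie_eq_zero {U V W : VF I} (hU : U ∈ genericIdeal σ) (hV : V ∈ genericIdeal σ)
    (hW : W ∈ genericIdeal σ) : ⁅U, ⁅V, W⁆⁆ = 0 := by
  obtain ⟨f, g, rfl⟩ := hU
  obtain ⟨f', g', rfl⟩ := hV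
  obtain ⟨f'', g'', rfl⟩ := hW
  have : ⁅fieldX f' + fieldY σ g', fieldX f'' + fieldY σ g''⁆ = fieldX (wronskian σ g' g'') := by
    rw [add_lie, lie_add, lie_add, lie_fieldX_fieldX, lie_fieldX_fieldY,
      lie_fieldY_fieldX, lie_fieldY_fieldY]
    simp
  rw [this, add_lie, lie_fieldX_fieldX, lie_fieldY_fieldX, add_zero]

theorem isNilpotent_genericIdeal : LieRing.IsNilpotent (genericIdeal σ) := by
  refine (LieModule.isNilpotent_iff ℝ (genericIdeal σ) (genericIdeal σ)).2 ⟨2, ?_⟩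
  rw [LieModule.lowerCentralSeries_succ, LieModule.lowerCentralSeries_succ,
    LieModule.lowerCentralSeries_zero, eq_bot_iff, LieSubmodule.lie_le_iff]
  have h1 : ⁅(⊤ : LieIdeal ℝ (genericIdeal σ)),
        (⊤ : LieSubmodule ℝ (genericIdeal σ) (genericIdeal σ))⁆
      ≤ LieModule.maxTrivSubmodule ℝ (genericIdeal σ) (genericIdeal σ) := by
    rw [LieSubmodule.lie_le_iff]
    intro V _ W _
    rw [LieModule.mem_maxTrivSubmodule]
    intro U
    exact Subtype.ext (lie_lie_eq_zero σ U.2 V.2 W.2)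
  intro U _ V hV
  rw [(LieModule.mem_maxTrivSubmodule _ _ _ _).1 (h1 hV) U]
  exact zero_mem _

theorem contDiff_eval (P : Polynomial ℝ) : ContDiff ℝ ∞ fun t => P.eval t :=
  P.contDiff_aeval (n := ∞)

/-- The `X(f)` with polynomial `f` already span a space of infinite dimension. -/
theorem not_finite_genericIdeal (hI : (I : Set ℝ).Nonempty) :
    ¬ Module.Finite ℝ (genericIdeal σ) := by
  intro hfin
  let φ : Polynomial ℝ →ₗ[ℝ] genericIdeal σ :=
    { toFun := fun P => ⟨fieldX ⟨fun t => P.eval t, (contDiff_eval P).contDiffOn⟩, fieldX_mem σ _⟩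
      map_add' := fun P Q => Subtype.ext (by
        simp only [Polynomial.eval_add]
        exact (fieldX_add ⟨fun t => P.eval t, (contDiff_eval P).contDiffOn⟩
          ⟨fun t => Q.eval t, (contDiff_eval Q).contDiffOn⟩).symm)
      map_smul' := fun c P => Subtype.ext (by
        simp only [Polynomial.eval_smul, smul_eq_mul, RingHom.id_apply]
        exact (fieldX_smul c ⟨fun t => P.eval t, (contDiff_eval P).contDiffOn⟩).symm) }
  have hφ : Function.Injective φ := by
    rw [← LinearMap.ker_eq_bot, LinearMap.ker_eq_bot']
    intro P hP
    have hinf : (I : Set ℝ).Infinite := by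
      obtain ⟨t, ht⟩ := hI
      exact infinite_of_mem_nhds t (I.isOpen.mem_nhds ht)
    refine Polynomial.eq_zero_of_infinite_isRoot _ (hinf.mono fun t ht => ?_)
    have e := congrArg (fun V : genericIdeal σ => (V.1.coeff 1).1 ⟨![t, 0, 0, 0], ht⟩) hP
    have e' : ((fieldX ⟨fun t => P.eval t, (contDiff_eval P).contDiffOn⟩ : VF I).coeff 1).1
      ⟨![t, 0, 0, 0], ht⟩ = 0 := e
    rw [fieldX_coeff] at e'
    exact e'
  exact Polynomial.not_finite (Module.Finite.of_injective φ hφ)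

variable {σ}

/-- The complement of `genericIdeal`: the fields `liftField I A B C k` that are symmetries. -/
def complement (hI : (I : Set ℝ).Nonempty) (σ : Coeff I) : LieSubalgebra ℝ (VF I) where
  carrier := {V | ∃ A B C k, Admissible σ A B C k ∧ V = liftField I A B C k}
  add_mem' := by
    rintro _ _ ⟨A, B, C, k, h, rfl⟩ ⟨A', B', C', k', h', rfl⟩
    exact ⟨_, _, _, _, h.add h', liftField_add _ _ _ _ _ _ _ _⟩
  zero_mem' := ⟨0, 0, 0, 0, Admissible.zero σ, liftField_zero.symm⟩
  smul_mem' := by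
    rintro c _ ⟨A, B, C, k, h, rfl⟩
    exact ⟨_, _, _, _, h.smul c, liftField_smul _ _ _ _ _⟩
  lie_mem' := by
    rintro _ _ ⟨A, B, C, k, h, rfl⟩ ⟨A', B', C', k', h', rfl⟩
    exact ⟨_, _, _, _, h.bracket hI h', lie_liftField_liftField _ _ _ _ _ _ _ _⟩

theorem lie_liftField_mem {A B C k : ℝ} (h : Admissible σ A B C k) {V : VF I}
    (hV : V ∈ genericIdeal σ) : ⁅liftField I A B C k, V⁆ ∈ genericIdeal σ := by
  obtain ⟨f, g, rfl⟩ := hV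
  exact ⟨_, _, by rw [lie_add, lie_liftField_fieldX, lie_liftField_fieldY h]⟩

/-- The point symmetries as a Lie algebra, the sum of `complement` and `genericIdeal`. -/
def pointSymmetries (hI : IsConnected (I : Set ℝ)) (σ : Coeff I) : LieSubalgebra ℝ (VF I) where
  toSubmodule := ((complement hI.nonempty σ).toSubmodule ⊔ (genericIdeal σ).toSubmodule).copy
    {V | IsPointSymmetry σ V} (by
      ext V
      simp only [SetLike.mem_coe, Submodule.mem_sup, mem_ofPred_eq, isPointSymmetry_iff hI]
      constructor
      · rintro ⟨A, B, C, k, f, g, h, rfl⟩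
        exact ⟨_, ⟨A, B, C, k, h, rfl⟩, _, ⟨f, g, rfl⟩, rfl⟩
      · rintro ⟨_, ⟨A, B, C, k, h, rfl⟩, _, ⟨f, g, rfl⟩, rfl⟩
        exact ⟨A, B, C, k, f, g, h, rfl⟩)
  lie_mem' := by
    intro V W hV hW
    obtain ⟨A, B, C, k, f, g, h, rfl⟩ := (isPointSymmetry_iff hI σ V).1 hV
    obtain ⟨A', B', C', k', f', g', h', rfl⟩ := (isPointSymmetry_iff hI σ W).1 hW
    refine (isPointSymmetry_iff hI σ _).2 ?_
    have m1 : ⁅liftField I A B C k, fieldX f' + fieldY σ g'⁆ ∈ genericIdeal σ :=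
      lie_liftField_mem h ⟨_, _, rfl⟩
    have m2 : ⁅fieldX f + fieldY σ g, liftField I A' B' C' k'⁆ ∈ genericIdeal σ := by
      rw [← lie_skew]
      exact neg_mem (lie_liftField_mem h' ⟨_, _, rfl⟩)
    have m3 : ⁅fieldX f + fieldY σ g, fieldX f' + fieldY σ g'⁆ ∈ genericIdeal σ :=
      (genericIdeal σ).lie_mem ⟨_, _, rfl⟩ ⟨_, _, rfl⟩
    obtain ⟨f'', g'', e⟩ := add_mem m1 (add_mem m2 m3)
    refine ⟨_, _, _, _, f'', g'', h.bracket hI.nonempty h', ?_⟩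
    rw [← e, ← lie_liftField_liftField (k := k) (k' := k'), add_lie, lie_add, lie_add _ _ (_ + _)]
    abel

theorem symmetryAlgebra_eq (hI : IsConnected (I : Set ℝ)) (σ : Coeff I) :
    symmetryAlgebra σ = pointSymmetries hI σ :=
  le_antisymm (LieSubalgebra.lieSpan_le.2 fun _ h => h)
    fun _ h => LieSubalgebra.subset_lieSpan h

theorem mem_symmetryAlgebra_iff (hI : IsConnected (I : Set ℝ)) (σ : Coeff I) (V : VF I) :
    V ∈ symmetryAlgebra σ ↔ ∃ (A B C k : ℝ) (f g : SmoothFn I), Admissible σ A B C k ∧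
      V = liftField I A B C k + (fieldX f + fieldY σ g) := by
  rw [symmetryAlgebra_eq hI]
  exact isPointSymmetry_iff hI σ V

theorem liftField_mem_genericIdeal (hI : (I : Set ℝ).Nonempty) {A B C k : ℝ}
    (h : liftField I A B C k ∈ genericIdeal σ) : A = 0 ∧ B = 0 ∧ C = 0 := by
  obtain ⟨f, g, e⟩ := h
  have e' := congrArg (VF.coeff · 0) e
  simp only [VF.coeff_add, liftField_coeff, fieldX_coeff, fieldY_coeff] at e'
  refine (cubic_eq_zero (I := I) (a := 0) hI fun t ht => ?_).2
  have := eq_iff.1 e' ⟨![t, 0, 0, 0], ht⟩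
  change A * t ^ 2 + B * t + C = 0 + 0 at this
  linear_combination this

theorem Admissible.eq_zero (hI : (I : Set ℝ).Nonempty) {k : ℝ} (h : Admissible σ 0 0 0 k) :
    k = 0 := by
  obtain ⟨t, ht⟩ := hI
  have := h t ht
  have hs := σ.ne_zero t ht
  have h2 : k * σ.toFun t = 0 := by linear_combination -1 / 2 * this
  exact (mul_eq_zero.1 h2).resolve_right hs

theorem isSemidirectSum_complement (hI : IsConnected (I : Set ℝ)) (σ : Coeff I) :
    IsSemidirectSum (symmetryAlgebra σ) (complement hI.nonempty σ) (genericAlgebra σ) := by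
  rw [genericAlgebra_eq]
  refine ⟨?_, ?_, ?_, ?_⟩
  · rintro _ ⟨f, g, rfl⟩
    exact (mem_symmetryAlgebra_iff hI σ _).2 ⟨0, 0, 0, 0, f, g, Admissible.zero σ, by
      rw [liftField_zero, zero_add]⟩
  · intro V hV W hW
    obtain ⟨A, B, C, k, f, g, h, rfl⟩ := (mem_symmetryAlgebra_iff hI σ _).1 hV
    rw [add_lie]
    exact add_mem (lie_liftField_mem h hW) ((genericIdeal σ).lie_mem ⟨_, _, rfl⟩ hW)
  · rw [Submodule.disjoint_def]
    rintro _ ⟨A, B, C, k, h, rfl⟩ h'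
    obtain ⟨rfl, rfl, rfl⟩ := liftField_mem_genericIdeal hI.nonempty h'
    rw [h.eq_zero hI.nonempty, liftField_zero]
  · ext V
    rw [Submodule.mem_sup, LieSubalgebra.mem_toSubmodule, mem_symmetryAlgebra_iff hI]
    constructor
    · rintro ⟨_, ⟨A, B, C, k, h, rfl⟩, _, ⟨f, g, rfl⟩, rfl⟩
      exact ⟨A, B, C, k, f, g, h, rfl⟩
    · rintro ⟨A, B, C, k, f, g, h, rfl⟩
      exact ⟨_, ⟨A, B, C, k, h, rfl⟩, _, ⟨f, g, rfl⟩, rfl⟩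

/-- There are symmetries besides the `X(f) + Y(g)` if and only if there is a nonzero admissible
polynomial. -/
theorem symmetryAlgebra_ne_iff (hI : IsConnected (I : Set ℝ)) (σ : Coeff I) :
    symmetryAlgebra σ ≠ genericAlgebra σ ↔
      ∃ A B C k, Admissible σ A B C k ∧ (A ≠ 0 ∨ B ≠ 0 ∨ C ≠ 0) := by
  rw [genericAlgebra_eq]
  constructor
  · intro hne
    by_contra! hcon
    refine hne (le_antisymm ?_ ?_)
    · intro V hV
      obtain ⟨A, B, C, k, f, g, h, rfl⟩ := (mem_symmetryAlgebra_iff hI σ _).1 hV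
      obtain ⟨rfl, rfl, rfl⟩ := hcon A B C k h
      rw [h.eq_zero hI.nonempty, liftField_zero, zero_add]
      exact ⟨f, g, rfl⟩
    · rw [← genericAlgebra_eq]
      exact (isSemidirectSum_complement hI σ).1
  · rintro ⟨A, B, C, k, h, h0⟩ heq
    have : liftField I A B C k ∈ symmetryAlgebra σ := (mem_symmetryAlgebra_iff hI σ _).2
      ⟨A, B, C, k, SmoothFn.zero I, SmoothFn.zero I, h, by
        rw [fieldX_zero, fieldY_zero, add_zero, add_zero]⟩
    rw [heq] at this
    obtain ⟨rfl, rfl, rfl⟩ := liftField_mem_genericIdeal hI.nonempty this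
    simp at h0

end algebras

/-! ### Admissible polynomials of the representatives -/

section representatives

variable {σ : Coeff I}

theorem deriv_eq_of_eqOn {F : ℝ → ℝ} {F' t : ℝ} (h : ∀ t ∈ I, σ.toFun t = F t) (ht : t ∈ I)
    (hF : HasDerivAt F F' t) : deriv σ.toFun t = F' := by
  have e : σ.toFun =ᶠ[𝓝 t] F := by
    filter_upwards [I.isOpen.mem_nhds ht] with s hs using h s hs
  rw [e.deriv_eq, hF.deriv]

theorem IsConstantCase.deriv_eq (h : IsConstantCase σ) {t : ℝ} (ht : t ∈ I) :
    deriv σ.toFun t = 0 := by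
  obtain ⟨c, -, h⟩ := h
  exact deriv_eq_of_eqOn (F := fun _ => c) h ht (hasDerivAt_const t c)

theorem hasDerivAt_rpow_of_pos (s : ℝ) {t : ℝ} (ht : 0 < t) :
    HasDerivAt (fun t : ℝ => t ^ s) (s / t * t ^ s) t := by
  have := Real.hasDerivAt_rpow_const (x := t) (p := s) (Or.inl ht.ne')
  rwa [Real.rpow_sub_one ht.ne', mul_div_assoc', mul_comm s, mul_div_assoc, mul_comm] at this

theorem hasDerivAt_exp_mul (κ t : ℝ) :
    HasDerivAt (fun t : ℝ => Real.exp (κ * t)) (κ * Real.exp (κ * t)) t := by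
  have := ((hasDerivAt_id t).const_mul κ).exp
  simpa [mul_comm] using this

theorem hasDerivAt_arctan_profile (s t : ℝ) :
    HasDerivAt (fun t : ℝ => (1 + t ^ 2) ^ (-(3 / 2) : ℝ) * Real.exp (s * Real.arctan t))
      ((s - 3 * t) / (1 + t ^ 2) * ((1 + t ^ 2) ^ (-(3 / 2) : ℝ) * Real.exp (s * Real.arctan t)))
      t := by
  have hpos : 0 < 1 + t ^ 2 := by positivity
  have h1 : HasDerivAt (fun t : ℝ => 1 + t ^ 2) (2 * t) t := by
    simpa using (hasDerivAt_pow 2 t).const_add 1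
  have h2 := (hasDerivAt_rpow_of_pos (-(3 / 2)) hpos).comp t h1
  have h3 := ((Real.hasDerivAt_arctan t).const_mul s).exp
  refine (h2.mul h3).congr_deriv ?_
  simp only [Function.comp]
  field_simp
  ring

theorem IsPowerCase.deriv_eq {s : ℝ} (h : IsPowerCase σ s) {t : ℝ} (ht : t ∈ I) :
    deriv σ.toFun t = s / t * σ.toFun t := by
  obtain ⟨c, -, h⟩ := h
  rw [deriv_eq_of_eqOn (fun t ht => (h t ht).2) ht
    ((hasDerivAt_rpow_of_pos s (h t ht).1).const_mul c), (h t ht).2]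
  ring

theorem IsExpCase.deriv_eq {κ : ℝ} (h : IsExpCase σ κ) {t : ℝ} (ht : t ∈ I) :
    deriv σ.toFun t = κ * σ.toFun t := by
  obtain ⟨c, -, h⟩ := h
  rw [deriv_eq_of_eqOn h ht ((hasDerivAt_exp_mul κ t).const_mul c), h t ht]
  ring

theorem IsArctanCase.deriv_eq {s : ℝ} (h : IsArctanCase σ s) {t : ℝ} (ht : t ∈ I) :
    deriv σ.toFun t = (s - 3 * t) / (1 + t ^ 2) * σ.toFun t := by
  obtain ⟨c, -, h⟩ := h
  simp only [mul_assoc] at h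
  rw [deriv_eq_of_eqOn h ht ((hasDerivAt_arctan_profile s t).const_mul c), h t ht]
  ring

variable {A B C k : ℝ}

theorem IsConstantCase.admissible_iff (h : IsConstantCase σ) (hI : (I : Set ℝ).Nonempty) :
    Admissible σ A B C k ↔ A = 0 ∧ k = 3 / 4 * B := by
  constructor
  · intro hA
    obtain ⟨-, -, e1, e2⟩ := cubic_eq_zero hI (a := 0) (b := 0) (c := 3 * A)
      (d := 3 / 2 * B - 2 * k) fun t ht => by
        have := hA t ht
        rw [h.deriv_eq ht] at this
        refine (mul_right_inj' (σ.ne_zero t ht)).1 ?_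
        linear_combination this
    constructor <;> linarith
  · rintro ⟨rfl, rfl⟩ t ht
    rw [h.deriv_eq ht]
    ring

theorem IsPowerCase.admissible_iff {s : ℝ} (h : IsPowerCase σ s) (hI : (I : Set ℝ).Nonempty)
    (h0 : s ≠ 0) (h3 : s ≠ -3) :
    Admissible σ A B C k ↔ A = 0 ∧ C = 0 ∧ k = (2 * s + 3) / 4 * B := by
  have hpos : ∀ t ∈ I, 0 < t := fun t ht => by
    obtain ⟨c, -, h⟩ := h
    exact (h t ht).1
  constructor
  · intro hA
    obtain ⟨-, e1, e2, e3⟩ := cubic_eq_zero hI (a := 0) (b := (s + 3) * A)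
      (c := s * B + 3 / 2 * B - 2 * k) (d := s * C) fun t ht => by
        have := hA t ht
        rw [h.deriv_eq ht] at this
        have ht0 := (hpos t ht).ne'
        refine (mul_right_inj' (σ.ne_zero t ht)).1 ?_
        field_simp at this
        linear_combination this / 2
    refine ⟨(mul_eq_zero.1 e1).resolve_left fun e => h3 (by linarith),
      (mul_eq_zero.1 e3).resolve_left h0, by linarith⟩
  · rintro ⟨rfl, rfl, rfl⟩ t ht
    have ht0 := (hpos t ht).ne'
    rw [h.deriv_eq ht]
    field_simp
    ring

theorem IsExpCase.admissible_iff {κ : ℝ} (h : IsExpCase σ κ) (hI : (I : Set ℝ).Nonempty)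
    (hκ : κ = 1 ∨ κ = -1) :
    Admissible σ A B C k ↔ A = 0 ∧ B = 0 ∧ k = κ / 2 * C := by
  have hκ0 : κ ≠ 0 := by rcases hκ with rfl | rfl <;> norm_num
  constructor
  · intro hA
    obtain ⟨-, e1, e2, e3⟩ := cubic_eq_zero hI (a := 0) (b := κ * A)
      (c := κ * B + 3 * A) (d := κ * C + 3 / 2 * B - 2 * k) fun t ht => by
        have := hA t ht
        rw [h.deriv_eq ht] at this
        refine (mul_right_inj' (σ.ne_zero t ht)).1 ?_
        linear_combination this
    obtain rfl : A = 0 := (mul_eq_zero.1 e1).resolve_left hκ0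
    obtain rfl : B = 0 := (mul_eq_zero.1 (show κ * B = 0 by linarith)).resolve_left hκ0
    exact ⟨rfl, rfl, by linarith⟩
  · rintro ⟨rfl, rfl, rfl⟩ t ht
    rw [h.deriv_eq ht]
    ring

theorem IsArctanCase.admissible_iff {s : ℝ} (h : IsArctanCase σ s) (hI : (I : Set ℝ).Nonempty) :
    Admissible σ A B C k ↔ C = A ∧ B = 0 ∧ k = s / 2 * A := by
  constructor
  · intro hA
    obtain ⟨-, e1, e2, e3⟩ := cubic_eq_zero hI (a := 0) (b := s * A - 3 / 2 * B - 2 * k)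
      (c := s * B - 3 * C + 3 * A) (d := s * C + 3 / 2 * B - 2 * k) fun t ht => by
        have := hA t ht
        rw [h.deriv_eq ht] at this
        have ht0 : 1 + t ^ 2 ≠ 0 := by positivity
        refine (mul_right_inj' (σ.ne_zero t ht)).1 ?_
        field_simp at this
        linear_combination this / 2
    -- the two equations for `A - C` and `B` have determinant `s² + 9`
    have e4 : (s ^ 2 + 9) * (A - C) = 0 := by linear_combination s * e1 - s * e3 + 3 * e2
    have e5 : A - C = 0 := (mul_eq_zero.1 e4).resolve_left (by positivity)
    have e6 : B = 0 := by linear_combination (s * e5 - e1 + e3) / 3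
    exact ⟨by linarith, e6, by subst e6; linarith⟩
  · rintro ⟨rfl, rfl, rfl⟩ t ht
    have ht0 : 1 + t ^ 2 ≠ 0 := by positivity
    rw [h.deriv_eq ht]
    field_simp
    ring

end representatives

/-! ### The symmetry algebras of the representatives -/

section extensions

theorem fieldT0_eq : fieldT0 I = liftField I 0 0 1 0 := VF.ext_on fun p hp => by
  simp only [fieldT0, liftField, VF.mk, indicator_of_mem hp]
  funext j
  fin_cases j <;> simp

theorem fieldD_eq (s : ℝ) : fieldD I s = liftField I 0 2 0 ((2 * s + 3) / 2) :=
  VF.ext_on fun p hp => by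
    simp only [fieldD, liftField, VF.mk, indicator_of_mem hp]
    funext j
    fin_cases j <;> simp

theorem fieldT_eq (κ : ℝ) : fieldT I κ = liftField I 0 0 1 (κ / 2) := VF.ext_on fun p hp => by
  simp only [fieldT, liftField, VF.mk, indicator_of_mem hp]
  funext j
  fin_cases j <;> simp

theorem fieldC_eq (s : ℝ) : fieldC I s = liftField I 1 0 1 (s / 2) := VF.ext_on fun p hp => by
  simp only [fieldC, liftField, VF.mk, indicator_of_mem hp]
  funext j
  fin_cases j <;> simp [add_comm, mul_comm]

theorem liftField_eq_zero (hI : (I : Set ℝ).Nonempty) {A B C k : ℝ}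
    (h : liftField I A B C k = 0) : A = 0 ∧ B = 0 ∧ C = 0 := by
  have e' := congrArg (VF.coeff · 0) h
  simp only [VF.coeff_zero, liftField_coeff] at e'
  refine (cubic_eq_zero (I := I) (a := 0) hI fun t ht => ?_).2
  have := eq_iff.1 e' ⟨![t, 0, 0, 0], ht⟩
  change A * t ^ 2 + B * t + C = 0 at this
  linear_combination this

/-- It suffices that the given fields are a basis of `complement`. -/
theorem isExtendedBy_of_span (hI : IsConnected (I : Set ℝ)) {σ : Coeff I} {n : ℕ}
    {v : Fin n → VF I} (hv : LinearIndependent ℝ v)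
    (hs : (complement hI.nonempty σ).toSubmodule = Submodule.span ℝ (range v)) :
    IsExtendedBy σ v := by
  have e : LieSubalgebra.lieSpan ℝ (VF I) (range v) = complement hI.nonempty σ := by
    apply le_antisymm
    · rw [LieSubalgebra.lieSpan_le]
      intro V hV
      have : V ∈ (complement hI.nonempty σ).toSubmodule := hs ▸ Submodule.subset_span hV
      exact this
    · have : (complement hI.nonempty σ).toSubmodule
          ≤ (LieSubalgebra.lieSpan ℝ (VF I) (range v)).toSubmodule :=
        hs ▸ LieSubalgebra.submodule_span_le_lieSpan
      exact this
  refine ⟨hv, by rw [e, hs], ?_⟩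
  rw [e]
  exact isSemidirectSum_complement hI σ

theorem isExtendedBy_singleton (hI : IsConnected (I : Set ℝ)) {σ : Coeff I} {V : VF I}
    (h0 : V ≠ 0) (hV : V ∈ complement hI.nonempty σ)
    (h : ∀ A B C k, Admissible σ A B C k → ∃ c : ℝ, liftField I A B C k = c • V) :
    IsExtendedBy σ ![V] := by
  refine isExtendedBy_of_span hI (linearIndependent_unique_iff.2 h0) ?_
  rw [Matrix.range_cons, Matrix.range_empty, union_empty]
  apply le_antisymm
  · rintro _ ⟨A, B, C, k, hA, rfl⟩
    obtain ⟨c, hc⟩ := h A B C k hA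
    rw [Submodule.mem_span_singleton]
    exact ⟨c, hc.symm⟩
  · rw [Submodule.span_singleton_le_iff_mem]
    exact hV

variable {σ : Coeff I}

theorem isExtendedBy_constant (hI : IsConnected (I : Set ℝ)) (h : IsConstantCase σ) :
    IsExtendedBy σ ![fieldT0 I, fieldD I 0] := by
  have hadm := fun A B C k => h.admissible_iff (A := A) (B := B) (C := C) (k := k) hI.nonempty
  apply isExtendedBy_of_span hI
  · rw [LinearIndependent.pair_iff]
    intro a b hab
    rw [fieldT0_eq, fieldD_eq, liftField_smul, liftField_smul, liftField_add] at hab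
    obtain ⟨-, h1, h2⟩ := liftField_eq_zero hI.nonempty hab
    constructor <;> linarith
  · apply le_antisymm
    · rintro _ ⟨A, B, C, k, hA, rfl⟩
      obtain ⟨rfl, rfl⟩ := (hadm _ _ _ _).1 hA
      rw [Matrix.range_cons, Matrix.range_cons, Matrix.range_empty, union_empty,
        singleton_union, Submodule.mem_span_pair]
      refine ⟨C, B / 2, ?_⟩
      rw [fieldT0_eq, fieldD_eq, liftField_smul, liftField_smul, liftField_add]
      congr 1 <;> ring
    · rw [Submodule.span_le]
      rintro _ ⟨i, rfl⟩
      fin_cases i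
      · exact ⟨0, 0, 1, 0, (hadm _ _ _ _).2 ⟨rfl, by norm_num⟩, fieldT0_eq⟩
      · exact ⟨_, _, _, _, (hadm _ _ _ _).2 ⟨rfl, by norm_num⟩, fieldD_eq 0⟩

theorem isExtendedBy_power (hI : IsConnected (I : Set ℝ)) {s : ℝ} (h0 : s ≠ 0) (h3 : s ≠ -3)
    (h : IsPowerCase σ s) : IsExtendedBy σ ![fieldD I s] := by
  have hadm := fun A B C k =>
    h.admissible_iff (A := A) (B := B) (C := C) (k := k) hI.nonempty h0 h3
  rw [fieldD_eq]
  refine isExtendedBy_singleton hI (fun e => ?_)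
    ⟨_, _, _, _, (hadm _ _ _ _).2 ⟨rfl, rfl, by ring⟩, rfl⟩ fun A B C k hA => ?_
  · have := (liftField_eq_zero hI.nonempty e).2.1
    norm_num at this
  · obtain ⟨rfl, rfl, rfl⟩ := (hadm _ _ _ _).1 hA
    refine ⟨B / 2, ?_⟩
    rw [liftField_smul]
    congr 1 <;> ring

theorem isExtendedBy_exp (hI : IsConnected (I : Set ℝ)) {κ : ℝ} (hκ : κ = 1 ∨ κ = -1)
    (h : IsExpCase σ κ) : IsExtendedBy σ ![fieldT I κ] := by
  have hadm := fun A B C k => h.admissible_iff (A := A) (B := B) (C := C) (k := k) hI.nonempty hκ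
  rw [fieldT_eq]
  refine isExtendedBy_singleton hI (fun e => ?_)
    ⟨_, _, _, _, (hadm _ _ _ _).2 ⟨rfl, rfl, by ring⟩, rfl⟩ fun A B C k hA => ?_
  · have := (liftField_eq_zero hI.nonempty e).2.2
    norm_num at this
  · obtain ⟨rfl, rfl, rfl⟩ := (hadm _ _ _ _).1 hA
    refine ⟨C, ?_⟩
    rw [liftField_smul]
    congr 1 <;> ring

theorem isExtendedBy_arctan (hI : IsConnected (I : Set ℝ)) {s : ℝ} (h : IsArctanCase σ s) :
    IsExtendedBy σ ![fieldC I s] := by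
  have hadm := fun A B C k => h.admissible_iff (A := A) (B := B) (C := C) (k := k) hI.nonempty
  rw [fieldC_eq]
  refine isExtendedBy_singleton hI (fun e => ?_)
    ⟨_, _, _, _, (hadm _ _ _ _).2 ⟨rfl, rfl, by ring⟩, rfl⟩ fun A B C k hA => ?_
  · have := (liftField_eq_zero hI.nonempty e).2.2
    norm_num at this
  · obtain ⟨rfl, rfl, rfl⟩ := (hadm _ _ _ _).1 hA
    refine ⟨C, ?_⟩
    rw [liftField_smul]
    congr 1 <;> ring

end extensions

/-! ### Equivalence transformations and admissible polynomials -/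

namespace EquivTransf

variable (g : EquivTransf I) {σ : Coeff I} {J : TopologicalSpace.Opens ℝ} {σ' : Coeff J}

theorem hasDerivAt_newTime {t : ℝ} (ht : t ∈ I) :
    HasDerivAt g.newTime (g.Δ / (g.c * t + g.d) ^ 2) t := by
  have h := g.regular t ht
  have h1 : HasDerivAt (fun t => g.a * t + g.b) g.a t := by
    simpa using ((hasDerivAt_id t).const_mul g.a).add_const g.b
  have h2 : HasDerivAt (fun t => g.c * t + g.d) g.c t := by
    simpa using ((hasDerivAt_id t).const_mul g.c).add_const g.d
  refine (h1.div h2 h).congr_deriv ?_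
  rw [Δ]
  ring

/-- The leading coefficient of the pullback of `A s² + B s + C` by the Möbius transformation
`s = T(t)`, where `A s² + B s + C` stands for the vector field `(A s² + B s + C) ∂_s`: the pullback
is `(A T² + B T + C) / T'`, again a quadratic polynomial in `t`. -/
def pullA (A B C : ℝ) : ℝ := (A * g.a ^ 2 + B * (g.a * g.c) + C * g.c ^ 2) / g.Δ

/-- The middle coefficient of the pullback of `A s² + B s + C`. -/
def pullB (A B C : ℝ) : ℝ :=
  (2 * A * g.a * g.b + B * (g.a * g.d + g.b * g.c) + 2 * C * g.c * g.d) / g.Δ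

/-- The constant coefficient of the pullback of `A s² + B s + C`. -/
def pullC (A B C : ℝ) : ℝ := (A * g.b ^ 2 + B * (g.b * g.d) + C * g.d ^ 2) / g.Δ

theorem disc_pull (A B C : ℝ) :
    g.pullB A B C ^ 2 - 4 * g.pullA A B C * g.pullC A B C = B ^ 2 - 4 * A * C := by
  have h := g.det_pos.ne'
  simp only [pullA, pullB, pullC, Δ]
  field_simp
  ring

theorem pull_eq_zero {A B C : ℝ} (hA : g.pullA A B C = 0) (hB : g.pullB A B C = 0)
    (hC : g.pullC A B C = 0) : A = 0 ∧ B = 0 ∧ C = 0 := by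
  have h := g.det_pos.ne'
  simp only [pullA, pullB, pullC, Δ, div_eq_zero_iff, h, or_false] at hA hB hC
  have h2 := pow_ne_zero 2 h
  refine ⟨(mul_right_inj' h2).1 ?_, (mul_right_inj' h2).1 ?_, (mul_right_inj' h2).1 ?_⟩
  · linear_combination g.d ^ 2 * hA - g.c * g.d * hB + g.c ^ 2 * hC
  · linear_combination -2 * g.b * g.d * hA + (g.a * g.d + g.b * g.c) * hB - 2 * g.a * g.c * hC
  · linear_combination g.b ^ 2 * hA - g.a * g.b * hB + g.a ^ 2 * hC

/-- Every quadratic polynomial is a pullback. -/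
theorem exists_pull_eq (A B C : ℝ) :
    ∃ A' B' C', g.pullA A' B' C' = A ∧ g.pullB A' B' C' = B ∧ g.pullC A' B' C' = C := by
  have h : g.Δ ≠ 0 := g.det_pos.ne'
  have hΔ : g.Δ = g.a * g.d - g.b * g.c := rfl
  refine ⟨(A * g.d ^ 2 - B * (g.c * g.d) + C * g.c ^ 2) / g.Δ,
    (-2 * A * g.b * g.d + B * (g.a * g.d + g.b * g.c) - 2 * C * g.a * g.c) / g.Δ,
    (A * g.b ^ 2 - B * (g.a * g.b) + C * g.a ^ 2) / g.Δ, ?_, ?_, ?_⟩ <;>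
  simp only [pullA, pullB, pullC] <;> field_simp <;> rw [hΔ] <;> ring

variable {g}

/-- The relation between the derivatives of the two coefficients. -/
theorem Takes.deriv_eq (h : g.Takes σ σ') {t : ℝ} (ht : t ∈ I) :
    deriv σ'.toFun (g.newTime t) * (g.Δ / (g.c * t + g.d) ^ 2)
      = g.ε * g.Δ ^ (-(3 / 2) : ℝ) * g.Y₁ ^ 2 * (3 * g.c * (g.c * t + g.d) ^ 2 * σ.toFun t
        + (g.c * t + g.d) ^ 3 * deriv σ.toFun t) := by
  have hJ : g.newTime t ∈ J := by
    have : g.newTime t ∈ (J : Set ℝ) := h.1 ▸ mem_image_of_mem _ ht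
    exact this
  have h1 := (σ'.hasDerivAt hJ).comp t (g.hasDerivAt_newTime ht)
  have h2 : HasDerivAt (fun t => g.c * t + g.d) g.c t := by
    simpa using ((hasDerivAt_id t).const_mul g.c).add_const g.d
  have h3 := ((h2.pow 3).const_mul (g.ε * g.Δ ^ (-(3 / 2) : ℝ) * g.Y₁ ^ 2)).mul (σ.hasDerivAt ht)
  have e : σ'.toFun ∘ g.newTime =ᶠ[𝓝 t] fun t =>
      g.ε * g.Δ ^ (-(3 / 2) : ℝ) * g.Y₁ ^ 2 * (g.c * t + g.d) ^ 3 * σ.toFun t := by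
    filter_upwards [I.isOpen.mem_nhds ht] with s hs using h.2 s hs
  have := (h1.congr_of_eventuallyEq e.symm).unique h3
  rw [this]
  simp only [Pi.pow_apply]
  push_cast
  ring

theorem factor_ne_zero (g : EquivTransf I) : g.ε * g.Δ ^ (-(3 / 2) : ℝ) * g.Y₁ ^ 2 ≠ 0 := by
  have hε : g.ε ≠ 0 := by rcases g.sign with h | h <;> rw [h] <;> norm_num
  exact mul_ne_zero (mul_ne_zero hε (Real.rpow_pos_of_pos g.det_pos _).ne')
    (pow_ne_zero 2 g.Y₁_ne_zero)

/-- Admissible polynomials are transported as vector fields on the line. -/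
theorem Takes.admissible_iff (h : g.Takes σ σ') (A B C k : ℝ) :
    Admissible σ' A B C k
      ↔ Admissible σ (g.pullA A B C) (g.pullB A B C) (g.pullC A B C) k := by
  have hΔ : g.Δ ≠ 0 := g.det_pos.ne'
  have key : ∀ t ∈ I, (A * g.newTime t ^ 2 + B * g.newTime t + C) * deriv σ'.toFun (g.newTime t)
      + 3 / 2 * (2 * A * g.newTime t + B) * σ'.toFun (g.newTime t)
      - 2 * k * σ'.toFun (g.newTime t)
      = g.ε * g.Δ ^ (-(3 / 2) : ℝ) * g.Y₁ ^ 2 * (g.c * t + g.d) ^ 3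
        * ((g.pullA A B C * t ^ 2 + g.pullB A B C * t + g.pullC A B C) * deriv σ.toFun t
          + 3 / 2 * (2 * g.pullA A B C * t + g.pullB A B C) * σ.toFun t - 2 * k * σ.toFun t) := by
    intro t ht
    have h0 := g.regular t ht
    have h1 := h.deriv_eq ht
    have h2 := h.2 t ht
    set κ := g.ε * g.Δ ^ (-(3 / 2) : ℝ) * g.Y₁ ^ 2
    have h3 : deriv σ'.toFun (g.newTime t) = κ * (3 * g.c * (g.c * t + g.d) ^ 2 * σ.toFun t
        + (g.c * t + g.d) ^ 3 * deriv σ.toFun t) * (g.c * t + g.d) ^ 2 / g.Δ := by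
      rw [← h1]
      field_simp
    rw [h3, h2, newTime, pullA, pullB, pullC]
    obtain ⟨ℓ, hℓ⟩ : ∃ ℓ, ℓ = g.c * t + g.d := ⟨_, rfl⟩
    have hd : g.d = ℓ - g.c * t := by rw [hℓ]; ring
    have hΔ' : g.Δ = g.a * (ℓ - g.c * t) - g.b * g.c := by rw [← hd]; rfl
    rw [← hℓ] at h0 ⊢
    field_simp
    rw [hΔ', hd]
    ring
  constructor
  · intro hA t ht
    have hJ : g.newTime t ∈ J := by
      have : g.newTime t ∈ (J : Set ℝ) := h.1 ▸ mem_image_of_mem _ ht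
      exact this
    have h1 := key t ht
    rw [hA _ hJ, sub_self] at h1
    have := (mul_eq_zero.1 h1.symm).resolve_left
      (mul_ne_zero g.factor_ne_zero (pow_ne_zero 3 (g.regular t ht)))
    linarith
  · intro hA s hs
    have : s ∈ (J : Set ℝ) := hs
    rw [h.1] at this
    obtain ⟨t, ht, rfl⟩ := this
    have h1 := key t ht
    rw [hA t ht, sub_self, mul_zero] at h1
    linarith

end EquivTransf

/-! ### Discriminants as invariants of the families -/

/-- `σ` admits a nonzero admissible polynomial of discriminant `δ`. -/
def HasDisc (σ : Coeff I) (δ : ℝ) : Prop :=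
  ∃ A B C k, Admissible σ A B C k ∧ (A ≠ 0 ∨ B ≠ 0 ∨ C ≠ 0) ∧ B ^ 2 - 4 * A * C = δ

/-- The discriminants of the admissible polynomials are invariant. -/
theorem EquivTransf.Takes.hasDisc_iff {g : EquivTransf I} {σ : Coeff I}
    {J : TopologicalSpace.Opens ℝ} {σ' : Coeff J} (h : g.Takes σ σ') (δ : ℝ) :
    HasDisc σ' δ ↔ HasDisc σ δ := by
  constructor
  · rintro ⟨A, B, C, k, hA, h0, hδ⟩
    refine ⟨_, _, _, k, (h.admissible_iff A B C k).1 hA, ?_, by rw [g.disc_pull, hδ]⟩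
    by_contra! hcon
    obtain ⟨rfl, rfl, rfl⟩ := g.pull_eq_zero hcon.1 hcon.2.1 hcon.2.2
    simp at h0
  · rintro ⟨A, B, C, k, hA, h0, hδ⟩
    obtain ⟨A', B', C', rfl, rfl, rfl⟩ := g.exists_pull_eq A B C
    refine ⟨A', B', C', k, (h.admissible_iff A' B' C' k).2 hA, ?_, by rw [← hδ, g.disc_pull]⟩
    by_contra! hcon
    obtain ⟨rfl, rfl, rfl⟩ := hcon
    simp [EquivTransf.pullA, EquivTransf.pullB, EquivTransf.pullC] at h0

theorem symmetryAlgebra_ne_iff_hasDisc (hI : IsConnected (I : Set ℝ)) (σ : Coeff I) :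
    symmetryAlgebra σ ≠ genericAlgebra σ ↔ ∃ δ, HasDisc σ δ := by
  rw [symmetryAlgebra_ne_iff hI]
  constructor
  · rintro ⟨A, B, C, k, h, h0⟩
    exact ⟨_, A, B, C, k, h, h0, rfl⟩
  · rintro ⟨_, A, B, C, k, h, h0, -⟩
    exact ⟨A, B, C, k, h, h0⟩

/-- The set of discriminants of the nonzero admissible polynomials that belongs to a family. -/
def Family.discs : Family → Set ℝ
  | .constant => Ici 0
  | .power => Ioi 0
  | .exponential => {0}
  | .arctangent => Iio 0

/-- The discriminants of the nonzero admissible polynomials of a member of a family are exactly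
the elements of `Family.discs`. -/
theorem Family.Contains.hasDisc_iff (hI : (I : Set ℝ).Nonempty) {σ : Coeff I} {F : Family}
    (h : F.Contains σ) (δ : ℝ) : HasDisc σ δ ↔ δ ∈ F.discs := by
  cases F
  · change IsConstantCase σ at h
    change _ ↔ 0 ≤ δ
    constructor
    · rintro ⟨A, B, C, k, hA, h0, rfl⟩
      obtain ⟨rfl, -⟩ := (h.admissible_iff hI).1 hA
      nlinarith [sq_nonneg B]
    · intro hδ
      refine ⟨0, √δ, 1, _, (h.admissible_iff hI).2 ⟨rfl, rfl⟩, by simp, ?_⟩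
      rw [Real.sq_sqrt hδ]
      ring
  · obtain ⟨s, h0, h3, h⟩ := h
    change _ ↔ 0 < δ
    constructor
    · rintro ⟨A, B, C, k, hA, hne, rfl⟩
      obtain ⟨rfl, rfl, -⟩ := (h.admissible_iff hI h0 h3).1 hA
      have hB : B ≠ 0 := by simpa using hne
      have := sq_pos_of_ne_zero hB
      linarith
    · intro hδ
      refine ⟨0, √δ, 0, _, (h.admissible_iff hI h0 h3).2 ⟨rfl, rfl, rfl⟩,
        Or.inr (Or.inl (Real.sqrt_ne_zero'.2 hδ)), ?_⟩
      rw [Real.sq_sqrt hδ.le]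
      ring
  · obtain ⟨κ, hκ, h⟩ := h
    change _ ↔ δ = 0
    constructor
    · rintro ⟨A, B, C, k, hA, hne, rfl⟩
      obtain ⟨rfl, rfl, -⟩ := (h.admissible_iff hI hκ).1 hA
      ring
    · rintro rfl
      exact ⟨0, 0, 1, _, (h.admissible_iff hI hκ).2 ⟨rfl, rfl, rfl⟩, by simp, by ring⟩
  · obtain ⟨s, h⟩ := h
    change _ ↔ δ < 0
    constructor
    · rintro ⟨A, B, C, k, hA, hne, rfl⟩
      obtain ⟨rfl, rfl, -⟩ := (h.admissible_iff hI).1 hA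
      have hB : C ≠ 0 := by simpa using hne
      have := sq_pos_of_ne_zero hB
      linarith
    · intro hδ
      have hpos : 0 < √(-δ) := Real.sqrt_pos.2 (by linarith)
      refine ⟨√(-δ) / 2, 0, √(-δ) / 2, _, (h.admissible_iff hI).2 ⟨rfl, rfl, rfl⟩,
        Or.inl (by positivity), ?_⟩
      have := Real.sq_sqrt (show 0 ≤ -δ by linarith)
      linear_combination -this

/-- The families are told apart by whether `0` and `1` are discriminants. -/
theorem Family.discs_injective {F F' : Family} (h : F.discs = F'.discs) : F = F' := by
  have h0 : (0 : ℝ) ∈ F.discs ↔ (0 : ℝ) ∈ F'.discs := by rw [h]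
  have h1 : (1 : ℝ) ∈ F.discs ↔ (1 : ℝ) ∈ F'.discs := by rw [h]
  cases F <;> cases F' <;> simp [Family.discs, not_lt.2 (zero_le_one' ℝ)] at h0 h1 ⊢

theorem EquivTransf.Takes.nonempty {g : EquivTransf I} {σ : Coeff I}
    {J : TopologicalSpace.Opens ℝ} {σ' : Coeff J} (h : g.Takes σ σ')
    (hI : (I : Set ℝ).Nonempty) : (J : Set ℝ).Nonempty := h.1 ▸ hI.image _

theorem EquivTransf.Takes.symmetryAlgebra_ne (hI : IsConnected (I : Set ℝ)) {F : Family}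
    {g : EquivTransf I} {σ : Coeff I} {J : TopologicalSpace.Opens ℝ} {σ' : Coeff J}
    (hF : F.Contains σ') (h : g.Takes σ σ') : symmetryAlgebra σ ≠ genericAlgebra σ := by
  have hne : ∃ δ, δ ∈ F.discs := by
    cases F
    · exact ⟨0, le_refl (0 : ℝ)⟩
    · exact ⟨1, zero_lt_one (α := ℝ)⟩
    · exact ⟨0, rfl⟩
    · exact ⟨-1, neg_one_lt_zero (R := ℝ)⟩
  obtain ⟨δ, hδ⟩ := hne
  exact (symmetryAlgebra_ne_iff_hasDisc hI σ).2 ⟨δ, (h.hasDisc_iff δ).1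
    ((hF.hasDisc_iff (h.nonempty hI.nonempty) δ).2 hδ)⟩

theorem EquivTransf.Takes.family_eq (hI : (I : Set ℝ).Nonempty) {F F' : Family}
    {g g' : EquivTransf I} {σ : Coeff I} {J J' : TopologicalSpace.Opens ℝ} {σ' : Coeff J}
    {σ'' : Coeff J'} (hF : F.Contains σ') (hF' : F'.Contains σ'') (h : g.Takes σ σ')
    (h' : g'.Takes σ σ'') : F = F' := by
  apply Family.discs_injective
  ext δ
  rw [← hF.hasDisc_iff (h.nonempty hI), ← hF'.hasDisc_iff (h'.nonempty hI), h.hasDisc_iff,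
    h'.hasDisc_iff]

/-! ### Möbius transformations of time -/

namespace EquivTransf

/-- The equivalence transformation given by a Möbius transformation of time and a scaling of `y`,
with `ε = 1` and `Y₀ = β₀ = 0`. -/
def mobius (a b c d : ℝ) (hΔ : 0 < a * d - b * c) (hreg : ∀ t ∈ I, c * t + d ≠ 0) (Y : ℝ)
    (hY : Y ≠ 0) : EquivTransf I where
  a := a
  b := b
  c := c
  d := d
  ε := 1
  Y₁ := Y
  Y₀ := SmoothFn.zero I
  β₀ := SmoothFn.zero I
  det_pos := hΔ
  sign := Or.inl rfl
  Y₁_ne_zero := hY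
  regular := hreg

variable (g : EquivTransf I)

theorem contDiffOn_newTime : ContDiffOn ℝ ∞ g.newTime I :=
  ContDiffOn.div (by fun_prop) (by fun_prop) g.regular

theorem isOpen_image_newTime : IsOpen (g.newTime '' I) := by
  rw [isOpen_iff_mem_nhds]
  rintro _ ⟨t, ht, rfl⟩
  have h1 : ContDiffAt ℝ ∞ g.newTime t := g.contDiffOn_newTime.contDiffAt (I.isOpen.mem_nhds ht)
  have h2 := h1.hasStrictDerivAt' (g.hasDerivAt_newTime ht) (by simp)
  rw [← h2.map_nhds_eq (div_ne_zero g.det_pos.ne' (pow_ne_zero 2 (g.regular t ht)))]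
  exact Filter.image_mem_map (I.isOpen.mem_nhds ht)

/-- A function of time, smooth on `I`, as a function of `(t, x, y)`. -/
theorem contDiffOn_base {f : ℝ → ℝ} (hf : ContDiffOn ℝ ∞ f I) :
    ContDiffOn ℝ ∞ (fun p : Fin 3 → ℝ => f (p 0)) (baseOpens I) :=
  hf.comp (contDiff_apply ℝ ℝ (0 : Fin 3)).contDiffOn fun _ hp => hp

/-- The change of variables multiplies the left-hand side of the equation by the factor
`Δ² / (ct + d)⁴`, so that it transforms the equations into each other. -/
theorem mapsEquation_of_eq_zero {σ : Coeff I} {J : TopologicalSpace.Opens ℝ} {σ' : Coeff J}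
    (hε : g.ε = 1) (hY : g.Y₀ = SmoothFn.zero I) (hβ : g.β₀ = SmoothFn.zero I) (h : g.Takes σ σ') :
    g.MapsEquation σ σ' := by
  intro v hv p hp
  have hΔ : 0 < √g.Δ := Real.sqrt_pos.2 g.det_pos
  have hsq : √g.Δ ^ 2 = g.Δ := Real.sq_sqrt g.det_pos.le
  have hline : ∀ t, HasDerivAt (fun t => g.c * t + g.d) g.c t := fun t => by
    simpa using ((hasDerivAt_id t).const_mul g.c).add_const g.d
  have hquot : ∀ e : ℝ, ContDiffOn ℝ ∞ (fun t => e / (g.c * t + g.d)) I := fun e =>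
    ContDiffOn.div (by fun_prop) (by fun_prop) g.regular
  have hquot' : ∀ e : ℝ, ∀ t ∈ I,
      HasDerivAt (fun t => e / (g.c * t + g.d))
        (-(g.c / (g.c * t + g.d) * (e / (g.c * t + g.d)))) t := by
    intro e t ht
    have := g.regular t ht
    refine ((hasDerivAt_const t e).div (hline t) this).congr_deriv ?_
    field_simp
    ring
  -- with `λ = √Δ / (ct + d)` and `μ = c / (ct + d)` the substitution is `u = λ v(T, λx, Y₁y) + μx`,
  -- where `T' = λ²`, `λ' = -μλ` and `μ' = -μ²`
  obtain ⟨T, hT⟩ : ∃ T : SmoothRing (baseOpens I),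
      T = SmoothRing.mk _ (contDiffOn_base g.contDiffOn_newTime) := ⟨_, rfl⟩
  obtain ⟨lam, hlam⟩ : ∃ lam : SmoothRing (baseOpens I),
      lam = SmoothRing.mk _ (contDiffOn_base (hquot √g.Δ)) := ⟨_, rfl⟩
  obtain ⟨mu, hmu⟩ : ∃ mu : SmoothRing (baseOpens I),
      mu = SmoothRing.mk _ (contDiffOn_base (hquot g.c)) := ⟨_, rfl⟩
  have DT : ∀ i, D i T = if i = 0 then lam * lam else 0 := by
    intro i
    refine eq_iff.2 fun q => ?_
    rw [hT]
    refine (D_mk_time (U := baseOpens I) _ i q (g.hasDerivAt_newTime q.2)).trans ?_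
    split_ifs
    · rw [val_mul, hlam, mk_apply, div_mul_div_comm, ← pow_two, ← pow_two, hsq]
    · rfl
  have Dlam : ∀ i, D i lam = if i = 0 then -(mu * lam) else 0 := by
    intro i
    refine eq_iff.2 fun q => ?_
    nth_rw 1 [hlam]
    refine (D_mk_time (U := baseOpens I) _ i q (hquot' √g.Δ _ q.2)).trans ?_
    split_ifs
    · rw [val_neg, val_mul, hlam, hmu, mk_apply, mk_apply]
    · rfl
  have Dmu : ∀ i, D i mu = if i = 0 then -(mu * mu) else 0 := by
    intro i
    refine eq_iff.2 fun q => ?_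
    nth_rw 1 [hmu]
    refine (D_mk_time (U := baseOpens I) _ i q (hquot' g.c _ q.2)).trans ?_
    split_ifs
    · rw [val_neg, val_mul, hmu, mk_apply]
    · rfl
  obtain ⟨Φ, hΦdef⟩ : ∃ Φ : Fin 3 → SmoothRing (baseOpens I),
      Φ = ![T, lam * coord 1, g.Y₁ • coord 2] := ⟨_, rfl⟩
  have hnew : ∀ q : baseOpens I, g.newPoint σ q.1 = fun j => (Φ j).1 q := by
    intro q
    funext j
    rw [hΦdef]
    fin_cases j
    · simp [newPoint, hT]
    · simp [newPoint, hlam, hε, hY, hβ, SmoothFn.zero]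
    · simp [newPoint, hY, SmoothFn.zero]
  have hΦ : ∀ q : baseOpens I, (fun j => (Φ j).1 q) ∈ baseOpens J := by
    intro q
    rw [← hnew q]
    have : g.newTime (q.1 0) ∈ (J : Set ℝ) := h.1 ▸ mem_image_of_mem _ q.2
    exact this
  have hV : ∀ q : baseOpens J, (SmoothRing.mk (U := baseOpens J) v hv).1 q = v q := fun _ => rfl
  set V := SmoothRing.mk (U := baseOpens J) v hv
  have hw : ∀ q : baseOpens I, (lam * pullback Φ hΦ V + mu * coord 1).1 q
      = g.oldFunction σ v q := by
    intro q
    simp only [val_add, val_mul, pullback_apply, hV, ← hnew q, oldFunction]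
    simp [hlam, hmu, hε, hY, hβ, SmoothFn.zero]
  have Φ0 : Φ 0 = T := by rw [hΦdef]; rfl
  have Φ1 : Φ 1 = lam * coord 1 := by rw [hΦdef]; rfl
  have Φ2 : Φ 2 = g.Y₁ • coord 2 := by rw [hΦdef]; rfl
  have P0 : ∀ f, D 0 (pullback Φ hΦ f) = pullback Φ hΦ (D 0 f) * (lam * lam)
      - pullback Φ hΦ (D 1 f) * (mu * lam * coord 1) := by
    intro f
    rw [D_pullback, Fin.sum_univ_three, Φ0, Φ1, Φ2]
    simp [DT, Dlam, D_coord]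
    ring
  have P1 : ∀ f, D 1 (pullback Φ hΦ f) = pullback Φ hΦ (D 1 f) * lam := by
    intro f
    rw [D_pullback, Fin.sum_univ_three, Φ0, Φ1, Φ2]
    simp [DT, Dlam, D_coord]
  have P2 : ∀ f, D 2 (pullback Φ hΦ f) = g.Y₁ • pullback Φ hΦ (D 2 f) := by
    intro f
    rw [D_pullback, Fin.sum_univ_three, Φ0, Φ1, Φ2]
    simp [DT, Dlam, D_coord]
  have hrel : σ'.toFun (g.newTime (p 0)) * lam.1 ⟨p, hp⟩ ^ 3 = g.Y₁ ^ 2 * σ.toFun (p 0) := by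
    have h0 := g.regular _ hp
    have hpos : 0 < g.Δ := g.det_pos
    have h1 : g.Δ ^ (-(3 / 2) : ℝ) * √g.Δ ^ 3 = 1 := by
      rw [Real.sqrt_eq_rpow, ← Real.rpow_natCast, ← Real.rpow_mul hpos.le,
        ← Real.rpow_add hpos]
      norm_num
    rw [h.2 _ hp, hlam, mk_apply, hε]
    field_simp
    linear_combination g.Y₁ ^ 2 * σ.toFun (p 0) * h1
  have hlam0 : lam.1 ⟨p, hp⟩ ≠ 0 := by
    rw [hlam, mk_apply]
    exact div_ne_zero hΔ.ne' (g.regular _ hp)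
  have e1 := gKZK_eq hw σ.toFun ⟨p, hp⟩
  have e2 := gKZK_eq hV σ'.toFun ⟨_, hΦ ⟨p, hp⟩⟩
  simp only [← hnew] at e2
  have e3 : gKZK σ.toFun (g.oldFunction σ v) p
      = lam.1 ⟨p, hp⟩ ^ 4 * gKZK σ'.toFun v (g.newPoint σ p) := by
    rw [e1, e2]
    simp only [Jet.eqn, jetAt, map_add, map_sub, D_mul, P0, P1, P2, Dlam, Dmu, D_coord, D_smul,
      val_add, val_mul]
    have e0 : (Φ 0).1 ⟨p, hp⟩ = g.newTime (p 0) := by rw [Φ0, hT]; rfl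
    simp [pullback_apply, ← hnew, e0]
    have hmem : g.newPoint σ p ∈ baseOpens J := hnew ⟨p, hp⟩ ▸ hΦ ⟨p, hp⟩
    linear_combination (-lam.1 ⟨p, hp⟩ * (D 2 (D 2 V)).1 ⟨g.newPoint σ p, hmem⟩) * hrel
  rw [e3, mul_eq_zero, or_iff_right (pow_ne_zero 4 hlam0)]

end EquivTransf

/-! ### Normal forms -/

/-- Some equivalence transformation takes `σ`, and the equation, to a member of one of the four
families. -/
def HasNormalForm (σ : Coeff I) : Prop :=
  ∃ (F : Family) (J : TopologicalSpace.Opens ℝ) (σ' : Coeff J) (g : EquivTransf I),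
    F.Contains σ' ∧ g.Takes σ σ' ∧ g.MapsEquation σ σ'

/-- Comparison of linear equations of first order: if `F' = m F` and `σ` satisfies the equation
that the pullback of `m` under a Möbius transformation prescribes, then a scaling of `y` turns
`σ` into `± F`. -/
theorem EquivTransf.exists_takes (hI : IsConnected (I : Set ℝ)) (σ : Coeff I) {a b c d : ℝ}
    (hΔ : 0 < a * d - b * c) (hreg : ∀ t ∈ I, c * t + d ≠ 0) {F m : ℝ → ℝ}
    (hF : ∀ t ∈ I, ContDiffAt ℝ ∞ F ((a * t + b) / (c * t + d)))
    (hF0 : ∀ t ∈ I, F ((a * t + b) / (c * t + d)) ≠ 0)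
    (hF' : ∀ t ∈ I, HasDerivAt F
      (m ((a * t + b) / (c * t + d)) * F ((a * t + b) / (c * t + d))) ((a * t + b) / (c * t + d)))
    (hσ : ∀ t ∈ I, (c * t + d) ^ 2 * deriv σ.toFun t
      = (m ((a * t + b) / (c * t + d)) * (a * d - b * c) - 3 * c * (c * t + d)) * σ.toFun t) :
    ∃ (J : TopologicalSpace.Opens ℝ) (σ' : Coeff J) (g : EquivTransf I),
      g.Takes σ σ' ∧ g.MapsEquation σ σ' ∧ ∃ σ₀ : ℝ, (σ₀ = 1 ∨ σ₀ = -1) ∧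
        ∀ s ∈ J, (∃ t ∈ I, s = (a * t + b) / (c * t + d)) ∧ σ'.toFun s = σ₀ * F s := by
  set g₀ : EquivTransf I := EquivTransf.mobius a b c d hΔ hreg 1 one_ne_zero
  -- `σ (ct + d)³` and `F(T)` satisfy the same equation, so that their quotient is constant
  have hquot : ∀ t ∈ I,
      HasDerivAt (fun t => σ.toFun t * (c * t + d) ^ 3 / F (g₀.newTime t)) 0 t := by
    intro t ht
    have h0 := hreg t ht
    have h1 := (hF' t ht).comp t (g₀.hasDerivAt_newTime ht)
    have h2 : HasDerivAt (fun t => c * t + d) c t := by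
      simpa using ((hasDerivAt_id t).const_mul c).add_const d
    refine (((σ.hasDerivAt ht).mul (h2.pow 3)).div h1 (hF0 t ht)).congr_deriv ?_
    rw [div_eq_zero_iff]
    left
    have h3 := hσ t ht
    simp only [Pi.pow_apply, Pi.mul_apply, Function.comp_apply]
    change (deriv σ.toFun t * (c * t + d) ^ 3 + σ.toFun t * (((3 : ℕ) : ℝ) * (c * t + d) ^ 2 * c))
      * F ((a * t + b) / (c * t + d)) - σ.toFun t * (c * t + d) ^ 3
        * (m ((a * t + b) / (c * t + d)) * F ((a * t + b) / (c * t + d))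
          * ((a * d - b * c) / (c * t + d) ^ 2)) = 0
    have h4 : (c * t + d) ^ 3 * ((a * d - b * c) / (c * t + d) ^ 2)
        = (c * t + d) * (a * d - b * c) := by
      field_simp
    push_cast
    linear_combination F ((a * t + b) / (c * t + d)) * (c * t + d) * h3
      - σ.toFun t * m ((a * t + b) / (c * t + d)) * F ((a * t + b) / (c * t + d)) * h4
  obtain ⟨K, hK⟩ := I.isOpen.exists_is_const_of_deriv_eq_zero hI.isPreconnected
    (fun t ht => (hquot t ht).differentiableAt.differentiableWithinAt)
    (fun t ht => (hquot t ht).deriv)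
  have hK' : ∀ t ∈ I, σ.toFun t * (c * t + d) ^ 3 = K * F (g₀.newTime t) := fun t ht =>
    (div_eq_iff (hF0 t ht)).1 (hK t ht)
  have hK0 : K ≠ 0 := by
    obtain ⟨t, ht⟩ := hI.nonempty
    rintro rfl
    have := hK' t ht
    rw [zero_mul] at this
    exact mul_ne_zero (σ.ne_zero t ht) (pow_ne_zero 3 (hreg t ht)) this
  have hpos : 0 < (a * d - b * c) ^ (3 / 2 : ℝ) / |K| :=
    div_pos (Real.rpow_pos_of_pos hΔ _) (abs_pos.2 hK0)
  obtain ⟨σ₀, hσ₀, hK1⟩ : ∃ σ₀ : ℝ, (σ₀ = 1 ∨ σ₀ = -1) ∧ K = σ₀ * |K| := by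
    rcases le_total 0 K with h | h
    · exact ⟨1, Or.inl rfl, by rw [abs_of_nonneg h, one_mul]⟩
    · exact ⟨-1, Or.inr rfl, by rw [abs_of_nonpos h]; ring⟩
  have hσ₀0 : σ₀ ≠ 0 := by rcases hσ₀ with rfl | rfl <;> norm_num
  let J : TopologicalSpace.Opens ℝ := ⟨g₀.newTime '' I, g₀.isOpen_image_newTime⟩
  let σ' : Coeff J :=
    { toFun := fun s => σ₀ * F s
      smooth := by
        rintro _ ⟨t, ht, rfl⟩
        exact (contDiffAt_const.mul (hF t ht)).contDiffWithinAt
      ne_zero := by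
        rintro _ ⟨t, ht, rfl⟩
        exact mul_ne_zero hσ₀0 (hF0 t ht) }
  let g : EquivTransf I := EquivTransf.mobius a b c d hΔ hreg
    √((a * d - b * c) ^ (3 / 2 : ℝ) / |K|) (Real.sqrt_pos.2 hpos).ne'
  have hT : g.Takes σ σ' := by
    refine ⟨rfl, fun t ht => ?_⟩
    change σ₀ * F (g₀.newTime t) = 1 * (a * d - b * c) ^ (-(3 / 2) : ℝ)
      * √((a * d - b * c) ^ (3 / 2 : ℝ) / |K|) ^ 2 * (c * t + d) ^ 3 * σ.toFun t
    rw [Real.sq_sqrt hpos.le, mul_assoc _ _ (σ.toFun t), mul_comm _ (σ.toFun t), hK' t ht,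
      Real.rpow_neg hΔ.le]
    have h1 := (Real.rpow_pos_of_pos hΔ (3 / 2)).ne'
    have h2 := abs_ne_zero.2 hK0
    field_simp
    rw [hK1, abs_mul, abs_abs]
    rcases hσ₀ with rfl | rfl <;> simp
  refine ⟨J, σ', g, hT, g.mapsEquation_of_eq_zero rfl rfl rfl hT, σ₀, hσ₀, ?_⟩
  rintro _ ⟨t, ht, rfl⟩
  exact ⟨⟨t, ht, rfl⟩, rfl⟩

/-- A continuous function on `I` vanishes as soon as its product with a nonzero affine function
does. -/
theorem eq_zero_of_affine_mul_eq_zero {ψ : ℝ → ℝ} (hψ : ContinuousOn ψ I) {a b : ℝ}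
    (hab : a ≠ 0 ∨ b ≠ 0) (h : ∀ t ∈ I, (a * t + b) * ψ t = 0) : ∀ t ∈ I, ψ t = 0 := by
  by_contra! hcon
  obtain ⟨t, ht, h0⟩ := hcon
  let U : TopologicalSpace.Opens ℝ := ⟨I ∩ ψ ⁻¹' {0}ᶜ,
    hψ.isOpen_inter_preimage I.isOpen isOpen_compl_singleton⟩
  obtain ⟨-, -, h1, h2⟩ := cubic_eq_zero (I := U) (a := 0) (b := 0) (c := a) (d := b) ⟨t, ht, h0⟩
    fun s hs => by
      have := (mul_eq_zero.1 (h s hs.1)).resolve_right hs.2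
      linarith
  exact hab.elim (fun h => h h1) (fun h => h h2)

theorem Coeff.continuousOn_first_order (σ : Coeff I) (c d e : ℝ) :
    ContinuousOn (fun t => (c * t + d) * deriv σ.toFun t + e * σ.toFun t) I :=
  ((by fun_prop : Continuous fun t : ℝ => c * t + d).continuousOn.mul
    (contDiffOn_deriv σ.smooth).continuousOn).add (continuousOn_const.mul σ.smooth.continuousOn)

/-- If `σ (ct + d)³` is constant, then `σ` is equivalent to `± 1`. -/
theorem hasNormalForm_of_cube (hI : IsConnected (I : Set ℝ)) (σ : Coeff I) {c d : ℝ}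
    (hcd : c ≠ 0 ∨ d ≠ 0) (h : ∀ t ∈ I, (c * t + d) * deriv σ.toFun t + 3 * c * σ.toFun t = 0) :
    HasNormalForm σ := by
  have hreg : ∀ t ∈ I, c * t + d ≠ 0 := by
    intro t ht h0
    have h1 := h t ht
    rw [h0, zero_mul, zero_add, mul_eq_zero, or_iff_left (σ.ne_zero t ht)] at h1
    have hc : c = 0 := by linarith
    rw [hc, zero_mul, zero_add] at h0
    exact hcd.elim (fun h => h hc) (fun h => h h0)
  -- any new time with denominator `ct + d` will do, for example `(dt - c) / (ct + d)`
  have hΔ : 0 < d * d - (-c) * c := by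
    rcases hcd with h | h
    · nlinarith [sq_pos_of_ne_zero h, sq_nonneg d]
    · nlinarith [sq_pos_of_ne_zero h, sq_nonneg c]
  obtain ⟨J, σ', g, hT, hM, σ₀, hσ₀, hs⟩ := EquivTransf.exists_takes hI σ hΔ hreg
    (F := fun _ => 1) (m := fun _ => 0) (fun _ _ => contDiffAt_const) (fun _ _ => one_ne_zero)
    (fun t _ => by simpa using hasDerivAt_const _ _)
    (fun t ht => by linear_combination (c * t + d) * h t ht)
  exact ⟨.constant, J, σ', g, ⟨σ₀, hσ₀, fun s hJ => by rw [(hs s hJ).2, mul_one]⟩, hT, hM⟩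

/-- A nonvanishing affine function has a constant sign on the interval `I`. -/
theorem exists_sign_mul_affine_pos (hI : IsConnected (I : Set ℝ)) {a b : ℝ}
    (h : ∀ t ∈ I, a * t + b ≠ 0) :
    ∃ e : ℝ, (e = 1 ∨ e = -1) ∧ ∀ t ∈ I, 0 < e * a * t + e * b := by
  have hc : ContinuousOn (fun t => a * t + b) I := by fun_prop
  obtain ⟨t₀, ht₀⟩ := hI.nonempty
  rcases lt_or_gt_of_ne (h t₀ ht₀) with h0 | h0
  · refine ⟨-1, Or.inr rfl, fun t ht => ?_⟩
    by_contra! hcon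
    obtain ⟨s, hs, hs0⟩ := hI.isPreconnected.intermediate_value ht₀ ht hc
      (show (0 : ℝ) ∈ Icc (a * t₀ + b) (a * t + b) from ⟨h0.le, by linarith⟩)
    exact h s hs hs0
  · refine ⟨1, Or.inl rfl, fun t ht => ?_⟩
    by_contra! hcon
    obtain ⟨s, hs, hs0⟩ := hI.isPreconnected.intermediate_value ht ht₀ hc
      (show (0 : ℝ) ∈ Icc (a * t + b) (a * t₀ + b) from ⟨by linarith, h0.le⟩)
    exact h s hs hs0

/-- Two distinct real roots, both outside `I`: here `σ` is a constant multiple of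
`(at + b)^p (ct + d)^(-3 - p)`, which becomes `± T^p` in the new time `T = (at + b) / (ct + d)`.
The exponents `0` and `-3` lead to the constant family. -/
theorem hasNormalForm_of_pos (hI : IsConnected (I : Set ℝ)) (σ : Coeff I) {a b c d k : ℝ}
    (hΔ : 0 < a * d - b * c) (h1 : ∀ t ∈ I, 0 < a * t + b) (h2 : ∀ t ∈ I, 0 < c * t + d)
    (h : ∀ t ∈ I, (a * t + b) * (c * t + d) * deriv σ.toFun t
      + 3 / 2 * (a * (c * t + d) + c * (a * t + b)) * σ.toFun t = 2 * k * σ.toFun t) :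
    HasNormalForm σ := by
  obtain ⟨p, hp⟩ : ∃ p, p = 2 * k / (a * d - b * c) - 3 / 2 := ⟨_, rfl⟩
  have hpΔ : p * (a * d - b * c) = 2 * k - 3 / 2 * (a * d - b * c) := by
    rw [hp]
    field_simp
  by_cases h3 : p = -3
  · refine hasNormalForm_of_cube hI σ (c := a) (d := b) ?_ fun t ht => ?_
    · by_contra! hcon
      simp [hcon.1, hcon.2] at hΔ
    · have h2' := (h2 t ht).ne'
      rw [h3] at hpΔ
      refine (mul_right_inj' h2').1 ?_
      linear_combination h t ht - σ.toFun t * hpΔ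
  have hT : ∀ t ∈ I, 0 < (a * t + b) / (c * t + d) := fun t ht => div_pos (h1 t ht) (h2 t ht)
  obtain ⟨J, σ', g, hT', hM, σ₀, hσ₀, hs⟩ := EquivTransf.exists_takes hI σ hΔ
    (fun t ht => (h2 t ht).ne') (F := fun s => s ^ p) (m := fun s => p / s)
    (fun t ht => Real.contDiffAt_rpow_const_of_ne (hT t ht).ne')
    (fun t ht => (Real.rpow_pos_of_pos (hT t ht) p).ne')
    (fun t ht => hasDerivAt_rpow_of_pos p (hT t ht))
    (fun t ht => by
      have e1 := (h1 t ht).ne'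
      have e2 := (h2 t ht).ne'
      have e3 : p / ((a * t + b) / (c * t + d)) * (a * t + b) = p * (c * t + d) := by
        field_simp
      refine mul_right_cancel₀ e1 ?_
      linear_combination (c * t + d) * h t ht - (c * t + d) * σ.toFun t * hpΔ
        - (a * d - b * c) * σ.toFun t * e3)
  by_cases h0 : p = 0
  · refine ⟨.constant, J, σ', g, ⟨σ₀, hσ₀, fun s hJ => ?_⟩, hT', hM⟩
    rw [(hs s hJ).2, h0, Real.rpow_zero, mul_one]
  · refine ⟨.power, J, σ', g, ⟨p, h0, h3, σ₀, hσ₀, fun s hJ => ⟨?_, (hs s hJ).2⟩⟩, hT', hM⟩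
    obtain ⟨t, ht, rfl⟩ := (hs s hJ).1
    exact hT t ht

/-- Two distinct real roots, the first of them in `I`: as `σ` does not vanish there, `k` is
determined, and `σ (ct + d)³` is constant. -/
theorem hasNormalForm_of_root (hI : IsConnected (I : Set ℝ)) (σ : Coeff I) {a b c d k r : ℝ}
    (hΔ : a * d - b * c ≠ 0) (hr : r ∈ I) (hr0 : a * r + b = 0)
    (h : ∀ t ∈ I, (a * t + b) * (c * t + d) * deriv σ.toFun t
      + 3 / 2 * (a * (c * t + d) + c * (a * t + b)) * σ.toFun t = 2 * k * σ.toFun t) :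
    HasNormalForm σ := by
  have hk : 2 * k = 3 / 2 * (a * d - b * c) := by
    have h1 := h r hr
    refine mul_right_cancel₀ (σ.ne_zero r hr) ?_
    linear_combination -h1 + ((c * r + d) * deriv σ.toFun r + 3 * c * σ.toFun r) * hr0
  refine hasNormalForm_of_cube hI σ (c := c) (d := d) ?_ ?_
  · by_contra! hcon
    simp [hcon.1, hcon.2] at hΔ
  · refine eq_zero_of_affine_mul_eq_zero (σ.continuousOn_first_order c d (3 * c)) (a := a)
      (b := b) ?_ fun t ht => ?_
    · by_contra! hcon
      simp [hcon.1, hcon.2] at hΔ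
    · linear_combination h t ht + σ.toFun t * hk

/-- Two distinct real roots. -/
theorem hasNormalForm_hyperbolic (hI : IsConnected (I : Set ℝ)) (σ : Coeff I) {a b c d k : ℝ}
    (hΔ : a * d - b * c ≠ 0)
    (h : ∀ t ∈ I, (a * t + b) * (c * t + d) * deriv σ.toFun t
      + 3 / 2 * (a * (c * t + d) + c * (a * t + b)) * σ.toFun t = 2 * k * σ.toFun t) :
    HasNormalForm σ := by
  by_cases h1 : ∃ r ∈ I, a * r + b = 0
  · obtain ⟨r, hr, hr0⟩ := h1
    exact hasNormalForm_of_root hI σ hΔ hr hr0 h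
  by_cases h2 : ∃ r ∈ I, c * r + d = 0
  · obtain ⟨r, hr, hr0⟩ := h2
    exact hasNormalForm_of_root hI σ (a := c) (b := d) (c := a) (d := b) (k := k)
      (fun h => hΔ (by linear_combination -h)) hr hr0
      fun t ht => by linear_combination h t ht
  push Not at h1 h2
  obtain ⟨e, he, h1⟩ := exists_sign_mul_affine_pos hI h1
  obtain ⟨f, hf, h2⟩ := exists_sign_mul_affine_pos hI h2
  have hef : e * f ≠ 0 := by rcases he with rfl | rfl <;> rcases hf with rfl | rfl <;> norm_num
  have hΔ' : e * f * (a * d - b * c) ≠ 0 := mul_ne_zero hef hΔ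
  rcases lt_or_gt_of_ne hΔ' with h0 | h0
  · -- the two roots change places, which reverses the sign of the determinant
    exact hasNormalForm_of_pos hI σ (a := f * c) (b := f * d) (c := e * a) (d := e * b)
      (k := e * f * k) (by linarith) h2 h1 fun t ht => by linear_combination e * f * h t ht
  · exact hasNormalForm_of_pos hI σ (a := e * a) (b := e * b) (c := f * c) (d := f * d)
      (k := e * f * k) (by linarith) h1 h2 fun t ht => by linear_combination e * f * h t ht

/-- A double root: here `σ (ct + d)³` is the exponential of a Möbius transformation of `t`. -/
theorem hasNormalForm_parabolic (hI : IsConnected (I : Set ℝ)) (σ : Coeff I) {c d k : ℝ}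
    (hcd : c ≠ 0 ∨ d ≠ 0)
    (h : ∀ t ∈ I, (c * t + d) ^ 2 * deriv σ.toFun t + 3 * c * (c * t + d) * σ.toFun t
      = 2 * k * σ.toFun t) : HasNormalForm σ := by
  by_cases hk : k = 0
  · refine hasNormalForm_of_cube hI σ hcd (eq_zero_of_affine_mul_eq_zero
      (σ.continuousOn_first_order c d (3 * c)) hcd fun t ht => ?_)
    have := h t ht
    rw [hk] at this
    linear_combination this
  have hreg : ∀ t ∈ I, c * t + d ≠ 0 := by
    intro t ht h0
    have h1 := h t ht
    rw [h0] at h1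
    exact mul_ne_zero (mul_ne_zero two_ne_zero hk) (σ.ne_zero t ht) (by linear_combination -h1)
  have hN : 0 < c ^ 2 + d ^ 2 := by
    rcases hcd with h | h <;> positivity
  obtain ⟨κ, hκ, hk1⟩ : ∃ κ : ℝ, (κ = 1 ∨ κ = -1) ∧ 0 < κ * k := by
    rcases lt_or_gt_of_ne hk with h | h
    · exact ⟨-1, Or.inr rfl, by linarith⟩
    · exact ⟨1, Or.inl rfl, by linarith⟩
  have hκ2 : κ * κ = 1 := by rcases hκ with rfl | rfl <;> norm_num
  -- the new time has determinant `2|k|`, which makes the rate of the exponential `±1`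
  have hΔ : (2 * (κ * k) * d / (c ^ 2 + d ^ 2)) * d - (-(2 * (κ * k) * c / (c ^ 2 + d ^ 2))) * c
      = 2 * (κ * k) := by
    field_simp
    ring
  obtain ⟨J, σ', g, hT, hM, σ₀, hσ₀, hs⟩ := EquivTransf.exists_takes hI σ
    (by rw [hΔ]; linarith) hreg (F := fun s => Real.exp (κ * s)) (m := fun _ => κ)
    (fun t ht => by fun_prop) (fun t ht => Real.exp_ne_zero _)
    (fun t ht => hasDerivAt_exp_mul κ _)
    (fun t ht => by
      rw [hΔ]
      linear_combination h t ht - 2 * k * σ.toFun t * hκ2)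
  exact ⟨.exponential, J, σ', g, ⟨κ, hκ, σ₀, hσ₀, fun s hJ => (hs s hJ).2⟩, hT, hM⟩

/-- No real roots: the new time is `(t + p) / w`. -/
theorem hasNormalForm_elliptic (hI : IsConnected (I : Set ℝ)) (σ : Coeff I) {p w k : ℝ}
    (hw : 0 < w)
    (h : ∀ t ∈ I, ((t + p) ^ 2 + w ^ 2) * deriv σ.toFun t + 3 * (t + p) * σ.toFun t
      = 2 * k * σ.toFun t) : HasNormalForm σ := by
  obtain ⟨J, σ', g, hT, hM, σ₀, hσ₀, hs⟩ := EquivTransf.exists_takes hI σ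
    (a := 1) (b := p) (c := 0) (d := w) (by linarith) (fun t ht => by linarith)
    (F := fun s => (1 + s ^ 2) ^ (-(3 / 2) : ℝ) * Real.exp (2 * k / w * Real.arctan s))
    (m := fun s => (2 * k / w - 3 * s) / (1 + s ^ 2))
    (fun t ht => by
      refine ContDiffAt.mul (ContDiffAt.rpow_const_of_ne (by fun_prop) (by positivity)) ?_
      exact (contDiffAt_const.mul Real.contDiff_arctan.contDiffAt).exp)
    (fun t ht => by positivity)
    (fun t ht => hasDerivAt_arctan_profile _ _)
    (fun t ht => by
      have h1 : 1 + ((1 * t + p) / (0 * t + w)) ^ 2 ≠ 0 := by positivity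
      have h2 : w ^ 2 + (t + p) ^ 2 ≠ 0 := by positivity
      have h3 := h t ht
      simp only [one_mul, zero_mul, zero_add, mul_zero, sub_zero]
      have h4 : (2 * k / w - 3 * ((t + p) / w)) / (1 + ((t + p) / w) ^ 2) * w
          = w ^ 2 * (2 * k - 3 * (t + p)) / (w ^ 2 + (t + p) ^ 2) := by
        field_simp
      rw [h4]
      field_simp
      linear_combination h3)
  exact ⟨.arctangent, J, σ', g, ⟨2 * k / w, σ₀, hσ₀, fun s hJ => by
    rw [(hs s hJ).2, mul_assoc]⟩, hT, hM⟩

/-- Every coefficient with a nonzero admissible polynomial has a normal form.  The type of the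
polynomial decides on the family. -/
theorem Admissible.hasNormalForm (hI : IsConnected (I : Set ℝ)) {σ : Coeff I} {A B C k : ℝ}
    (h : Admissible σ A B C k) (h0 : A ≠ 0 ∨ B ≠ 0 ∨ C ≠ 0) : HasNormalForm σ := by
  by_cases hA : A = 0
  · subst hA
    by_cases hB : B = 0
    · subst hB
      have hC : C ≠ 0 := by simpa using h0
      refine hasNormalForm_parabolic hI σ (c := 0) (d := 1) (k := k / C) (Or.inr one_ne_zero)
        fun t ht => ?_
      have := h t ht
      field_simp
      linear_combination this
    · exact hasNormalForm_hyperbolic hI σ (a := B) (b := C) (c := 0) (d := 1) (k := k)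
        (by simpa using hB) fun t ht => by linear_combination h t ht
  obtain ⟨p, hp⟩ : ∃ p, B = 2 * A * p := ⟨B / (2 * A), by field_simp⟩
  obtain ⟨q, hq⟩ : ∃ q, C = A * q := ⟨C / A, by field_simp⟩
  obtain ⟨l, hl⟩ : ∃ l, k = A * l := ⟨k / A, by field_simp⟩
  subst hp hq hl
  have key : ∀ t ∈ I, ((t + p) ^ 2 + (q - p ^ 2)) * deriv σ.toFun t + 3 * (t + p) * σ.toFun t
      = 2 * l * σ.toFun t := fun t ht => by
    refine (mul_right_inj' hA).1 ?_
    linear_combination h t ht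
  rcases lt_trichotomy (q - p ^ 2) 0 with hneg | hzero | hpos
  · have hs : 0 < √(p ^ 2 - q) := Real.sqrt_pos.2 (by linarith)
    have hs2 : √(p ^ 2 - q) ^ 2 = p ^ 2 - q := Real.sq_sqrt (by linarith)
    refine hasNormalForm_hyperbolic hI σ (a := 1) (b := p + √(p ^ 2 - q)) (c := 1)
      (d := p - √(p ^ 2 - q)) (k := l) (fun h => hs.ne' (by linarith)) fun t ht => ?_
    linear_combination key t ht - deriv σ.toFun t * hs2
  · refine hasNormalForm_parabolic hI σ (c := 1) (d := p) (k := l) (Or.inl one_ne_zero)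
      fun t ht => ?_
    linear_combination key t ht - deriv σ.toFun t * hzero
  · refine hasNormalForm_elliptic hI σ (p := p) (w := √(q - p ^ 2)) (k := l)
      (Real.sqrt_pos.2 hpos) fun t ht => ?_
    rw [Real.sq_sqrt hpos.le]
    exact key t ht

end

theorem mainTheorem2 (I : TopologicalSpace.Opens ℝ) (hI : IsConnected (I : Set ℝ)) (σ : Coeff I) :
    -- the point symmetries form a Lie algebra, containing the algebra spanned by `X(f)`, `Y(g)`
    -- as an ideal, and the latter is nilpotent and infinite-dimensional
    ((symmetryAlgebra σ : Set (VF I)) = {V | IsPointSymmetry σ V} ∧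
      (genericAlgebra σ).toSubmodule = Submodule.span ℝ (genericFields σ) ∧
      LieRing.IsNilpotent (genericAlgebra σ) ∧
      ¬ Module.Finite ℝ (genericAlgebra σ) ∧
      ∃ S : LieSubalgebra ℝ (VF I),
        IsSemidirectSum (symmetryAlgebra σ) S (genericAlgebra σ)) ∧
    -- the algebra is extended only if the equation is equivalent to one of the list
    (symmetryAlgebra σ ≠ genericAlgebra σ →
      ∃ (F : Family) (J : TopologicalSpace.Opens ℝ) (σ' : Coeff J) (g : EquivTransf I),
        F.Contains σ' ∧ g.Takes σ σ' ∧ g.MapsEquation σ σ') ∧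
    -- the algebra is extended if the equation is equivalent to one of the list
    (∀ (F : Family) (J : TopologicalSpace.Opens ℝ) (σ' : Coeff J) (g : EquivTransf I),
      F.Contains σ' → g.Takes σ σ' → symmetryAlgebra σ ≠ genericAlgebra σ) ∧
    -- different families are inequivalent
    (∀ (F F' : Family) (J J' : TopologicalSpace.Opens ℝ) (σ' : Coeff J) (σ'' : Coeff J')
      (g g' : EquivTransf I), F.Contains σ' → F'.Contains σ'' → g.Takes σ σ' → g'.Takes σ σ'' →
        F = F') ∧
    -- the symmetry algebras of the representatives
    (IsConstantCase σ → IsExtendedBy σ ![fieldT0 I, fieldD I 0]) ∧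
    (∀ s : ℝ, s ≠ 0 → s ≠ -3 → IsPowerCase σ s → IsExtendedBy σ ![fieldD I s]) ∧
    (∀ κ : ℝ, (κ = 1 ∨ κ = -1) → IsExpCase σ κ → IsExtendedBy σ ![fieldT I κ]) ∧
    (∀ s : ℝ, IsArctanCase σ s → IsExtendedBy σ ![fieldC I s]) := by
  refine ⟨⟨?_, genericAlgebra_toSubmodule σ, ?_, ?_, complement hI.nonempty σ,
      isSemidirectSum_complement hI σ⟩, ?_,
    fun F J σ' g hF h => h.symmetryAlgebra_ne hI hF,
    fun F F' J J' σ' σ'' g g' hF hF' h h' => h.family_eq hI.nonempty hF hF' h',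
    isExtendedBy_constant hI, fun s h0 h3 => isExtendedBy_power hI h0 h3,
    fun κ hκ => isExtendedBy_exp hI hκ, fun s => isExtendedBy_arctan hI⟩
  · rw [symmetryAlgebra_eq hI]
    rfl
  · rw [genericAlgebra_eq]
    exact isNilpotent_genericIdeal σ
  · rw [genericAlgebra_eq]
    exact not_finite_genericIdeal σ hI.nonempty
  · intro hne
    obtain ⟨A, B, C, k, h, h0⟩ := (symmetryAlgebra_ne_iff hI σ).1 hne
    exact h.hasNormalForm hI h0
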